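/- Let $F$ be a field, let $L$ be a quadratic étale $F$-algebra (i.e. étale of dimension $2$; $L=F\times F$ is allowed), and let $N$ be a free $L$-module of finite rank. Let $\mathbb{P}_F(N)$ be the $F$-scheme of lines in the $F$-vector space $N$, let $\mathbb{P}_L(N)$ be the $L$-scheme of $L$-lines in $N$, and let $\mathbb{P}(N,L)=\mathrm{tr}_{L/F}\,\mathbb{P}_L(N)$ be its Weil restriction, the $F$-scheme representing $T\mapsto \mathrm{Hom}_L(T\times_F L,\mathbb{P}_L(N))$ (which exists). Let $S(N)\subset\mathbb{P}_F(N)$ be the set of points at which the line $[m]$ has a nonzero annihilator in $L$; here $m\in K\otimes_F N$ for an extension field $K/F$, and the annihilator is taken in $L\otimes_F K$. Then $S(N)$ is closed, with dense open complement $U$, and there is a morphism $f_N\colon U\to\mathbb{P}(N,L)$ of $F$-schemes, i.e. a rational map $\mathbb{P}_F(N)\dashrightarrow\mathbb{P}(N,L)$, sending a line $l$ to its $L$-span $Ll$ (on points with values in every commutative $F$-algebra). Give $S(N)$ the reduced scheme structure and let $\pi\colon Bl_{S(N)}\mathbb{P}_F(N)\to\mathbb{P}_F(N)$ be the blow-up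 of $\mathbb{P}_F(N)$ along $S(N)$ (which exists). Then there is a unique morphism of $F$-schemes $$g_N\colon Bl_{S(N)}\mathbb{P}_F(N)\to\mathbb{P}(N,L)$$ that extends $f_N$, i.e. $g_N=f_N\circ\pi$ on $\pi^{-1}(U)$. Moreover $g_N$ is a projective bundle of rank $1$: it is isomorphic over $\mathbb{P}(N,L)$ to the $\mathbb{P}^1$-bundle $\mathbb{P}(E)$ of a vector bundle $E$ of rank $2$ on $\mathbb{P}(N,L)$. -/

import Mathlib

open CategoryTheory Limits AlgebraicGeometry TensorProduct

universe u

namespace LineSpan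

/-! ### Projective spaces of lines -/

section ProjectiveSpace

variable (R M : Type u) [CommRing R] [AddCommGroup M] [Module R M]

/-- The grading of the symmetric algebra: the degree `i` part is the `i`-th power of the
submodule generated by the degree one elements. -/
abbrev symGrading (i : ℕ) : Submodule R (SymmetricAlgebra R M) :=
  LinearMap.range (SymmetricAlgebra.ι R M) ^ i

open scoped DirectSum in
/-- The degree one inclusion into the graded pieces (auxiliary). -/
noncomputable def symGradingι : M →ₗ[R] ⨁ i : ℕ, symGrading R M i :=
  DirectSum.lof R ℕ (fun i => symGrading R M i) 1 ∘ₗ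
    (SymmetricAlgebra.ι R M).codRestrict _ fun m => by
      simpa only [symGrading, pow_one] using LinearMap.mem_range_self _ m

theorem symGradingι_apply (m : M) :
    symGradingι R M m =
      DirectSum.of (fun i : ℕ => symGrading R M i) 1
        ⟨SymmetricAlgebra.ι R M m, by
          simpa only [symGrading, pow_one] using LinearMap.mem_range_self _ m⟩ :=
  rfl

noncomputable instance symGradedAlgebra : GradedAlgebra (symGrading R M) :=
  GradedAlgebra.ofAlgHom _ (SymmetricAlgebra.lift (symGradingι R M))
    (by
      ext m
      change DirectSum.coeAlgHom (symGrading R M)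
        (SymmetricAlgebra.lift (symGradingι R M) (SymmetricAlgebra.ι R M m)) =
          SymmetricAlgebra.ι R M m
      rw [SymmetricAlgebra.lift_ι_apply, symGradingι_apply, DirectSum.coeAlgHom_of])
    fun i x => by
    obtain ⟨x, hx⟩ := x
    dsimp only [Subtype.coe_mk, DirectSum.lof_eq_of]
    induction hx using Submodule.pow_induction_on_left' with
    | algebraMap r =>
      rw [AlgHom.commutes, DirectSum.algebraMap_apply]; rfl
    | add x y i hx hy ihx ihy =>
      rw [map_add, ihx, ihy, ← map_add]
      rfl
    | mem_mul m hm i x hx ih =>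
      obtain ⟨_, rfl⟩ := hm
      rw [map_mul, ih, SymmetricAlgebra.lift_ι_apply, symGradingι_apply, DirectSum.of_mul_of]
      exact DirectSum.of_eq_of_gradedMonoid_eq (Sigma.subtype_ext (add_comm _ _) rfl)

/-- The projective space `ℙ_R(M) = Proj (Sym (M^∨))` of lines in a finite free `R`-module `M`,
as a scheme over `Spec R`. -/
noncomputable def projSpace : Over (Spec (.of R)) :=
  Over.mk (Proj.toSpecZero (symGrading R (Module.Dual R M)) ≫
    Spec.map (CommRingCat.ofHom (algebraMap R (symGrading R (Module.Dual R M) 0))))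

variable (A : Type u) [CommRing A] [Algebra R A]

/-- `Spec A` as a scheme over `Spec R`. -/
noncomputable def specOver : Over (Spec (.of R)) :=
  Over.mk (Spec.map (CommRingCat.ofHom (algebraMap R A)))

variable {R M A}

/-- For `v ∈ A ⊗ M`, the map `M^∨ → A` that sends a linear form `φ` to `(1 ⊗ φ)(v)`. -/
noncomputable def evalDual (v : A ⊗[R] M) : Module.Dual R M →ₗ[R] A :=
  (TensorProduct.rid R A).toLinearMap ∘ₗ (LinearMap.lTensorHom A).flip v

/-- A vector `v ∈ A ⊗ M` is unimodular if its coordinates generate the unit ideal. For finite free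
`M` this means exactly that `v` is a basis of a direct summand `A v ⊆ A ⊗ M` of rank one, i.e.
of a family of lines over `Spec A`; for a field `A` it means `v ≠ 0`. -/
def Unimodular (v : A ⊗[R] M) : Prop :=
  Ideal.span (Set.range (evalDual v)) = ⊤

/-- The homomorphism `Sym (M^∨) → A` evaluating polynomial functions at `v ∈ A ⊗ M`. -/
noncomputable def evalSym (v : A ⊗[R] M) : SymmetricAlgebra R (Module.Dual R M) →ₐ[R] A :=
  SymmetricAlgebra.lift (evalDual v)

theorem map_irrelevant_eq_top {v : A ⊗[R] M} (hv : Unimodular v) :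
    (HomogeneousIdeal.irrelevant (symGrading R (Module.Dual R M))).toIdeal.map
      ((Scheme.ΓSpecIso (.of A)).inv.hom.comp (evalSym v).toRingHom) = ⊤ := by
  have h1 : (HomogeneousIdeal.irrelevant (symGrading R (Module.Dual R M))).toIdeal.map
      (evalSym v).toRingHom = ⊤ := by
    rw [eq_top_iff, ← (hv : Ideal.span _ = ⊤), Ideal.span_le]
    rintro _ ⟨φ, rfl⟩
    have hφ : SymmetricAlgebra.ι R (Module.Dual R M) φ ∈
        symGrading R (Module.Dual R M) 1 := by
      simpa only [symGrading, pow_one] using LinearMap.mem_range_self _ φ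
    have : evalDual v φ = (evalSym v).toRingHom (SymmetricAlgebra.ι R (Module.Dual R M) φ) :=
      (SymmetricAlgebra.lift_ι_apply (evalDual v) φ).symm
    rw [this]
    refine Ideal.mem_map_of_mem _ ?_
    exact HomogeneousIdeal.mem_irrelevant_of_mem _ one_pos hφ
  rw [← Ideal.map_map, h1, Ideal.map_top]

/-- The morphism underlying `point`. -/
noncomputable def pointHom (v : A ⊗[R] M) (hv : Unimodular v) :
    Spec (.of A) ⟶ Proj (symGrading R (Module.Dual R M)) :=
  Proj.fromOfGlobalSections _ ((Scheme.ΓSpecIso (.of A)).inv.hom.comp (evalSym v).toRingHom)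
    (map_irrelevant_eq_top hv)

theorem pointHom_comp (v : A ⊗[R] M) (hv : Unimodular v) :
    pointHom v hv ≫ (projSpace R M).hom = Spec.map (CommRingCat.ofHom (algebraMap R A)) := by
  change Proj.fromOfGlobalSections _ _ _ ≫ Proj.toSpecZero _ ≫ _ = _
  rw [Proj.fromOfGlobalSections_toSpecZero_assoc]
  rw [← Spec.map_comp, ← CommRingCat.ofHom_comp]
  have : CommRingCat.ofHom (((((Scheme.ΓSpecIso (.of A)).inv.hom.comp (evalSym v).toRingHom).comp
      (algebraMap (symGrading R (Module.Dual R M) 0) _)).comp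
      (algebraMap R (symGrading R (Module.Dual R M) 0)))) =
      CommRingCat.ofHom (algebraMap R A) ≫ (Scheme.ΓSpecIso (.of A)).inv := by
    ext x
    exact congrArg (Scheme.ΓSpecIso (.of A)).inv.hom ((evalSym v).commutes x)
  rw [this, Spec.map_comp, toSpecΓ_SpecMap_ΓSpecIso_inv_assoc]

/-- The `A`-valued point `[v]` of `ℙ_R(M)`: the line generated by the unimodular vector `v`. -/
noncomputable def point (v : A ⊗[R] M) (hv : Unimodular v) : specOver R A ⟶ projSpace R M :=
  Over.homMk (pointHom v hv) (pointHom_comp v hv)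

end ProjectiveSpace

/-! ### Blow-ups -/

section Blowup

/-- An ideal sheaf is invertible if it is locally generated by one nonzerodivisor, i.e. if it
defines an effective Cartier divisor. -/
def IsInvertibleIdeal {X : Scheme.{u}} (I : X.IdealSheafData) : Prop :=
  ∀ x : X, ∃ V : X.affineOpens, x ∈ V.1 ∧
    ∃ a ∈ nonZeroDivisors Γ(X, V), I.ideal V = Ideal.span {a}

/-- `π : B ⟶ X` is the blow-up of `X` along the closed subscheme defined by `I`: the inverse image
ideal sheaf `I · 𝒪_B` is invertible, and `π` is universal for this property. -/
structure IsBlowup {X B : Scheme.{u}} (I : X.IdealSheafData) (π : B ⟶ X) : Prop where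
  isInvertible : IsInvertibleIdeal (I.comap π)
  existsUnique_lift : ∀ (T : Scheme.{u}) (h : T ⟶ X), IsInvertibleIdeal (I.comap h) →
    ∃! t : T ⟶ B, t ≫ π = h

end Blowup

/-! ### Projective bundles -/

section ProjectiveBundle

/-- The pull-back of a function on the open subset `V` of `Y` along `s : Spec A ⟶ V`. -/
noncomputable def pullFun {Y : Scheme.{u}} {V : Y.Opens} {A : Type u} [CommRing A]
    (s : Spec (.of A) ⟶ V.toScheme) : Γ(Y, V) →+* A :=
  (V.topIso.inv ≫ s.appTop ≫ (Scheme.ΓSpecIso (.of A)).hom).hom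

/-- The vector of `A ⊗ F^{r+1}` with the given coordinates. -/
noncomputable def vec (F : Type u) [Field F] {A : Type u} [CommRing A] [Algebra F A] {r : ℕ}
    (w : Fin (r + 1) → A) : A ⊗[F] (Fin (r + 1) → F) :=
  (TensorProduct.piScalarRight F F A (Fin (r + 1))).symm w

/-- `p : X ⟶ Y` is (isomorphic over `Y` to) the projective bundle `ℙ(E)` of a vector bundle `E`
of rank `r + 1` on the `F`-scheme `Y`: there are an open cover `U i` of `Y`, a cocycle
`g i j ∈ GL_{r+1}(Γ(U i ∩ U j))` (the transition matrices of `E`), and isomorphisms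
`U i × ℙ^r ≅ p⁻¹(U i)` over `U i` (given as morphisms `ψ i : U i × ℙ^r ⟶ X` that are base changes
of `U i ⟶ Y`) that are glued by the cocycle: `ψ j (t, [w]) = ψ i (t, [g i j (t) w])`
on all points `(t, [w])` with values in an `F`-algebra, where `t ∈ U i ∩ U j`. -/
def IsProjectiveBundle (F : Type u) [Field F] (r : ℕ) {X Y : Over (Spec (.of F))} (p : X ⟶ Y) :
    Prop :=
  ∃ (ι : Type u) (U : ι → Y.left.Opens)
    (g : ∀ i j, Matrix (Fin (r + 1)) (Fin (r + 1)) Γ(Y.left, U i ⊓ U j))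
    (ψ : ∀ i, pullback ((U i).ι ≫ Y.hom) (projSpace F (Fin (r + 1) → F)).hom ⟶ X.left),
    (⨆ i, U i = ⊤) ∧
    (∀ i j, IsUnit (g i j)) ∧
    (∀ i j k,
      (g i j).map (Y.left.presheaf.map (homOfLE (inf_le_left : U i ⊓ U j ⊓ U k ≤ U i ⊓ U j)).op) *
      (g j k).map (Y.left.presheaf.map (homOfLE (le_inf (inf_le_left.trans inf_le_right)
        inf_le_right : U i ⊓ U j ⊓ U k ≤ U j ⊓ U k)).op) =
      (g i k).map (Y.left.presheaf.map (homOfLE (le_inf (inf_le_left.trans inf_le_left)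
        inf_le_right : U i ⊓ U j ⊓ U k ≤ U i ⊓ U k)).op)) ∧
    (∀ i, IsPullback (ψ i) (pullback.fst _ _) p.left (U i).ι) ∧
    (∀ (i j : ι) (A : Type u) [CommRing A] [Algebra F A]
      (s : Spec (.of A) ⟶ (U i ⊓ U j).toScheme) (w : Fin (r + 1) → A)
      (hw : Unimodular (vec F w))
      (hgw : Unimodular (vec F (((g i j).map (pullFun s)).mulVec w)))
      (a : Spec (.of A) ⟶ pullback ((U i).ι ≫ Y.hom) (projSpace F (Fin (r + 1) → F)).hom)
      (b : Spec (.of A) ⟶ pullback ((U j).ι ≫ Y.hom) (projSpace F (Fin (r + 1) → F)).hom),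
      a ≫ pullback.fst _ _ = s ≫ Y.left.homOfLE inf_le_left →
      a ≫ pullback.snd _ _ = (point _ hgw).left →
      b ≫ pullback.fst _ _ = s ≫ Y.left.homOfLE inf_le_right →
      b ≫ pullback.snd _ _ = (point _ hw).left →
      a ≫ ψ i = b ≫ ψ j)

end ProjectiveBundle

/-! ### The locus `S(N)`, the variety `ℙ(N, L)` and the map `l ↦ L l` -/

section Span

variable (F L N : Type u) [Field F] [CommRing L] [Algebra F L] [AddCommGroup N] [Module F N]
  [Module L N] [IsScalarTower F L N]

variable {F N} in
/-- The canonical identification `A ⊗_F N ≅ (L ⊗_F A) ⊗_L N`, `a ⊗ n ↦ (1 ⊗ a) ⊗ n`. -/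
noncomputable def toExt {A : Type u} [CommRing A] [Algebra F A] :
    A ⊗[F] N →ₗ[F] (L ⊗[F] A) ⊗[L] N :=
  TensorProduct.lift (LinearMap.mk₂ F (fun (a : A) (n : N) => ((1 : L) ⊗ₜ[F] a) ⊗ₜ[L] n)
    (fun a b n => by rw [TensorProduct.tmul_add, TensorProduct.add_tmul])
    (fun c a n => by simp only [TensorProduct.tmul_smul, TensorProduct.smul_tmul'])
    (fun a m n => by rw [TensorProduct.tmul_add])
    (fun c a n => by
      rw [← algebraMap_smul L c n, ← TensorProduct.smul_tmul,
        ← algebraMap_smul L c (((1 : L) ⊗ₜ[F] a) ⊗ₜ[L] n)]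
      rfl))

/-- The set of points of `ℙ_F(N)` at which the line `[m]` satisfies `ann_L(m) ≠ 0`: the points `x`
that underlie a line `[v]` over some extension field `K` of `F`, generated by some
`v ∈ K ⊗_F N` that is killed by a nonzero element of `L ⊗_F K`. -/
def annLocus : Set (projSpace F N).left :=
  {x | ∃ (K : Type u) (_ : Field K) (_ : Algebra F K) (v : K ⊗[F] N) (hv : Unimodular v),
    (∃ a : L ⊗[F] K, a ≠ 0 ∧ a • toExt L v = 0) ∧ x ∈ Set.range (point v hv).left}

/-- The ideal sheaf of the reduced closed subscheme `S(N)` of `ℙ_F(N)`. (The set `annLocus` is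
closed, so that taking its closure changes nothing.) -/
noncomputable def annIdeal : (projSpace F N).left.IdealSheafData :=
  Scheme.IdealSheafData.vanishingIdeal (TopologicalSpace.Closeds.closure (annLocus F L N))

/-- The functor `T ↦ Hom_L(T ×_F L, X)` on `F`-schemes, for an `L`-scheme `X`. The `F`-scheme
representing it is the Weil restriction (transfer) `tr_{L/F} X`. -/
noncomputable abbrev weilFunctor (X : Over (Spec (.of L))) : (Over (Spec (.of F)))ᵒᵖ ⥤ Type u :=
  (Over.pullback (Spec.map (CommRingCat.ofHom (algebraMap F L)))).op ⋙ yoneda.obj X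

/-- The canonical isomorphism `Spec A ×_F Spec L ≅ Spec (L ⊗_F A)`. -/
noncomputable def pullbackSpecOverIso (A : Type u) [CommRing A] [Algebra F A] :
    ((Over.pullback (Spec.map (CommRingCat.ofHom (algebraMap F L)))).obj (specOver F A)).left ≅
      Spec (.of (L ⊗[F] A)) :=
  pullbackSymmetry _ _ ≪≫ pullbackSpecIso F L A

variable {F L N}

/-- Let `R` represent `ℙ(N, L) = tr_{L/F} ℙ_L(N)`, and let `f : U ⟶ R` be an `F`-morphism from an
open subscheme `U` of `ℙ_F(N)`. This says that `U` is the complement of `S(N)`, that it is dense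
(so that `f` is a rational map on `ℙ_F(N)`), and that `f` sends a line `l` to its `L`-span `L l`:
for each `A`-valued point `p` of `U` given by a line `[v]`, `v ∈ A ⊗_F N`, the vector `v` generates
a line over `L ⊗_F A`, and the latter is the `(L ⊗_F A)`-valued point of `ℙ_L(N)` to
which `f p` corresponds. -/
structure IsLineSpanMap {R : Over (Spec (.of F))}
    (e : (weilFunctor F L (projSpace L N)).RepresentableBy R)
    (U : (projSpace F N).left.Opens) (f : Over.mk (U.ι ≫ (projSpace F N).hom) ⟶ R) : Prop where
  coe_eq : (U : Set (projSpace F N).left) = (annLocus F L N)ᶜ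
  dense : Dense (U : Set (projSpace F N).left)
  map_point : ∀ (A : Type u) [CommRing A] [Algebra F A] (v : A ⊗[F] N) (hv : Unimodular v)
    (p : specOver F A ⟶ Over.mk (U.ι ≫ (projSpace F N).hom)),
    p.left ≫ U.ι = (point v hv).left →
    ∃ hv' : Unimodular (toExt L v),
      (e.homEquiv (p ≫ f)).left = (pullbackSpecOverIso F L A).hom ≫ (point (toExt L v) hv').left

/-- Given `π : B ⟶ X` over `S`, the morphism `g : B ⟶ R` extends `f : U ⟶ R`, where `U` is open
in `X`: on `π⁻¹(U)` it is `f ∘ π`. -/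
def Extends {S : Scheme.{u}} {X R : Over S} {U : X.left.Opens} (f : Over.mk (U.ι ≫ X.hom) ⟶ R)
    {B : Scheme.{u}} (π : B ⟶ X.left) (g : Over.mk (π ≫ X.hom) ⟶ R) : Prop :=
  (π ⁻¹ᵁ U).ι ≫ g.left = (π ∣_ U) ≫ f.left

end Span

end LineSpan

/-! Write L = F ⊕ Fθ with its conjugation, trace and norm. Étaleness says that the difference 2θ − p
of θ and its conjugate is invertible, so the trace form stays nondegenerate over every F-algebra A.
A family of lines over Spec A is locally [w] with w ∈ A ⊗ N, and w has L-linear coordinates `co w φ`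
in L ⊗ A. Everything rests on `normIdeal`, the ideal of A generated by the norms of these
coordinates. By polarization and nondegeneracy its extension to L ⊗ A contains all products conj(co
w φ) · co w ψ (`conjA_co_mul_co_mem`). Hence it is the unit ideal exactly when w generates an
L-line, and over a field it vanishes exactly when w has a nonzero annihilator. On the charts of the
projective space it is radical (`isRadical_normIdeal_of_universal`), so it is the ideal of the
reduced subscheme S(N) (`comap_chart_annIdeal`).

Suppose the norm ideal is generated by a nonzerodivisor s. Locally the norm of some coordinate co w
φ is s times a unit; this coordinate then divides all others, so w = l v with l a nonzerodivisor and
v the generator of an L-line, and this L-line is determined by w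
(`exists_factor_of_normIdeal_eq_span`, `exists_unit_of_smul_eq`). So a family of lines along which
S(N) becomes a Cartier divisor lies in a unique family of L-lines (`existsUnique_isSpanPair`).

Conversely, consider pairs of a line and an L-line containing it. An L-line has, locally, a unique
generator v with co v φ = 1, and the lines in it are those of l v, where l ∈ L ⊗ A ≅ A² is given up
to scalars. The functor of pairs is therefore represented by a ℙ¹-bundle B over ℙ(N, L), whose
transition matrices are multiplications by units of L ⊗ A (`isRepresentable_spanPairFunctor`,
`IsUniversalSpanPair.isProjectiveBundle`). On B the norm ideal is locally generated by the norm of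
l, a nonzerodivisor because the norm form is a nonzero polynomial. So S(N) becomes Cartier on B, and
the previous paragraph turns the universal property of B into that of the blow-up
(`IsUniversalSpanPair.isBlowup`); g is the projection to the L-line. The extension is unique because
the complement of a Cartier divisor is schematically dense and equality of L-lines amounts to the
vanishing of minors.

Schemes are handled through points with values in algebras. Morphisms are glued from relations
between such points (`exists_hom_of_local`), and both ℙ(N, L) and B come from one criterion of
representability by open charts (`isRepresentable_of_charts`). -/

set_option autoImplicit false

namespace LineSpan

/-! ### Morphisms from affine schemes to Proj -/

section

section ProjPoints

variable {σ S : Type u} [CommRing S] [SetLike σ S] [AddSubgroupClass σ S] {𝒜 : ℕ → σ}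
  [GradedRing 𝒜]

/-- The homomorphism from `S_(r)` induced by a homomorphism from `S` that sends `r` to
a unit. -/
noncomputable def awayLift {C : Type u} [CommRing C] (f : S →+* C) {r : S}
    (hr : IsUnit (f r)) : HomogeneousLocalization.Away 𝒜 r →+* C :=
  (IsLocalization.Away.lift (S := Localization.Away r) r hr).comp
    (algebraMap (HomogeneousLocalization.Away 𝒜 r) (Localization.Away r))

variable {X : Scheme.{u}} (f : S →+* Γ(X, ⊤))
  (hf : (HomogeneousIdeal.irrelevant 𝒜).toIdeal.map f = ⊤) {C : Type u} [CommRing C]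
  (c : Spec (.of C) ⟶ X)

/-- The homomorphism on global functions induced by a morphism from an affine scheme. -/
noncomputable def globalHom : Γ(X, ⊤) →+* C :=
  (c.appTop ≫ (Scheme.ΓSpecIso (.of C)).hom).hom

theorem comp_toSpecΓ_eq : c ≫ X.toSpecΓ = Spec.map (CommRingCat.ofHom (globalHom c)) := by
  rw [Scheme.toSpecΓ_naturality, ← SpecMap_ΓSpecIso_hom, ← Spec.map_comp]
  rfl

theorem range_subset_basicOpen {x : Γ(X, ⊤)} (hx : IsUnit (globalHom c x)) :
    Set.range c ⊆ X.basicOpen x := by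
  rintro _ ⟨p, rfl⟩
  rw [← Scheme.toSpecΓ_preimage_basicOpen]
  change (c ≫ X.toSpecΓ) p ∈ PrimeSpectrum.basicOpen x
  rw [comp_toSpecΓ_eq]
  intro h
  exact p.2.ne_top (Ideal.eq_top_of_isUnit_mem _ h hx)

theorem toSpecΓ_restrict_basicOpen (X : Scheme.{u}) (x : Γ(X, ⊤)) :
    (X.isoOfEq (X.toSpecΓ_preimage_basicOpen x)).inv ≫
      (X.toSpecΓ ∣_ PrimeSpectrum.basicOpen x) ≫ (basicOpenIsoSpecAway x).hom ≫
        Spec.map (CommRingCat.ofHom (algebraMap Γ(X, ⊤) (Localization.Away x))) =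
      (X.basicOpen x).ι ≫ X.toSpecΓ := by
  let V : (Spec Γ(X, ⊤)).Opens := PrimeSpectrum.basicOpen x
  have h0 : IsOpenImmersion V.ι := inferInstance
  have h1 : (basicOpenIsoSpecAway x).hom ≫
        Spec.map (CommRingCat.ofHom (algebraMap Γ(X, ⊤) (Localization.Away x))) =
        V.ι :=
    IsOpenImmersion.isoOfRangeEq_hom_fac V.ι _ _
  have h2 := morphismRestrict_ι X.toSpecΓ V
  have h3 := Scheme.isoOfEq_inv_ι X (X.toSpecΓ_preimage_basicOpen x)
  refine Eq.trans (congrArg (fun z => _ ≫ _ ≫ z) h1) ?_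
  refine Eq.trans (congrArg (fun z => _ ≫ z) h2) ?_
  rw [← Category.assoc]
  exact congrArg (fun z => z ≫ X.toSpecΓ) h3

/-- If f r becomes a unit on Spec C, then c lands in the basic open set of f r, where the glued
morphism to Proj is by construction given by a homomorphism out of the degree-zero localization.
This makes points of Proj computable by ring homomorphisms. -/
theorem comp_fromOfGlobalSections {r : S} {d : ℕ} (hd : 0 < d) (hr : r ∈ 𝒜 d)
    (hu : IsUnit (((globalHom c).comp f) r)) :
    c ≫ Proj.fromOfGlobalSections 𝒜 f hf =
      Spec.map (CommRingCat.ofHom (awayLift ((globalHom c).comp f) hu)) ≫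
        Proj.awayι 𝒜 r hr hd := by
  obtain ⟨t, ht⟩ : ∃ t : Spec (.of C) ⟶ (X.basicOpen (f r)).toScheme,
      t ≫ (X.basicOpen (f r)).ι = c :=
    ⟨IsOpenImmersion.lift _ _ (by
      rw [Scheme.Opens.range_ι]; exact range_subset_basicOpen c hu), IsOpenImmersion.lift_fac _ _ _⟩
  have h1 : (X.basicOpen (f r)).ι ≫ Proj.fromOfGlobalSections 𝒜 f hf =
      Proj.toBasicOpenOfGlobalSections 𝒜 f rfl hd hr ≫ (Proj.basicOpen _ _).ι :=
    (Proj.openCoverOfMapIrrelevantEqTop 𝒜 f hf).ι_glueMorphisms _ _ ⟨d, _, hd, hr⟩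
  have h2 : t ≫ (X.isoOfEq (X.toSpecΓ_preimage_basicOpen (f r))).inv ≫
      (X.toSpecΓ ∣_ PrimeSpectrum.basicOpen (f r)) ≫ (basicOpenIsoSpecAway (f r)).hom =
      Spec.map (CommRingCat.ofHom
        (IsLocalization.Away.lift (S := Localization.Away (f r)) (g := globalHom c) (f r) hu)) := by
    -- The spectrum of a localization is a monomorphism, so both sides may be compared as morphisms
    -- to the spectrum of all global functions.
    rw [← cancel_mono (Spec.map (CommRingCat.ofHom
      (algebraMap Γ(X, ⊤) (Localization.Away (f r)))))]
    have h3 := congrArg (fun z => t ≫ z) (toSpecΓ_restrict_basicOpen X (f r))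
    simp only [Category.assoc, ← Spec.map_comp, ← CommRingCat.ofHom_comp] at h3 ⊢
    rw [IsLocalization.Away.lift_comp]
    refine Eq.trans h3 ?_
    rw [reassoc_of% ht, comp_toSpecΓ_eq]
  conv_lhs => rw [← ht, Category.assoc, h1, Proj.toBasicOpenOfGlobalSections]
  simp only [Category.assoc, Proj.basicOpenIsoSpec_inv_ι]
  rw [reassoc_of% h2, ← Spec.map_comp_assoc, ← CommRingCat.ofHom_comp, awayLift,
    ← RingHom.comp_assoc]
  congr 4
  apply IsLocalization.ringHom_ext (M := .powers r)
  ext i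
  simp

theorem awayLift_mk (g : S →+* C) {r : S} (hu : IsUnit (g r)) {d : ℕ} (hr : r ∈ 𝒜 d) (n : ℕ) (s : S)
    (hs : s ∈ 𝒜 (n • d)) :
    g r ^ n * awayLift (𝒜 := 𝒜) g hu (HomogeneousLocalization.Away.mk 𝒜 hr n s hs) = g s := by
  have : algebraMap S (Localization.Away r) r ^ n *
      (algebraMap _ (Localization.Away r) (HomogeneousLocalization.Away.mk 𝒜 hr n s hs)) =
      algebraMap S (Localization.Away r) s := by
    rw [HomogeneousLocalization.algebraMap_apply, HomogeneousLocalization.Away.val_mk,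
      Localization.mk_eq_mk', ← map_pow]
    exact IsLocalization.mk'_spec' _ s (⟨r ^ n, n, rfl⟩ : Submonoid.powers r)
  have h := congrArg (IsLocalization.Away.lift (S := Localization.Away r) r hu) this
  rw [map_mul, map_pow, IsLocalization.Away.lift_eq, IsLocalization.Away.lift_eq] at h
  exact h

end ProjPoints

end

/-! ### Unimodular vectors and their coordinates -/

section

/-- If ∑ dᵢ yᵢ = 1, the vanishing of the minors gives x = m y with m = ∑ dᵢ xᵢ. All coordinates of x
are multiples of m and generate the unit ideal, so m is a unit. -/
theorem exists_unit_of_minors {ι A : Type*} [CommRing A] {x y : ι → A}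
    (hx : Ideal.span (Set.range x) = ⊤) (hy : Ideal.span (Set.range y) = ⊤)
    (h : ∀ i j, x i * y j = x j * y i) : ∃ m : Aˣ, ∀ i, x i = m * y i := by
  obtain ⟨d, hd⟩ := (Finsupp.mem_ideal_span_range_iff_exists_finsupp (v := y)).1
    ((Ideal.eq_top_iff_one _).1 hy)
  have key : ∀ j, x j = (d.sum fun i a => a * x i) * y j := fun j => by
    rw [← mul_one (x j), ← hd, Finsupp.mul_sum, Finsupp.sum_mul]
    refine Finsupp.sum_congr fun i _ => ?_
    rw [mul_left_comm, h j i, mul_assoc]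
  have hu : IsUnit (d.sum fun i a => a * x i) := by
    rw [← Ideal.span_singleton_eq_top, eq_top_iff, ← hx, Ideal.span_le]
    rintro _ ⟨j, rfl⟩
    rw [key j]
    exact Ideal.mul_mem_right _ _ (Ideal.mem_span_singleton_self _)
  exact ⟨hu.unit, key⟩

section Vectors

variable {R M : Type u} [CommRing R] [AddCommGroup M] [Module R M]
  {A B : Type u} [CommRing A] [Algebra R A] [CommRing B] [Algebra R B]

@[simp]
theorem evalDual_tmul (a : A) (m : M) (φ : Module.Dual R M) :
    evalDual (a ⊗ₜ[R] m) φ = φ m • a := by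
  simp [evalDual]

@[simp]
theorem evalDual_zero (φ : Module.Dual R M) : evalDual (0 : A ⊗[R] M) φ = 0 := by
  simp [evalDual]

@[simp]
theorem evalDual_add (v w : A ⊗[R] M) (φ : Module.Dual R M) :
    evalDual (v + w) φ = evalDual v φ + evalDual w φ := by
  simp [evalDual]

@[simp]
theorem evalDual_smul (a : A) (v : A ⊗[R] M) (φ : Module.Dual R M) :
    evalDual (a • v) φ = a * evalDual v φ := by
  induction v with
  | zero => simp
  | tmul b m => simp [smul_tmul']
  | add v w hv hw => rw [smul_add, evalDual_add, hv, hw, evalDual_add, mul_add]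

/-- Extension of scalars for vectors. -/
noncomputable def mapVec (f : A →ₐ[R] B) : A ⊗[R] M →ₗ[R] B ⊗[R] M :=
  LinearMap.rTensor M f.toLinearMap

@[simp]
theorem mapVec_tmul (f : A →ₐ[R] B) (a : A) (m : M) : mapVec f (a ⊗ₜ[R] m) = f a ⊗ₜ[R] m :=
  rfl

@[simp]
theorem evalDual_mapVec (f : A →ₐ[R] B) (v : A ⊗[R] M) (φ : Module.Dual R M) :
    evalDual (mapVec f v) φ = f (evalDual v φ) := by
  induction v with
  | zero => simp
  | tmul b m => simp
  | add v w hv hw => simp only [map_add, evalDual_add, hv, hw]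

theorem Unimodular.map {v : A ⊗[R] M} (hv : Unimodular v) (f : A →ₐ[R] B) :
    Unimodular (mapVec f v) := by
  have : Set.range (evalDual (mapVec f v)) = f '' Set.range (evalDual v) := by
    rw [← Set.range_comp]
    congr 1
    ext φ
    simp
  have h2 := Ideal.map_span (f : A →+* B) (Set.range (evalDual v))
  rw [Unimodular, this]
  rw [show Ideal.span (Set.range (evalDual v)) = ⊤ from hv, Ideal.map_top] at h2
  exact h2.symm

theorem unimodular_of_isUnit {v : A ⊗[R] M} {φ : Module.Dual R M} (h : IsUnit (evalDual v φ)) :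
    Unimodular v :=
  Ideal.eq_top_of_isUnit_mem _ (Ideal.subset_span ⟨φ, rfl⟩) h

theorem evalDual_coord {ι : Type*} [Finite ι] (b : Module.Basis ι R M) (v : A ⊗[R] M) (i : ι) :
    (b.baseChange A).repr v i = evalDual v (b.coord i) := by
  induction v with
  | zero => simp
  | tmul b m => simp
  | add v w hv hw => simp [hv, hw]

variable [Module.Free R M] [Module.Finite R M]

theorem vec_ext {v w : A ⊗[R] M} (h : ∀ φ, evalDual v φ = evalDual w φ) : v = w := by
  apply ((Module.Free.chooseBasis R M).baseChange A).ext_elem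
  intro i
  rw [evalDual_coord, evalDual_coord, h]

/-- With `vec_ext`, vectors of A ⊗ M are the same as linear maps from the dual of M to A. Later
vectors are constructed and compared only through the values of linear forms. -/
theorem exists_vec (l : Module.Dual R M →ₗ[R] A) : ∃ v : A ⊗[R] M, evalDual v = l := by
  classical
  let b := Module.Free.chooseBasis R M
  refine ⟨∑ i, l (b.coord i) ⊗ₜ[R] b i, ?_⟩
  apply b.dualBasis.ext
  intro j
  have : ∀ v w : A ⊗[R] M, evalDual (v + w) = evalDual v + evalDual w := fun v w => by
    ext; simp
  let E : A ⊗[R] M →+ (Module.Dual R M →ₗ[R] A) := ⟨⟨evalDual, by ext; simp⟩, this⟩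
  have h : evalDual (∑ i, l (b.coord i) ⊗ₜ[R] b i) = ∑ i, evalDual (l (b.coord i) ⊗ₜ[R] b i) :=
    map_sum E _ _
  rw [h, LinearMap.sum_apply]
  simp [Finsupp.single_apply]

theorem exists_unit_smul_of_minors {v w : A ⊗[R] M} (hv : Unimodular v) (hw : Unimodular w)
    (h : ∀ φ ψ, evalDual v φ * evalDual w ψ = evalDual v ψ * evalDual w φ) :
    ∃ m : Aˣ, v = (m : A) • w := by
  obtain ⟨m, hm⟩ := exists_unit_of_minors hv hw h
  exact ⟨m, vec_ext fun φ => by rw [hm, evalDual_smul]⟩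

end Vectors

end

/-! ### Points of projective space given by vectors -/

section

theorem hom_ext_of_span {B : Type u} [CommRing B] {X : Scheme.{u}} {ι : Type*} (s : ι → B)
    (hs : Ideal.span (Set.range s) = ⊤) {f g : Spec (.of B) ⟶ X}
    (h : ∀ i, Spec.map (CommRingCat.ofHom (algebraMap B (Localization.Away (s i)))) ≫ f =
      Spec.map (CommRingCat.ofHom (algebraMap B (Localization.Away (s i)))) ≫ g) : f = g := by
  have hs' : Ideal.span (Set.range fun i : Set.range s => (i : B)) = ⊤ := by
    rw [Subtype.range_coe]; exact hs
  refine (Scheme.affineOpenCoverOfSpanRangeEqTop (R := .of B)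
    (fun i : Set.range s => (i : B)) hs').openCover.hom_ext _ _ ?_
  rintro ⟨_, i, rfl⟩
  exact h i

section Points

variable {R M : Type u} [CommRing R] [AddCommGroup M] [Module R M]

theorem ι_mem_symGrading (m : M) : SymmetricAlgebra.ι R M m ∈ symGrading R M 1 := by
  simpa only [symGrading, pow_one] using LinearMap.mem_range_self _ m

variable {A B C : Type u} [CommRing A] [Algebra R A] [CommRing B] [Algebra R B] [CommRing C]

theorem evalSym_ι (v : A ⊗[R] M) (φ : Module.Dual R M) :
    evalSym v (SymmetricAlgebra.ι R _ φ) = evalDual v φ :=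
  SymmetricAlgebra.lift_ι_apply (evalDual v) φ

theorem specMap_comp_pointHom (v : A ⊗[R] M) (hv : Unimodular v) (s : A →+* C)
    (φ : Module.Dual R M)
    (hs : IsUnit ((s.comp (evalSym v).toRingHom) (SymmetricAlgebra.ι R _ φ))) :
    Spec.map (CommRingCat.ofHom s) ≫ pointHom v hv =
      Spec.map (CommRingCat.ofHom (awayLift (s.comp (evalSym v).toRingHom) hs)) ≫
        Proj.awayι (symGrading R (Module.Dual R M)) (SymmetricAlgebra.ι R _ φ)
          (ι_mem_symGrading φ) one_pos := by
  have h : (globalHom (Spec.map (CommRingCat.ofHom s))).comp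
      ((Scheme.ΓSpecIso (.of A)).inv.hom.comp (evalSym v).toRingHom) =
      s.comp (evalSym v).toRingHom := by
    rw [← RingHom.comp_assoc]
    congr 1
    ext x
    simp [globalHom]
  have := comp_fromOfGlobalSections (𝒜 := symGrading R (Module.Dual R M)) _
    (map_irrelevant_eq_top hv) (Spec.map (CommRingCat.ofHom s)) one_pos (ι_mem_symGrading φ)
    (by rw [h]; exact hs)
  rw [pointHom, this]
  congr 4

theorem isUnit_comp_evalSym {v : A ⊗[R] M} {s : A →+* C} {φ : Module.Dual R M}
    (hs : IsUnit (s (evalDual v φ))) :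
    IsUnit ((s.comp (evalSym v).toRingHom) (SymmetricAlgebra.ι R _ φ)) := by
  rw [← evalSym_ι] at hs
  exact hs

/-- The morphism of affine schemes given by a homomorphism of algebras. -/
noncomputable def specMap (f : A →ₐ[R] B) : specOver R B ⟶ specOver R A :=
  Over.homMk (Spec.map (CommRingCat.ofHom f.toRingHom)) (by
    change Spec.map _ ≫ Spec.map _ = Spec.map _
    rw [← Spec.map_comp, ← CommRingCat.ofHom_comp]
    congr 2
    exact f.comp_algebraMap)

theorem exists_specMap_eq (f : specOver R B ⟶ specOver R A) : ∃ g : A →ₐ[R] B, f = specMap g := by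
  obtain ⟨g, hg⟩ := Spec.map_surjective f.left
  have hw : Spec.map g ≫ Spec.map (CommRingCat.ofHom (algebraMap R A)) =
      Spec.map (CommRingCat.ofHom (algebraMap R B)) := by
    rw [hg]; exact Over.w f
  rw [← Spec.map_comp] at hw
  have hw' := Spec.map_injective hw
  refine ⟨⟨g.hom, fun r => ?_⟩, ?_⟩
  · exact congrArg (fun z => z.hom r) hw'
  · ext1
    exact hg.symm

theorem specMap_comp_point (f : A →ₐ[R] B) (v : A ⊗[R] M) (hv : Unimodular v) :
    specMap f ≫ point v hv = point (mapVec f v) (hv.map f) := by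
  ext1
  change Spec.map _ ≫ pointHom v hv = pointHom (mapVec f v) (hv.map f)
  -- The coordinates of the vector generate the unit ideal, and after inverting the coordinate at φ
  -- both morphisms land in the chart φ ≠ 0.
  refine hom_ext_of_span _ (hv.map f) fun φ => ?_
  rw [← Spec.map_comp_assoc, ← CommRingCat.ofHom_comp]
  have hu : IsUnit (algebraMap B (Localization.Away (evalDual (mapVec f v) φ))
      (evalDual (mapVec f v) φ)) := IsLocalization.Away.algebraMap_isUnit _
  have hu' := hu
  conv at hu' => arg 1; arg 2; rw [evalDual_mapVec]
  rw [specMap_comp_pointHom v hv _ φ (isUnit_comp_evalSym hu'),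
    specMap_comp_pointHom _ _ _ φ (isUnit_comp_evalSym hu)]
  congr 4
  rw [RingHom.comp_assoc]
  congr 1
  have : (f.comp (evalSym v)) = evalSym (mapVec f v) := by
    apply SymmetricAlgebra.algHom_ext
    ext φ
    simp [evalSym_ι]
  exact congrArg AlgHom.toRingHom this

theorem point_congr {v w : A ⊗[R] M} (h : v = w) (hv : Unimodular v) :
    point v hv = point w (h ▸ hv) := by
  subst h; rfl

theorem pointHom_preimage_basicOpen (v : A ⊗[R] M) (hv : Unimodular v) (φ : Module.Dual R M) :
    pointHom v hv ⁻¹ᵁ Proj.basicOpen _ (SymmetricAlgebra.ι R _ φ) =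
      (PrimeSpectrum.basicOpen (evalDual v φ) : (Spec (.of A)).Opens) := by
  rw [pointHom, Proj.fromOfGlobalSections_preimage_basicOpen _ _ _ one_pos (ι_mem_symGrading φ),
    basicOpen_eq_of_affine']
  congr 1
  simp [evalSym_ι]

end Points

end

/-! ### Affine charts of projective space -/

section

section Charts

variable {R M : Type u} [CommRing R] [AddCommGroup M] [Module R M]

/-- The coordinate ring of the affine chart `φ ≠ 0` of the projective space. -/
abbrev AwayRing (φ : Module.Dual R M) : Type u :=
  HomogeneousLocalization.Away (symGrading R (Module.Dual R M)) (SymmetricAlgebra.ι R _ φ)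

noncomputable instance awayAlgebra (φ : Module.Dual R M) : Algebra R (AwayRing φ) :=
  ((HomogeneousLocalization.fromZeroRingHom _ _).comp
    (algebraMap R (symGrading R (Module.Dual R M) 0))).toAlgebra

theorem algebraMap_awayRing (φ : Module.Dual R M) : algebraMap R (AwayRing φ) =
    (HomogeneousLocalization.fromZeroRingHom _ _).comp
      (algebraMap R (symGrading R (Module.Dual R M) 0)) := rfl

/-- The affine chart `φ ≠ 0` of the projective space. -/
noncomputable def chart (φ : Module.Dual R M) : specOver R (AwayRing φ) ⟶ projSpace R M :=
  Over.homMk (Proj.awayι (symGrading R (Module.Dual R M)) (SymmetricAlgebra.ι R _ φ)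
    (ι_mem_symGrading φ) one_pos) (by
      change Proj.awayι _ _ _ _ ≫ Proj.toSpecZero _ ≫ _ = Spec.map _
      rw [Proj.awayι_toSpecZero_assoc, ← Spec.map_comp, ← CommRingCat.ofHom_comp])

theorem chart_left (φ : Module.Dual R M) : (chart φ).left =
    Proj.awayι (symGrading R (Module.Dual R M)) (SymmetricAlgebra.ι R _ φ)
      (ι_mem_symGrading φ) one_pos := rfl

instance (φ : Module.Dual R M) : IsOpenImmersion (chart φ).left := by
  rw [chart_left]
  exact inferInstanceAs (IsOpenImmersion (Proj.awayι (symGrading R (Module.Dual R M))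
    (SymmetricAlgebra.ι R _ φ) (ι_mem_symGrading φ) one_pos))

/-- The open subset `φ ≠ 0` of the projective space. -/
noncomputable def nonvanishing (φ : Module.Dual R M) : (projSpace R M).left.Opens :=
  Proj.basicOpen (symGrading R (Module.Dual R M)) (SymmetricAlgebra.ι R _ φ)

theorem opensRange_chart (φ : Module.Dual R M) :
    (chart φ).left.opensRange = nonvanishing φ :=
  Proj.opensRange_awayι _ _ _ _

theorem range_chart (φ : Module.Dual R M) :
    Set.range (chart φ).left = (nonvanishing φ : Set (projSpace R M).left) :=
  congrArg (fun U : (projSpace R M).left.Opens => (U : Set (projSpace R M).left))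
    (opensRange_chart φ)

/-- The fraction `a / φ ^ n` on the chart `φ ≠ 0`. -/
noncomputable def fraction (φ : Module.Dual R M) (n : ℕ)
    (a : SymmetricAlgebra R (Module.Dual R M)) (ha : a ∈ symGrading R (Module.Dual R M) n) :
    AwayRing φ :=
  HomogeneousLocalization.Away.mk _ (ι_mem_symGrading φ) n a (by simpa using ha)

theorem val_fraction (φ : Module.Dual R M) (n : ℕ)
    (a : SymmetricAlgebra R (Module.Dual R M)) (ha : a ∈ symGrading R (Module.Dual R M) n) :
    (fraction φ n a ha).val = Localization.mk a
      (⟨_, pow_mem (Submonoid.mem_powers (SymmetricAlgebra.ι R (Module.Dual R M) φ)) n⟩ :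
        Submonoid.powers (SymmetricAlgebra.ι R (Module.Dual R M) φ)) :=
  HomogeneousLocalization.Away.val_mk _ _ _ _ _

theorem exists_fraction_eq (φ : Module.Dual R M) (x : AwayRing φ) :
    ∃ n a ha, fraction φ n a ha = x := by
  obtain ⟨n, a, ha, h⟩ :=
    HomogeneousLocalization.Away.mk_surjective _ (ι_mem_symGrading φ) x
  exact ⟨n, a, by simpa using ha, h⟩

theorem fraction_mul (φ : Module.Dual R M) (m n : ℕ)
    (a b : SymmetricAlgebra R (Module.Dual R M)) (ha : a ∈ symGrading R (Module.Dual R M) m)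
    (hb : b ∈ symGrading R (Module.Dual R M) n) :
    fraction φ m a ha * fraction φ n b hb =
      fraction φ (m + n) (a * b) (SetLike.mul_mem_graded ha hb) := by
  apply HomogeneousLocalization.val_injective
  rw [HomogeneousLocalization.val_mul, val_fraction, val_fraction, val_fraction,
    Localization.mk_mul]
  congr 1
  ext
  simp [pow_add]

theorem fraction_add (φ : Module.Dual R M) (n : ℕ)
    (a b : SymmetricAlgebra R (Module.Dual R M)) (ha : a ∈ symGrading R (Module.Dual R M) n)
    (hb : b ∈ symGrading R (Module.Dual R M) n) :
    fraction φ n a ha + fraction φ n b hb = fraction φ n (a + b) (add_mem ha hb) := by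
  apply HomogeneousLocalization.val_injective
  rw [HomogeneousLocalization.val_add, val_fraction, val_fraction, val_fraction,
    Localization.add_mk_self]

theorem fraction_algebraMap (φ : Module.Dual R M) (r : R) :
    fraction φ 0 (algebraMap R _ r) (SetLike.algebraMap_mem_graded _ r) = algebraMap R (AwayRing φ) r := by
  apply HomogeneousLocalization.val_injective
  rw [val_fraction, algebraMap_awayRing]
  change _ = Localization.mk _ _
  congr 1
  ext
  simp

theorem fraction_self (φ : Module.Dual R M) :
    fraction φ 1 (SymmetricAlgebra.ι R _ φ) (ι_mem_symGrading φ) = 1 := by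
  apply HomogeneousLocalization.val_injective
  rw [val_fraction, HomogeneousLocalization.val_one]
  convert Localization.mk_self
    (⟨_, Submonoid.mem_powers _⟩ : Submonoid.powers (SymmetricAlgebra.ι R (Module.Dual R M) φ))
    using 3
  exact pow_one _

/-- The linear form on the dual that sends `ψ` to `ψ / φ`. -/
noncomputable def ratio (φ : Module.Dual R M) : Module.Dual R M →ₗ[R] AwayRing φ where
  toFun ψ := fraction φ 1 (SymmetricAlgebra.ι R _ ψ) (ι_mem_symGrading ψ)
  map_add' ψ χ := by
    rw [fraction_add]
    congr 1
    exact map_add _ _ _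
  map_smul' r ψ := by
    rw [Algebra.smul_def, RingHom.id_apply, ← fraction_algebraMap, fraction_mul]
    apply HomogeneousLocalization.val_injective
    rw [val_fraction, val_fraction]
    congr 1
    rw [map_smul, Algebra.smul_def]

theorem ratio_self (φ : Module.Dual R M) : ratio φ φ = 1 := fraction_self φ

variable {A B : Type u} [CommRing A] [Algebra R A] [CommRing B] [Algebra R B]

/-- A homomorphism from the chart ring is determined by the ratios ψ/φ. They are the coordinates of
a vector v whose φ-coordinate is 1, so the denominator of a/φⁿ disappears and only the value of a at
v remains. -/
theorem algHom_fraction {φ : Module.Dual R M} (χ : AwayRing φ →ₐ[R] A) (v : A ⊗[R] M)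
    (hv : ∀ ψ, evalDual v ψ = χ (ratio φ ψ)) {n : ℕ} {a : SymmetricAlgebra R (Module.Dual R M)}
    (ha : a ∈ symGrading R (Module.Dual R M) n) : χ (fraction φ n a ha) = evalSym v a := by
  induction ha using Submodule.pow_induction_on_left' with
  | algebraMap r => 
    have := fraction_algebraMap φ r
    rw [AlgHom.commutes, ← χ.commutes, ← this]
  | add x y i hx hy ihx ihy => rw [map_add, ← ihx, ← ihy, ← map_add, fraction_add]
  | mem_mul m hm i x hx ih =>
    obtain ⟨ψ, rfl⟩ := hm
    rw [map_mul, ← ih, evalSym_ι, hv, ← map_mul, ratio]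
    change _ = χ (fraction φ 1 _ (ι_mem_symGrading ψ) * _)
    rw [fraction_mul]
    congr 1
    apply HomogeneousLocalization.val_injective
    rw [val_fraction, val_fraction]
    congr 3
    rw [add_comm]

theorem specMap_comp_chart {φ : Module.Dual R M} (χ : AwayRing φ →ₐ[R] A) (v : A ⊗[R] M)
    (hv : ∀ ψ, evalDual v ψ = χ (ratio φ ψ)) (hv' : Unimodular v) :
    specMap χ ≫ chart φ = point v hv' := by
  ext1
  change Spec.map _ ≫ Proj.awayι _ _ _ _ = pointHom v hv'
  have h1 : evalDual v φ = 1 := by rw [hv, ratio_self, map_one]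
  have hu : IsUnit (RingHom.id A (evalDual v φ)) := by rw [h1, map_one]; exact isUnit_one
  have := specMap_comp_pointHom v hv' (RingHom.id A) φ (isUnit_comp_evalSym hu)
  rw [show CommRingCat.ofHom (RingHom.id A) = 𝟙 _ from rfl, Spec.map_id, Category.id_comp] at this
  rw [this]
  congr 3
  ext x
  obtain ⟨n, a, ha, rfl⟩ := exists_fraction_eq φ x
  have h2 := algHom_fraction χ v hv ha
  have h3 := awayLift_mk (𝒜 := symGrading R (Module.Dual R M))
    ((RingHom.id A).comp (evalSym v).toRingHom) (isUnit_comp_evalSym hu) (ι_mem_symGrading φ) n a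
    (by simpa using ha)
  have h4 : ((RingHom.id A).comp (evalSym v).toRingHom) (SymmetricAlgebra.ι R _ φ) = 1 :=
    (evalSym_ι v φ).trans h1
  rw [h4, one_pow, one_mul] at h3
  exact h2.trans h3.symm

theorem iSup_nonvanishing : ⨆ φ : Module.Dual R M, nonvanishing φ = ⊤ := by
  refine Proj.iSup_basicOpen_eq_top' (symGrading R (Module.Dual R M))
    (fun φ => SymmetricAlgebra.ι R _ φ) (fun φ => ⟨1, ι_mem_symGrading φ⟩) ?_
  rw [eq_top_iff]
  rintro x -
  induction x using SymmetricAlgebra.induction with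
  | algebraMap r => exact Subalgebra.algebraMap_mem _ (algebraMap R (symGrading R _ 0) r)
  | ι x => exact Algebra.subset_adjoin ⟨x, rfl⟩
  | mul a b ha hb => exact mul_mem ha hb
  | add a b ha hb => exact add_mem ha hb

variable [Module.Free R M] [Module.Finite R M]

theorem exists_point_of_chart {φ : Module.Dual R M} (χ : AwayRing φ →ₐ[R] A) :
    ∃ (v : A ⊗[R] M) (hv : Unimodular v), (∀ ψ, evalDual v ψ = χ (ratio φ ψ)) ∧
      evalDual v φ = 1 ∧ specMap χ ≫ chart φ = point v hv := by
  obtain ⟨v, hv⟩ := exists_vec (χ.toLinearMap ∘ₗ ratio φ)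
  have hv : ∀ ψ, evalDual v ψ = χ (ratio φ ψ) := fun ψ => by rw [hv]; rfl
  have h1 : evalDual v φ = 1 := by rw [hv, ratio_self, map_one]
  have hv' : Unimodular v := unimodular_of_isUnit (φ := φ) (h1 ▸ isUnit_one)
  exact ⟨v, hv', hv, h1, specMap_comp_chart χ v hv hv'⟩

theorem exists_point_of_range_subset {φ : Module.Dual R M} (h : specOver R A ⟶ projSpace R M)
    (hφ : Set.range h.left ⊆ nonvanishing φ) :
    ∃ (v : A ⊗[R] M) (hv : Unimodular v), evalDual v φ = 1 ∧ h = point v hv := by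
  rw [← range_chart] at hφ
  let t : specOver R A ⟶ specOver R (AwayRing φ) :=
    Over.homMk (IsOpenImmersion.lift (chart φ).left h.left hφ) (by
      rw [← Over.w (chart φ), IsOpenImmersion.lift_fac_assoc, Over.w h])
  have ht : t ≫ chart φ = h := by
    ext1; exact IsOpenImmersion.lift_fac _ _ _
  obtain ⟨χ, hχ⟩ := exists_specMap_eq t
  obtain ⟨v, hv, -, h1, h2⟩ := exists_point_of_chart χ
  exact ⟨v, hv, h1, by rw [← h2, ← hχ, ht]⟩

end Charts

end

/-! ### Gluing morphisms from relations between affine points -/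

section

section Local

theorem Scheme.hom_ext_of_local {X Y : Scheme.{u}} {f g : X ⟶ Y}
    (h : ∀ x : X, ∃ (Z : Scheme.{u}) (i : Z ⟶ X), IsOpenImmersion i ∧ x ∈ Set.range i ∧
      i ≫ f = i ≫ g) : f = g := by
  choose Z i hi hx he using h
  let 𝒰 : X.OpenCover := Scheme.Cover.mkOfCovers X Z i (fun x => ⟨x, hx x⟩) hi
  exact 𝒰.hom_ext _ _ he

variable {R : Type u} [CommRing R]

theorem exists_affine_nhd (T : Over (Spec (.of R))) {U : T.left.Opens} {x : T.left} (hx : x ∈ U) :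
    ∃ (A : Type u) (_ : CommRing A) (_ : Algebra R A) (a : specOver R A ⟶ T),
      IsOpenImmersion a.left ∧ x ∈ Set.range a.left ∧ Set.range a.left ⊆ U := by
  obtain ⟨_, ⟨V, hV, rfl⟩, hxV, hVU⟩ :=
    T.left.isBasis_affineOpens.exists_subset_of_mem_open hx U.isOpen
  have hV : IsAffineOpen V := hV
  let c := Spec.preimage (hV.fromSpec ≫ T.hom)
  let : Algebra R Γ(T.left, V) := c.hom.toAlgebra
  refine ⟨Γ(T.left, V), inferInstance, inferInstance, Over.homMk hV.fromSpec ?_, ?_, ?_, ?_⟩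
  · exact (Spec.map_preimage _).symm
  · exact inferInstanceAs (IsOpenImmersion hV.fromSpec)
  · change x ∈ Set.range hV.fromSpec
    rw [hV.range_fromSpec]; exact hxV
  · change Set.range hV.fromSpec ⊆ _
    rw [hV.range_fromSpec]; exact hVU

variable {A B : Type u} [CommRing A] [Algebra R A] [CommRing B] [Algebra R B]

theorem over_hom_ext {T Y : Over (Spec (.of R))} {f g : T ⟶ Y}
    (h : ∀ x : T.left, ∃ (A : Type u) (_ : CommRing A) (_ : Algebra R A) (a : specOver R A ⟶ T),
      IsOpenImmersion a.left ∧ x ∈ Set.range a.left ∧ a ≫ f = a ≫ g) : f = g := by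
  ext1
  refine Scheme.hom_ext_of_local fun x => ?_
  obtain ⟨A, _, _, a, ha, hx, he⟩ := h x
  exact ⟨_, a.left, ha, hx, congrArg Over.Hom.left he⟩

theorem exists_common_refinement {T : Over (Spec (.of R))} (a : specOver R A ⟶ T)
    (b : specOver R B ⟶ T) [IsOpenImmersion b.left] (p : Spec (.of A))
    (hp : a.left p ∈ Set.range b.left) :
    ∃ (C : Type u) (_ : CommRing C) (_ : Algebra R C) (f : A →ₐ[R] C) (g : B →ₐ[R] C),
      IsOpenImmersion (specMap f).left ∧ p ∈ Set.range (specMap f).left ∧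
      specMap f ≫ a = specMap g ≫ b ∧
      (IsOpenImmersion a.left → IsOpenImmersion (specMap g).left) := by
  let P : Over (Spec (.of R)) := Over.mk (pullback.fst a.left b.left ≫ (specOver R A).hom)
  let fst : P ⟶ specOver R A := Over.homMk (pullback.fst a.left b.left) rfl
  let snd : P ⟶ specOver R B := Over.homMk (pullback.snd a.left b.left) (by
    change _ = pullback.fst a.left b.left ≫ (specOver R A).hom
    rw [← Over.w a, ← Over.w b, pullback.condition_assoc])
  have hc : fst ≫ a = snd ≫ b := by ext1; exact pullback.condition
  obtain ⟨q, hq⟩ := hp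
  obtain ⟨z, hz, -⟩ := Scheme.Pullback.exists_preimage_pullback p q hq.symm
  obtain ⟨C, _, _, c, hc1, ⟨t, ht⟩, -⟩ := exists_affine_nhd P (U := ⊤) (x := z) trivial
  obtain ⟨f, hf⟩ := exists_specMap_eq (c ≫ fst)
  obtain ⟨g, hg⟩ := exists_specMap_eq (c ≫ snd)
  refine ⟨C, _, _, f, g, ?_, ?_, ?_, ?_⟩
  · rw [← hf]
    exact inferInstanceAs (IsOpenImmersion (c.left ≫ pullback.fst a.left b.left))
  · rw [← hf]
    refine ⟨t, ?_⟩
    change (c.left ≫ pullback.fst a.left b.left) t = p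
    rw [Scheme.Hom.comp_apply, ht]
    exact hz
  · rw [← hf, ← hg, Category.assoc, Category.assoc, hc]
  · intro ha
    rw [← hg]
    exact inferInstanceAs (IsOpenImmersion (c.left ≫ pullback.snd a.left b.left))

/-- A morphism over `Spec R` can be constructed from a relation between points of the source and
the target that is functional, stable under open restriction, and satisfied locally. -/
theorem exists_hom_of_local {T Y : Over (Spec (.of R))}
    (Rel : ∀ (A : Type u) [CommRing A] [Algebra R A],
      (specOver R A ⟶ T) → (specOver R A ⟶ Y) → Prop)
    (stable : ∀ (A B : Type u) [CommRing A] [Algebra R A] [CommRing B] [Algebra R B]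
      (f : A →ₐ[R] B) (a : specOver R A ⟶ T) (y : specOver R A ⟶ Y),
      IsOpenImmersion a.left → IsOpenImmersion (specMap f).left → Rel A a y →
        Rel B (specMap f ≫ a) (specMap f ≫ y))
    (func : ∀ (A : Type u) [CommRing A] [Algebra R A] (a : specOver R A ⟶ T)
      (y y' : specOver R A ⟶ Y), IsOpenImmersion a.left → Rel A a y → Rel A a y' → y = y')
    (loc : ∀ x : T.left, ∃ (A : Type u) (_ : CommRing A) (_ : Algebra R A)
      (a : specOver R A ⟶ T) (y : specOver R A ⟶ Y),
      IsOpenImmersion a.left ∧ x ∈ Set.range a.left ∧ Rel A a y) :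
    ∃ f : T ⟶ Y, ∀ (A : Type u) [CommRing A] [Algebra R A] (a : specOver R A ⟶ T)
      (y : specOver R A ⟶ Y), IsOpenImmersion a.left → Rel A a y → a ≫ f = y := by
  choose A _ _ a y ha hx hr using loc
  let 𝒰 : T.left.OpenCover :=
    Scheme.Cover.mkOfCovers T.left (fun x => (specOver R (A x)).left) (fun x => (a x).left)
      (fun x => ⟨x, hx x⟩) ha
  have comp : ∀ i j : T.left, pullback.fst (𝒰.f i) (𝒰.f j) ≫ (y i).left =
      pullback.snd (𝒰.f i) (𝒰.f j) ≫ (y j).left := by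
    intro i j
    let P : Over (Spec (.of R)) :=
      Over.mk (pullback.fst (a i).left (a j).left ≫ (specOver R (A i)).hom)
    let fst : P ⟶ specOver R (A i) := Over.homMk (pullback.fst (a i).left (a j).left) rfl
    let snd : P ⟶ specOver R (A j) := Over.homMk (pullback.snd (a i).left (a j).left) (by
      change _ = pullback.fst (a i).left (a j).left ≫ (specOver R (A i)).hom
      rw [← Over.w (a i), ← Over.w (a j), pullback.condition_assoc])
    have hc : fst ≫ a i = snd ≫ a j := by ext1; exact pullback.condition
    -- The overlap need not be affine. It is tested on affine opens, which are open in both pieces,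
    -- so stability under open restriction suffices.
    have : fst ≫ y i = snd ≫ y j := by
      refine over_hom_ext fun z => ?_
      obtain ⟨C, _, _, c, hc1, hz, -⟩ := exists_affine_nhd P (U := ⊤) (x := z) trivial
      obtain ⟨f, hf⟩ := exists_specMap_eq (c ≫ fst)
      obtain ⟨g, hg⟩ := exists_specMap_eq (c ≫ snd)
      have hf' : IsOpenImmersion (specMap f).left := by
        rw [← hf]; exact inferInstanceAs (IsOpenImmersion (c.left ≫ pullback.fst _ _))
      have hg' : IsOpenImmersion (specMap g).left := by
        rw [← hg]; exact inferInstanceAs (IsOpenImmersion (c.left ≫ pullback.snd _ _))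
      refine ⟨C, _, _, c, hc1, hz, ?_⟩
      rw [← Category.assoc, ← Category.assoc, hf, hg]
      have h1 := stable _ _ f _ _ (ha i) hf' (hr i)
      have h2 := stable _ _ g _ _ (ha j) hg' (hr j)
      have h3 : specMap f ≫ a i = specMap g ≫ a j := by
        rw [← hf, ← hg, Category.assoc, Category.assoc, hc]
      rw [h3] at h1
      exact func _ _ _ _ (by
        rw [Over.comp_left]
        exact IsOpenImmersion.comp _ _) h1 h2
    exact congrArg Over.Hom.left this
  let f0 : T.left ⟶ Y.left := 𝒰.glueMorphisms (fun i => (y i).left) comp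
  have hf0 : ∀ i, (a i).left ≫ f0 = (y i).left := fun i => 𝒰.ι_glueMorphisms _ comp i
  have hover : f0 ≫ Y.hom = T.hom := by
    refine 𝒰.hom_ext _ _ fun i => ?_
    change (a i).left ≫ f0 ≫ Y.hom = (a i).left ≫ T.hom
    rw [reassoc_of% (hf0 i), Over.w (y i), Over.w (a i)]
  let f : T ⟶ Y := Over.homMk f0 hover
  have hf : ∀ i, a i ≫ f = y i := fun i => by ext1; exact hf0 i
  refine ⟨f, fun B _ _ b z hb hbz => over_hom_ext fun p => ?_⟩
  have := ha (b.left p)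
  obtain ⟨C, _, _, g, g', hg, hp, he, hg'⟩ :=
    exists_common_refinement b (a (b.left p)) p (hx _)
  refine ⟨C, _, _, specMap g, hg, hp, ?_⟩
  have h1 := stable _ _ g _ _ hb hg hbz
  have h2 := stable _ _ g' _ _ (ha _) (hg' hb) (hr (b.left p))
  rw [reassoc_of% he, hf]
  rw [he] at h1
  exact (func _ _ _ _ (by
    rw [Over.comp_left]
    have := hg' hb
    exact IsOpenImmersion.comp _ _) h1 h2).symm

/-- If the relation is stable under all base changes, the morphism constructed in
`exists_hom_of_local` satisfies it on all points. -/
theorem comp_eq_of_local {T Y : Over (Spec (.of R))}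
    (Rel : ∀ (A : Type u) [CommRing A] [Algebra R A],
      (specOver R A ⟶ T) → (specOver R A ⟶ Y) → Prop)
    (stable : ∀ (A B : Type u) [CommRing A] [Algebra R A] [CommRing B] [Algebra R B]
      (f : A →ₐ[R] B) (a : specOver R A ⟶ T) (y : specOver R A ⟶ Y), Rel A a y →
        Rel B (specMap f ≫ a) (specMap f ≫ y))
    (func : ∀ (A : Type u) [CommRing A] [Algebra R A] (a : specOver R A ⟶ T)
      (y y' : specOver R A ⟶ Y), Rel A a y → Rel A a y' → y = y')
    (loc : ∀ x : T.left, ∃ (A : Type u) (_ : CommRing A) (_ : Algebra R A)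
      (a : specOver R A ⟶ T) (y : specOver R A ⟶ Y),
      IsOpenImmersion a.left ∧ x ∈ Set.range a.left ∧ Rel A a y) :
    ∃ f : T ⟶ Y, ∀ (A : Type u) [CommRing A] [Algebra R A] (a : specOver R A ⟶ T)
      (y : specOver R A ⟶ Y), Rel A a y → a ≫ f = y := by
  obtain ⟨f, hf⟩ := exists_hom_of_local Rel (fun A B _ _ _ _ g a y _ _ h => stable A B g a y h)
    (fun A _ _ a y y' _ h h' => func A a y y' h h') loc
  refine ⟨f, fun B _ _ b z hbz => over_hom_ext fun p => ?_⟩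
  obtain ⟨A, _, _, a, y, ha, hx, hr⟩ := loc (b.left p)
  obtain ⟨C, _, _, g, g', hg, hp, he, -⟩ := exists_common_refinement b a p hx
  refine ⟨C, _, _, specMap g, hg, hp, ?_⟩
  have h1 := stable _ _ g _ _ hbz
  have h2 := stable _ _ g' _ _ hr
  rw [reassoc_of% he, hf _ _ _ ha hr]
  rw [he] at h1
  exact (func _ _ _ _ h1 h2).symm

end Local

end

/-! ### Equality of points of projective space -/

section

/-- Equality of functions can be checked locally. -/
theorem eq_of_local {A : Type u} [CommRing A] {a b : A}
    (h : ∀ p : Spec (.of A), ∃ (B : Type u) (_ : CommRing B) (f : A →+* B),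
      IsOpenImmersion (Spec.map (CommRingCat.ofHom f)) ∧
        p ∈ Set.range (Spec.map (CommRingCat.ofHom f)) ∧ f a = f b) : a = b := by
  -- Functions are morphisms to the affine line over ℤ, and morphisms of schemes may be compared
  -- locally; the lift of ℤ only adjusts the universe.
  let e (x : A) : Polynomial (ULift.{u} ℤ) →+* A :=
    Polynomial.eval₂RingHom ((Int.castRingHom A).comp ULift.ringEquiv.toRingHom) x
  have key : Spec.map (CommRingCat.ofHom (e a)) = Spec.map (CommRingCat.ofHom (e b)) := by
    refine Scheme.hom_ext_of_local fun p => ?_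
    obtain ⟨B, _, f, hf, hp, he⟩ := h p
    refine ⟨_, _, hf, hp, ?_⟩
    rw [← Spec.map_comp, ← Spec.map_comp, ← CommRingCat.ofHom_comp, ← CommRingCat.ofHom_comp]
    congr 2
    apply Polynomial.ringHom_ext
    · intro n; simp [e]
    · simpa [e] using he
  have h2 := congrArg (fun z => z.hom Polynomial.X) (Spec.map_injective key)
  simpa [e] using h2

section Points

variable {R M : Type u} [CommRing R] [AddCommGroup M] [Module R M]
  {A B : Type u} [CommRing A] [Algebra R A] [CommRing B] [Algebra R B]

theorem point_mem_nonvanishing {v : A ⊗[R] M} {hv : Unimodular v} {φ : Module.Dual R M}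
    {p : Spec (.of A)} :
    (point v hv).left p ∈ nonvanishing φ ↔ evalDual v φ ∉ p.asIdeal := by
  have h : p ∈ pointHom v hv ⁻¹ᵁ Proj.basicOpen _ (SymmetricAlgebra.ι R _ φ) ↔
      p ∈ (PrimeSpectrum.basicOpen (evalDual v φ) : (Spec (.of A)).Opens) := by
    rw [pointHom_preimage_basicOpen]
    exact Iff.rfl
  exact h

theorem isUnit_of_forall_prime {a : A} (h : ∀ p : Spec (.of A), a ∉ p.asIdeal) : IsUnit a := by
  by_contra ha
  obtain ⟨m, hm, ham⟩ := exists_max_ideal_of_mem_nonunits ha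
  exact h ⟨m, hm.isPrime⟩ ham

/-- Both points factor through the affine chart φ ≠ 0, which is a monomorphism, so the function ψ/φ
has the same value at both. Clearing denominators gives the minor. -/
theorem minors_of_point_eq_of_isUnit {v w : A ⊗[R] M} {hv : Unimodular v} {hw : Unimodular w}
    (h : point v hv = point w hw) {φ : Module.Dual R M} (hφ : IsUnit (evalDual v φ))
    (ψ : Module.Dual R M) :
    evalDual v φ * evalDual w ψ = evalDual v ψ * evalDual w φ := by
  have hφ' : IsUnit (evalDual w φ) := by
    apply isUnit_of_forall_prime
    intro p
    rw [← point_mem_nonvanishing (hv := hw), ← h, point_mem_nonvanishing]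
    intro hp
    exact p.2.ne_top (Ideal.eq_top_of_isUnit_mem _ hp hφ)
  have h1 := specMap_comp_pointHom v hv (RingHom.id A) φ (isUnit_comp_evalSym hφ)
  have h2 := specMap_comp_pointHom w hw (RingHom.id A) φ (isUnit_comp_evalSym hφ')
  rw [show pointHom v hv = pointHom w hw from congrArg Over.Hom.left h, h2] at h1
  have h3 := (cancel_mono _).1 h1
  have h4 := congrArg (fun z => z.hom (ratio φ ψ)) (Spec.map_injective h3)
  have e1 := awayLift_mk (𝒜 := symGrading R (Module.Dual R M))
    ((RingHom.id A).comp (evalSym v).toRingHom) (isUnit_comp_evalSym hφ) (ι_mem_symGrading φ) 1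
    (SymmetricAlgebra.ι R _ ψ) (by simp)
  have e2 := awayLift_mk (𝒜 := symGrading R (Module.Dual R M))
    ((RingHom.id A).comp (evalSym w).toRingHom) (isUnit_comp_evalSym hφ') (ι_mem_symGrading φ) 1
    (SymmetricAlgebra.ι R _ ψ) (by simp)
  have f1 : ∀ (u : A ⊗[R] M) χ, ((RingHom.id A).comp (evalSym u).toRingHom)
    (SymmetricAlgebra.ι R _ χ) = evalDual u χ := fun u χ => evalSym_ι u χ
  rw [f1, f1, pow_one] at e1 e2
  rw [← e1, ← e2]
  change evalDual v φ * (evalDual w φ * _) = evalDual v φ * _ * evalDual w φ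
  rw [mul_assoc, mul_comm (evalDual w φ)]
  congr 2

theorem evalSym_smul (m : A) (w : A ⊗[R] M) {n : ℕ} {a : SymmetricAlgebra R (Module.Dual R M)}
    (ha : a ∈ symGrading R (Module.Dual R M) n) : evalSym (m • w) a = m ^ n * evalSym w a := by
  induction ha using Submodule.pow_induction_on_left' with
  | algebraMap r => simp
  | add x y i hx hy ihx ihy => rw [map_add, map_add, ihx, ihy, mul_add]
  | mem_mul y hy i x hx ih =>
    obtain ⟨ψ, rfl⟩ := hy
    rw [map_mul, map_mul, ih, evalSym_ι, evalSym_ι, evalDual_smul, Nat.succ_eq_add_one, pow_succ]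
    ring

/-- Equal points have vanishing minors where a coordinate is invertible, hence everywhere, and
`exists_unit_smul_of_minors` supplies the scalar. Conversely, a fraction of degree zero has the same
value at proportional vectors, the powers of the scalar cancelling. -/
theorem point_eq_iff {v w : A ⊗[R] M} {hv : Unimodular v} {hw : Unimodular w}
    [Module.Free R M] [Module.Finite R M] :
    point v hv = point w hw ↔ ∃ m : Aˣ, v = (m : A) • w := by
  constructor
  · intro h
    refine exists_unit_smul_of_minors hv hw fun φ ψ => ?_
    refine eq_of_local fun p => ?_
    obtain ⟨χ, hχ⟩ : ∃ χ, evalDual v χ ∉ p.asIdeal := by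
      by_contra! hc
      refine p.2.ne_top (top_le_iff.1 ?_)
      rw [← (hv : Ideal.span _ = ⊤), Ideal.span_le]
      rintro _ ⟨χ, rfl⟩
      exact hc χ
    let s := evalDual v χ
    let f : A →ₐ[R] Localization.Away s := IsScalarTower.toAlgHom R A _
    refine ⟨Localization.Away s, inferInstance, f.toRingHom, ?_, ?_, ?_⟩
    · exact IsOpenImmersion.of_isLocalization s
    · have := PrimeSpectrum.localization_away_comap_range (Localization.Away s) s
      exact (Set.ext_iff.1 this p).2 hχ
    · have hu : IsUnit (evalDual (mapVec f v) χ) := by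
        rw [evalDual_mapVec]; exact IsLocalization.Away.algebraMap_isUnit s
      have h' : point (mapVec f v) (hv.map f) = point (mapVec f w) (hw.map f) := by
        rw [← specMap_comp_point f v hv, h, specMap_comp_point]
      have k1 := minors_of_point_eq_of_isUnit h' hu φ
      have k2 := minors_of_point_eq_of_isUnit h' hu ψ
      simp only [evalDual_mapVec] at k1 k2 hu
      change f _ = f _
      rw [map_mul, map_mul]
      -- The minor for φ and ψ is a combination of the two minors involving χ, because the
      -- χ-coordinate of v is invertible here.
      refine hu.mul_left_cancel ?_
      linear_combination f (evalDual v φ) * k2 - f (evalDual v ψ) * k1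
  · rintro ⟨m, rfl⟩
    ext1
    change pointHom _ hv = pointHom _ hw
    refine hom_ext_of_span _ hw fun φ => ?_
    have hu : IsUnit (algebraMap A (Localization.Away (evalDual w φ)) (evalDual w φ)) :=
      IsLocalization.Away.algebraMap_isUnit _
    have hu' : IsUnit (algebraMap A (Localization.Away (evalDual w φ))
        (evalDual ((m : A) • w) φ)) := by
      rw [evalDual_smul, map_mul]
      exact (m.isUnit.map _).mul hu
    rw [specMap_comp_pointHom _ _ _ φ (isUnit_comp_evalSym hu),
      specMap_comp_pointHom _ _ _ φ (isUnit_comp_evalSym hu')]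
    refine congrArg (fun r => Spec.map (CommRingCat.ofHom r) ≫ Proj.awayι
      (symGrading R (Module.Dual R M)) (SymmetricAlgebra.ι R _ φ) (ι_mem_symGrading φ) one_pos)
      (RingHom.ext fun x => ?_)
    obtain ⟨n, a, ha, rfl⟩ := exists_fraction_eq φ x
    have e1 := awayLift_mk (𝒜 := symGrading R (Module.Dual R M))
      ((algebraMap A (Localization.Away (evalDual w φ))).comp (evalSym w).toRingHom)
      (isUnit_comp_evalSym hu) (ι_mem_symGrading φ) n a (by simpa using ha)
    have e2 := awayLift_mk (𝒜 := symGrading R (Module.Dual R M))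
      ((algebraMap A (Localization.Away (evalDual w φ))).comp (evalSym ((m : A) • w)).toRingHom)
      (isUnit_comp_evalSym hu') (ι_mem_symGrading φ) n a (by simpa using ha)
    have f1 : ∀ (u : A ⊗[R] M) b, ((algebraMap A (Localization.Away (evalDual w φ))).comp
      (evalSym u).toRingHom) b = algebraMap A _ (evalSym u b) := fun u b => rfl
    rw [f1, f1] at e1 e2
    rw [evalSym_smul _ _ ha, evalSym_smul _ _ (ι_mem_symGrading φ), pow_one, map_mul, map_mul, mul_pow, map_pow, mul_assoc]
      at e2
    have e3 := ((m.isUnit.map (algebraMap A (Localization.Away (evalDual w φ)))).pow n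
      ).mul_left_cancel e2
    rw [← e1] at e3
    have hu2 : IsUnit (algebraMap A (Localization.Away (evalDual w φ))
      (evalSym w (SymmetricAlgebra.ι R _ φ))) := by rw [evalSym_ι]; exact hu
    exact (hu2.pow n).mul_left_cancel e3

theorem exists_local_point [Module.Free R M] [Module.Finite R M] {T : Over (Spec (.of R))}
    (h : T ⟶ projSpace R M) {U : T.left.Opens} {x : T.left} (hx : x ∈ U) :
    ∃ (A : Type u) (_ : CommRing A) (_ : Algebra R A) (a : specOver R A ⟶ T)
      (φ : Module.Dual R M) (v : A ⊗[R] M) (hv : Unimodular v),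
      IsOpenImmersion a.left ∧ x ∈ Set.range a.left ∧ Set.range a.left ⊆ U ∧
      evalDual v φ = 1 ∧ a ≫ h = point v hv := by
  obtain ⟨φ, hφ⟩ : ∃ φ : Module.Dual R M, h.left x ∈ nonvanishing φ := by
    have := iSup_nonvanishing (R := R) (M := M)
    rw [← TopologicalSpace.Opens.mem_iSup, this]
    trivial
  obtain ⟨A, _, _, a, ha, hx', hU⟩ :=
    exists_affine_nhd T (U := U ⊓ h.left ⁻¹ᵁ nonvanishing φ) ⟨hx, hφ⟩
  obtain ⟨v, hv, h1, h2⟩ := exists_point_of_range_subset (φ := φ) (a ≫ h) (by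
    rintro _ ⟨p, rfl⟩
    exact (hU ⟨p, rfl⟩).2)
  exact ⟨A, _, _, a, φ, v, hv, ha, hx', fun y hy => (hU hy).1, h1, h2⟩

end Points

end

/-! ### Quadratic étale algebras: conjugation, trace and norm -/

section

/-- A generator `θ` of a quadratic étale algebra `L = F ⊕ F θ`, with `θ² = p θ - q`, and the
coordinates with respect to it; `d` is the inverse of the different `2 θ - p`. -/
structure Quadratic (F L : Type u) [Field F] [CommRing L] [Algebra F L] where
  θ : L
  p : F
  q : F
  d : L
  re : L →ₗ[F] F
  im : L →ₗ[F] F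
  eq_add : ∀ l, l = algebraMap F L (re l) + algebraMap F L (im l) * θ
  re_one : re 1 = 1
  im_one : im 1 = 0
  re_θ : re θ = 0
  im_θ : im θ = 1
  mul_self : θ * θ = algebraMap F L p * θ - algebraMap F L q
  mul_d : (2 * θ - algebraMap F L p) * d = 1

/-- In dimension two every θ outside F · 1 completes 1 to a basis. Étaleness is needed only to
invert 2θ − p, the derivative at θ of its quadratic equation. -/
theorem exists_quadratic (F L : Type u) [Field F] [CommRing L] [Algebra F L] [Algebra.Etale F L]
    (hL : Module.finrank F L = 2) : Nonempty (Quadratic F L) := by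
  have hfin : Module.Finite F L := Module.finite_of_finrank_pos (by omega)
  have hnt : Nontrivial L := Module.nontrivial_of_finrank_pos (R := F) (by omega)
  obtain ⟨θ, hθ⟩ : ∃ θ : L, θ ∉ Submodule.span F {(1 : L)} := by
    by_contra! h
    have := finrank_span_singleton (K := F) (one_ne_zero (α := L))
    rw [(Submodule.eq_top_iff'.2 h : Submodule.span F {(1 : L)} = ⊤), finrank_top] at this
    omega
  have hli : LinearIndependent F ![(1 : L), θ] := by
    rw [LinearIndependent.pair_iff]
    intro s t hst
    have ht : t = 0 := by
      by_contra ht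
      apply hθ
      rw [Submodule.mem_span_singleton]
      refine ⟨-(t⁻¹ * s), ?_⟩
      have h2 : t • θ = -(s • (1 : L)) := by rw [eq_neg_iff_add_eq_zero, add_comm]; exact hst
      have h3 : θ = t⁻¹ • t • θ := by rw [smul_smul, inv_mul_cancel₀ ht, one_smul]
      rw [h3, h2, smul_neg, smul_smul, neg_smul]
    refine ⟨?_, ht⟩
    rw [ht, zero_smul, add_zero] at hst
    exact (smul_eq_zero.1 hst).resolve_right one_ne_zero
  let b := basisOfLinearIndependentOfCardEqFinrank hli (by simp [hL])
  have hb : ⇑b = ![(1 : L), θ] := coe_basisOfLinearIndependentOfCardEqFinrank hli _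
  have hb0 : b 0 = 1 := by rw [hb]; rfl
  have hb1 : b 1 = θ := by rw [hb]; rfl
  have eq_add : ∀ l, l = algebraMap F L (b.coord 0 l) + algebraMap F L (b.coord 1 l) * θ := by
    intro l
    conv_lhs => rw [← b.sum_repr l]
    rw [Fin.sum_univ_two, hb0, hb1, Algebra.smul_def, Algebra.smul_def, mul_one]
    rfl
  have re_one : b.coord 0 1 = 1 := by rw [← hb0]; simp
  have im_one : b.coord 1 1 = 0 := by rw [← hb0]; simp
  have re_θ : b.coord 0 θ = 0 := by rw [← hb1]; simp
  have im_θ : b.coord 1 θ = 1 := by rw [← hb1]; simp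
  let p := b.coord 1 (θ * θ)
  let q := - b.coord 0 (θ * θ)
  have hsq : θ * θ = algebraMap F L p * θ - algebraMap F L q := by
    conv_lhs => rw [eq_add (θ * θ)]
    simp only [p, q, map_neg]; ring
  obtain ⟨d, hd⟩ : ∃ d, (2 * θ - algebraMap F L p) * d = 1 := by
    have hinj : Function.Injective (LinearMap.mulLeft F (2 * θ - algebraMap F L p)) := by
      rw [injective_iff_map_eq_zero]
      intro d hd
      rw [LinearMap.mulLeft_apply] at hd
      have him : ∀ l l', b.coord 1 (l * l') = b.coord 0 l * b.coord 1 l' +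
          b.coord 1 l * b.coord 0 l' + p * (b.coord 1 l * b.coord 1 l') := by
        intro l l'
        have : l * l' = (b.coord 0 l * b.coord 0 l' - q * (b.coord 1 l * b.coord 1 l')) • (1 : L)
            + (b.coord 0 l * b.coord 1 l' +
          b.coord 1 l * b.coord 0 l' + p * (b.coord 1 l * b.coord 1 l')) • θ := by
          conv_lhs => rw [eq_add l, eq_add l']
          simp only [Algebra.smul_def, map_add, map_mul, map_sub]
          linear_combination
            (algebraMap F L (b.coord 1 l) * algebraMap F L (b.coord 1 l')) * hsq
        conv_lhs => rw [this]
        rw [map_add, map_smul, map_smul, im_one, im_θ]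
        simp
      -- If (2θ − p) d = 0, then l ↦ im(l) d obeys the Leibniz rule. There are no differentials, so
      -- this derivation is zero, and its value at θ is d. Multiplication by 2θ − p is thus
      -- injective, hence surjective since L is finite-dimensional.
      let D : Derivation F L L := Derivation.mk' ((b.coord 1).smulRight d) (by
        intro l l'
        simp only [LinearMap.smulRight_apply, him, smul_eq_mul, Algebra.smul_def, map_add, map_mul]
        have h1 := congrArg (· * d) (eq_add l)
        have h2 := congrArg (· * d) (eq_add l')
        linear_combination -(algebraMap F L (b.coord 1 l')) * h1 -
          (algebraMap F L (b.coord 1 l)) * h2 -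
          (algebraMap F L (b.coord 1 l) * algebraMap F L (b.coord 1 l')) * hd)
      have hD : D = 0 := by
        rw [← D.liftKaehlerDifferential_comp]
        ext x
        simp [Subsingleton.elim (KaehlerDifferential.D F L x) 0]
      have := congrArg (fun D : Derivation F L L => D θ) hD
      simpa [D, im_θ] using this
    obtain ⟨d, hd⟩ := (LinearMap.injective_iff_surjective.1 hinj) 1
    exact ⟨d, hd⟩
  exact ⟨⟨θ, p, q, d, b.coord 0, b.coord 1, eq_add, re_one, im_one, re_θ, im_θ, hsq, hd⟩⟩

namespace Quadratic

variable {F L : Type u} [Field F] [CommRing L] [Algebra F L] (Q : Quadratic F L)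

theorem re_algebraMap (x : F) : Q.re (algebraMap F L x) = x := by
  rw [Algebra.algebraMap_eq_smul_one, map_smul, Q.re_one, smul_eq_mul, mul_one]

theorem re_mul (x y : L) : Q.re (x * y) = Q.re x * Q.re y - Q.q * (Q.im x * Q.im y) := by
  have : x * y = (Q.re x * Q.re y - Q.q * (Q.im x * Q.im y)) • (1 : L)
      + (Q.re x * Q.im y + Q.im x * Q.re y + Q.p * (Q.im x * Q.im y)) • Q.θ := by
    conv_lhs => rw [Q.eq_add x, Q.eq_add y]
    simp only [Algebra.smul_def, map_add, map_mul, map_sub]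
    linear_combination (algebraMap F L (Q.im x) * algebraMap F L (Q.im y)) * Q.mul_self
  conv_lhs => rw [this]
  rw [map_add, map_smul, map_smul, Q.re_one, Q.re_θ]
  simp

theorem im_mul (x y : L) : Q.im (x * y) =
    Q.re x * Q.im y + Q.im x * Q.re y + Q.p * (Q.im x * Q.im y) := by
  have : x * y = (Q.re x * Q.re y - Q.q * (Q.im x * Q.im y)) • (1 : L)
      + (Q.re x * Q.im y + Q.im x * Q.re y + Q.p * (Q.im x * Q.im y)) • Q.θ := by
    conv_lhs => rw [Q.eq_add x, Q.eq_add y]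
    simp only [Algebra.smul_def, map_add, map_mul, map_sub]
    linear_combination (algebraMap F L (Q.im x) * algebraMap F L (Q.im y)) * Q.mul_self
  conv_lhs => rw [this]
  rw [map_add, map_smul, map_smul, Q.im_one, Q.im_θ]
  simp

/-- The nontrivial automorphism of a quadratic étale algebra. -/
noncomputable def conj : L →ₐ[F] L :=
  AlgHom.ofLinearMap ((LinearMap.toSpanSingleton F L 1) ∘ₗ (Q.re + Q.p • Q.im) -
      (LinearMap.toSpanSingleton F L Q.θ) ∘ₗ Q.im)
    (by simp [Q.re_one, Q.im_one])
    (by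
      intro x y
      simp only [LinearMap.sub_apply, LinearMap.comp_apply, LinearMap.add_apply,
        LinearMap.smul_apply, LinearMap.toSpanSingleton_apply, Q.re_mul, Q.im_mul,
        Algebra.smul_def, map_add, map_mul, map_sub]
      simp only [Algebra.algebraMap_self, RingHom.id_apply]
      linear_combination (-algebraMap F L (Q.im x) * algebraMap F L (Q.im y)) * Q.mul_self)

theorem conj_apply (x : L) : Q.conj x =
    algebraMap F L (Q.re x + Q.p * Q.im x) - algebraMap F L (Q.im x) * Q.θ := by
  simp [conj, Algebra.smul_def]

theorem conj_θ : Q.conj Q.θ = algebraMap F L Q.p - Q.θ := by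
  rw [conj_apply, Q.re_θ, Q.im_θ]; simp

section BaseChange

variable {A B : Type u} [CommRing A] [Algebra F A] [CommRing B] [Algebra F B]

/-- The embedding of the scalars. -/
noncomputable abbrev scal : A →ₐ[F] L ⊗[F] A := Algebra.TensorProduct.includeRight

/-- The generator of the algebra over an extension of the base. -/
noncomputable def gen (A : Type u) [CommRing A] [Algebra F A] : L ⊗[F] A := Q.θ ⊗ₜ 1

/-- First coordinate of an element of `L ⊗ A`. -/
noncomputable def reA : L ⊗[F] A →ₗ[F] A :=
  (TensorProduct.lid F A).toLinearMap ∘ₗ LinearMap.rTensor A Q.re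

/-- Second coordinate of an element of `L ⊗ A`. -/
noncomputable def imA : L ⊗[F] A →ₗ[F] A :=
  (TensorProduct.lid F A).toLinearMap ∘ₗ LinearMap.rTensor A Q.im

theorem reA_tmul (l : L) (a : A) : Q.reA (l ⊗ₜ a) = Q.re l • a := rfl

theorem imA_tmul (l : L) (a : A) : Q.imA (l ⊗ₜ a) = Q.im l • a := rfl

theorem scal_add (x : L ⊗[F] A) : x = scal (Q.reA x) + scal (Q.imA x) * Q.gen A := by
  induction x with
  | zero => simp
  | tmul l a =>
    rw [reA_tmul, imA_tmul, gen, map_smul, map_smul]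
    simp only [Algebra.TensorProduct.includeRight_apply, smul_tmul', Algebra.smul_mul_assoc,
      Algebra.TensorProduct.tmul_mul_tmul, one_mul, mul_one]
    rw [← add_tmul]
    congr 1
    conv_lhs => rw [Q.eq_add l]
    simp [Algebra.smul_def]
  | add x y hx hy =>
    rw [map_add, map_add, map_add, map_add, add_mul, add_add_add_comm, ← hx, ← hy]

theorem reA_scal_mul (a : A) (x : L ⊗[F] A) : Q.reA (scal a * x) = a * Q.reA x := by
  induction x with
  | zero => simp
  | tmul l b => simp [reA_tmul]
  | add x y hx hy => rw [mul_add, map_add, map_add, hx, hy, mul_add]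

theorem imA_scal_mul (a : A) (x : L ⊗[F] A) : Q.imA (scal a * x) = a * Q.imA x := by
  induction x with
  | zero => simp
  | tmul l b => simp [imA_tmul]
  | add x y hx hy => rw [mul_add, map_add, map_add, hx, hy, mul_add]

theorem reA_one : Q.reA (1 : L ⊗[F] A) = 1 := by
  rw [Algebra.TensorProduct.one_def, reA_tmul, Q.re_one, one_smul]

theorem imA_one : Q.imA (1 : L ⊗[F] A) = 0 := by
  rw [Algebra.TensorProduct.one_def, imA_tmul, Q.im_one, zero_smul]

theorem reA_gen : Q.reA (Q.gen A) = 0 := by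
  rw [gen, reA_tmul, Q.re_θ, zero_smul]

theorem imA_gen : Q.imA (Q.gen A) = 1 := by
  rw [gen, imA_tmul, Q.im_θ, one_smul]

theorem reA_scal (a : A) : Q.reA (scal a : L ⊗[F] A) = a := by
  rw [← mul_one (scal a), reA_scal_mul, reA_one, mul_one]

theorem imA_scal (a : A) : Q.imA (scal a : L ⊗[F] A) = 0 := by
  rw [← mul_one (scal a), imA_scal_mul, imA_one, mul_zero]

theorem scal_injective (Q : Quadratic F L) : Function.Injective (scal : A →ₐ[F] L ⊗[F] A) :=
  Function.LeftInverse.injective Q.reA_scal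

theorem ext_iff (Q : Quadratic F L) {x y : L ⊗[F] A} : x = y ↔ Q.reA x = Q.reA y ∧ Q.imA x = Q.imA y :=
  ⟨fun h => h ▸ ⟨rfl, rfl⟩, fun h => by rw [Q.scal_add x, Q.scal_add y, h.1, h.2]⟩

theorem reA_add_mul_gen (s t : A) : Q.reA (scal s + scal t * Q.gen A) = s := by
  rw [map_add, reA_scal, reA_scal_mul, reA_gen, mul_zero, add_zero]

theorem imA_add_mul_gen (s t : A) : Q.imA (scal s + scal t * Q.gen A) = t := by
  rw [map_add, imA_scal, imA_scal_mul, imA_gen, mul_one, zero_add]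

theorem gen_mul_gen : Q.gen A * Q.gen A =
    scal (algebraMap F A Q.p) * Q.gen A - scal (algebraMap F A Q.q) := by
  simp only [gen, Algebra.TensorProduct.includeRight_apply, Algebra.TensorProduct.tmul_mul_tmul,
    Q.mul_self, one_mul, mul_one, sub_tmul]
  rw [Algebra.algebraMap_eq_smul_one, Algebra.algebraMap_eq_smul_one,
    Algebra.algebraMap_eq_smul_one, Algebra.algebraMap_eq_smul_one, tmul_smul, tmul_smul,
    smul_tmul', smul_tmul', smul_mul_assoc, one_mul]

/-- The conjugation of `L ⊗ A`. -/
noncomputable def conjA : L ⊗[F] A →ₐ[F] L ⊗[F] A :=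
  Algebra.TensorProduct.map Q.conj (AlgHom.id F A)

theorem conjA_scal (a : A) : Q.conjA (scal a) = scal a := by
  simp [conjA]

theorem conjA_gen : Q.conjA (Q.gen A) = scal (algebraMap F A Q.p) - Q.gen A := by
  simp only [conjA, gen, Algebra.TensorProduct.map_tmul, conj_θ, map_one, sub_tmul,
    Algebra.TensorProduct.includeRight_apply]
  rw [Algebra.algebraMap_eq_smul_one, Algebra.algebraMap_eq_smul_one, tmul_smul, smul_tmul']

theorem conjA_conjA (x : L ⊗[F] A) : Q.conjA (Q.conjA x) = x := by
  conv_lhs => rw [Q.scal_add x]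
  conv_rhs => rw [Q.scal_add x]
  simp only [map_add, map_mul, conjA_scal, conjA_gen, map_sub, sub_sub_cancel]

/-- The trace of an element of `L ⊗ A`. -/
noncomputable def tr (x : L ⊗[F] A) : A := 2 * Q.reA x + algebraMap F A Q.p * Q.imA x

/-- The norm of an element of `L ⊗ A`. -/
noncomputable def nm (x : L ⊗[F] A) : A :=
  Q.reA x * Q.reA x + algebraMap F A Q.p * (Q.reA x * Q.imA x) +
    algebraMap F A Q.q * (Q.imA x * Q.imA x)

theorem scal_tr (x : L ⊗[F] A) : scal (Q.tr x) = x + Q.conjA x := by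
  conv_rhs => rw [Q.scal_add x]
  simp only [map_add, map_mul, conjA_scal, conjA_gen, tr, map_ofNat]
  ring

theorem scal_nm (x : L ⊗[F] A) : scal (Q.nm x) = x * Q.conjA x := by
  conv_rhs => rw [Q.scal_add x]
  simp only [map_add, map_mul, conjA_scal, conjA_gen, nm]
  linear_combination scal (Q.imA x) * scal (Q.imA x) * Q.gen_mul_gen (A := A)

theorem nm_mul (x y : L ⊗[F] A) : Q.nm (x * y) = Q.nm x * Q.nm y := by
  apply Q.scal_injective
  rw [map_mul, scal_nm, scal_nm, scal_nm, map_mul]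
  ring

theorem nm_scal (a : A) : Q.nm (scal a) = a * a := by
  rw [nm, reA_scal, imA_scal]; ring

theorem nm_one : Q.nm (1 : L ⊗[F] A) = 1 := by
  simp [nm, reA_one, imA_one]

theorem nm_add (x y : L ⊗[F] A) : Q.nm (x + y) = Q.nm x + Q.nm y + Q.tr (Q.conjA x * y) := by
  apply Q.scal_injective
  rw [map_add, map_add, scal_nm, scal_nm, scal_nm, scal_tr, map_mul, conjA_conjA, map_add]
  ring

theorem isUnit_iff (x : L ⊗[F] A) : IsUnit x ↔ IsUnit (Q.nm x) := by
  constructor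
  · rintro ⟨u, rfl⟩
    refine .of_mul_eq_one (Q.nm (u⁻¹ : (L ⊗[F] A)ˣ)) ?_
    rw [← nm_mul, Units.mul_inv, nm_one]
  · intro h
    have := h.map (scal : A →ₐ[F] L ⊗[F] A)
    rw [scal_nm] at this
    exact isUnit_of_mul_isUnit_left this

theorem scal_mem_nonZeroDivisors (Q : Quadratic F L) {a : A} (ha : a ∈ nonZeroDivisors A) :
    (scal a : L ⊗[F] A) ∈ nonZeroDivisors (L ⊗[F] A) := by
  rw [mem_nonZeroDivisors_iff_right] at ha ⊢
  intro x hx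
  rw [mul_comm] at hx
  rw [Q.ext_iff]
  constructor
  · rw [map_zero]
    apply ha
    rw [mul_comm, ← reA_scal_mul, hx, map_zero]
  · rw [map_zero]
    apply ha
    rw [mul_comm, ← imA_scal_mul, hx, map_zero]

theorem mem_nonZeroDivisors_of_nm {x : L ⊗[F] A} (h : Q.nm x ∈ nonZeroDivisors A) :
    x ∈ nonZeroDivisors (L ⊗[F] A) := by
  have := Q.scal_mem_nonZeroDivisors h
  rw [scal_nm] at this
  exact (mul_mem_nonZeroDivisors.1 this).1

/-- L ⊗ A is free over A on 1 and `gen`, so extending an ideal I gives I ⊕ I · gen. In particular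
extension followed by contraction returns I, which lets ideal membership in A be checked in L ⊗ A.
-/
theorem mem_map_iff {I : Ideal A} {x : L ⊗[F] A} :
    x ∈ I.map (scal : A →ₐ[F] L ⊗[F] A) ↔ Q.reA x ∈ I ∧ Q.imA x ∈ I := by
  constructor
  · intro hx
    refine Submodule.span_induction ?_ ?_ ?_ ?_ hx
    · rintro _ ⟨a, ha, rfl⟩
      rw [reA_scal, imA_scal]; exact ⟨ha, I.zero_mem⟩
    · rw [map_zero, map_zero]; exact ⟨I.zero_mem, I.zero_mem⟩
    · intro x y _ _ hx hy
      rw [map_add, map_add]; exact ⟨I.add_mem hx.1 hy.1, I.add_mem hx.2 hy.2⟩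
    · intro z x _ hx
      have h : z * x = scal (Q.reA z * Q.reA x - algebraMap F A Q.q * (Q.imA z * Q.imA x)) +
          scal (Q.reA z * Q.imA x + Q.imA z * Q.reA x +
            algebraMap F A Q.p * (Q.imA z * Q.imA x)) * Q.gen A := by
        conv_lhs => rw [Q.scal_add x, Q.scal_add z]
        simp only [map_add, map_sub, map_mul]
        linear_combination scal (Q.imA z) * scal (Q.imA x) * Q.gen_mul_gen (A := A)
      rw [smul_eq_mul, h, reA_add_mul_gen, imA_add_mul_gen]
      exact ⟨I.sub_mem (I.mul_mem_left _ hx.1) (I.mul_mem_left _ (I.mul_mem_left _ hx.2)),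
        I.add_mem (I.add_mem (I.mul_mem_left _ hx.2) (I.mul_mem_left _ hx.1))
          (I.mul_mem_left _ (I.mul_mem_left _ hx.2))⟩
  · rintro ⟨h1, h2⟩
    rw [Q.scal_add x]
    exact Ideal.add_mem _ (Ideal.mem_map_of_mem _ h1)
      (Ideal.mul_mem_right _ _ (Ideal.mem_map_of_mem _ h2))

theorem scal_mem_map_iff (Q : Quadratic F L) {I : Ideal A} {a : A} :
    (scal a : L ⊗[F] A) ∈ I.map (scal : A →ₐ[F] L ⊗[F] A) ↔ a ∈ I := by
  rw [Q.mem_map_iff, reA_scal, imA_scal]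
  simp

theorem gen_different (A : Type u) [CommRing A] [Algebra F A] :
    (2 * Q.gen A - scal (algebraMap F A Q.p)) * (Q.d ⊗ₜ 1) = 1 := by
  have : (2 * Q.gen A - scal (algebraMap F A Q.p)) =
      (2 * Q.θ - algebraMap F L Q.p) ⊗ₜ[F] (1 : A) := by
    rw [gen, Algebra.TensorProduct.includeRight_apply, sub_tmul, two_mul, two_mul, add_tmul,
      Algebra.algebraMap_eq_smul_one, Algebra.algebraMap_eq_smul_one, tmul_smul, smul_tmul']
  rw [this, Algebra.TensorProduct.tmul_mul_tmul, Q.mul_d, mul_one, Algebra.TensorProduct.one_def]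

/-- The trace form is nondegenerate: an element lies in the extension of an ideal if its traces
against all elements do. -/
theorem mem_map_of_tr_mem {I : Ideal A} {x : L ⊗[F] A} (h : ∀ l : L, Q.tr ((l ⊗ₜ 1) * x) ∈ I) :
    x ∈ I.map (scal : A →ₐ[F] L ⊗[F] A) := by
  have h1 := Ideal.mem_map_of_mem (scal : A →ₐ[F] L ⊗[F] A) (h 1)
  have h2 := Ideal.mem_map_of_mem (scal : A →ₐ[F] L ⊗[F] A) (h Q.θ)
  rw [scal_tr, ← Algebra.TensorProduct.one_def, one_mul] at h1
  rw [scal_tr, ← gen, map_mul, conjA_gen] at h2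
  -- The dual basis for the trace form: x is recovered from its traces against 1 and θ, since θ
  -- minus its conjugate is 2θ − p, with inverse d.
  have : x = (Q.d ⊗ₜ 1) * ((Q.gen A * x + (scal (algebraMap F A Q.p) - Q.gen A) * Q.conjA x) -
      (scal (algebraMap F A Q.p) - Q.gen A) * (x + Q.conjA x)) := by
    linear_combination -x * Q.gen_different A
  rw [this]
  exact Ideal.mul_mem_left _ _ (Ideal.sub_mem _ h2 (Ideal.mul_mem_left _ _ h1))

section Functoriality

variable (f : A →ₐ[F] B)

/-- Extension of scalars for `L ⊗ A`. -/
noncomputable abbrev mapA (f : A →ₐ[F] B) : L ⊗[F] A →ₐ[L] L ⊗[F] B :=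
  Algebra.TensorProduct.map (AlgHom.id L L) f

theorem reA_mapA (x : L ⊗[F] A) : Q.reA (mapA f x) = f (Q.reA x) := by
  induction x with
  | zero => simp
  | tmul l a => simp [reA_tmul]
  | add x y hx hy => rw [map_add, map_add, map_add, map_add, hx, hy]

theorem imA_mapA (x : L ⊗[F] A) : Q.imA (mapA f x) = f (Q.imA x) := by
  induction x with
  | zero => simp
  | tmul l a => simp [imA_tmul]
  | add x y hx hy => rw [map_add, map_add, map_add, map_add, hx, hy]

theorem nm_mapA (x : L ⊗[F] A) : Q.nm (mapA f x) = f (Q.nm x) := by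
  simp [nm, reA_mapA, imA_mapA]

theorem mapA_scal (a : A) : mapA f (scal a : L ⊗[F] A) = scal (f a) := by
  simp

end Functoriality
end BaseChange
end Quadratic

end

/-! ### L-linear coordinates of a vector and its norm ideal -/

section

open Quadratic

variable {F L N : Type u} [Field F] [CommRing L] [Algebra F L] [AddCommGroup N] [Module F N]
  [Module L N] [IsScalarTower F L N]

section Ext

variable {A B : Type u} [CommRing A] [Algebra F A] [CommRing B] [Algebra F B]

/-- The value of an `L`-linear form at the `L`-span of a vector. -/
noncomputable def co (w : A ⊗[F] N) : Module.Dual L N →ₗ[L] L ⊗[F] A := evalDual (toExt L w)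

theorem toExt_tmul (a : A) (n : N) :
    toExt L (a ⊗ₜ[F] n) = ((1 : L) ⊗ₜ[F] a) ⊗ₜ[L] n := rfl

theorem co_tmul (a : A) (n : N) (φ : Module.Dual L N) : co (a ⊗ₜ[F] n) φ = φ n ⊗ₜ[F] a := by
  rw [co, toExt_tmul, evalDual_tmul, smul_tmul', smul_eq_mul, mul_one]

theorem co_add (v w : A ⊗[F] N) (φ : Module.Dual L N) : co (v + w) φ = co v φ + co w φ := by
  rw [co, map_add, evalDual_add]; rfl

theorem co_zero (φ : Module.Dual L N) : co (0 : A ⊗[F] N) φ = 0 := by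
  rw [co, map_zero, evalDual_zero]

theorem toExt_smul (a : A) (w : A ⊗[F] N) :
    toExt L (a • w) = (scal a : L ⊗[F] A) • toExt L w := by
  induction w with
  | zero => rw [smul_zero, map_zero, smul_zero]
  | tmul b n =>
    rw [smul_tmul', toExt_tmul, toExt_tmul, smul_tmul']
    simp
  | add v w hv hw => rw [smul_add, map_add, map_add, smul_add, hv, hw]

theorem co_smul (a : A) (w : A ⊗[F] N) (φ : Module.Dual L N) :
    co (a • w) φ = scal a * co w φ := by
  rw [co, toExt_smul, evalDual_smul]; rfl

theorem toExt_mapVec (f : A →ₐ[F] B) (w : A ⊗[F] N) :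
    toExt L (mapVec f w) = mapVec (mapA f) (toExt L w) := by
  induction w with
  | zero => simp only [map_zero]
  | tmul b n =>
    rw [mapVec_tmul, toExt_tmul, toExt_tmul, mapVec_tmul]
    simp
  | add v w hv hw => simp only [map_add, hv, hw]

theorem co_mapVec (f : A →ₐ[F] B) (w : A ⊗[F] N) (φ : Module.Dual L N) :
    co (mapVec f w) φ = mapA f (co w φ) := by
  rw [co, toExt_mapVec, evalDual_mapVec]; rfl

variable (Q : Quadratic F L)

/-- The trace of an `L`-linear form. -/
noncomputable def trDual (φ : Module.Dual L N) : Module.Dual F N :=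
  ((2 : F) • Q.re + Q.p • Q.im) ∘ₗ φ.restrictScalars F

theorem evalDual_trDual (w : A ⊗[F] N) (φ : Module.Dual L N) :
    evalDual w (trDual Q φ) = Q.tr (co w φ) := by
  induction w with
  | zero => simp [co_zero, tr]
  | tmul a n =>
    rw [evalDual_tmul, co_tmul, tr, reA_tmul, imA_tmul]
    simp only [trDual, LinearMap.comp_apply, LinearMap.add_apply, LinearMap.smul_apply,
      LinearMap.restrictScalars_apply, smul_eq_mul, Algebra.smul_def, map_add, map_mul, map_ofNat]
    ring
  | add v w hv hw => rw [evalDual_add, hv, hw, co_add, tr, tr, tr, map_add, map_add]; ring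

theorem trDual_apply (φ : Module.Dual L N) (n : N) :
    algebraMap F L (trDual Q φ n) = φ n + Q.conj (φ n) := by
  rw [Q.conj_apply]
  simp only [trDual, LinearMap.comp_apply, LinearMap.add_apply, LinearMap.smul_apply,
    LinearMap.restrictScalars_apply, smul_eq_mul, map_add, map_mul, map_ofNat]
  linear_combination -Q.eq_add (φ n)

/-- The `L`-linear form whose trace is a given `F`-linear form. -/
noncomputable def dualOfDual (ψ : Module.Dual F N) : Module.Dual L N where
  -- An element y of L equals d (tr(θ y) − θ̄ tr(y)); the formula is this identity for y = φ n, with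
  -- ψ the trace of φ.
  toFun n := Q.d * (algebraMap F L (ψ (Q.θ • n)) - Q.conj Q.θ * algebraMap F L (ψ n))
  map_add' m n := by simp only [smul_add, map_add]; ring
  map_smul' l n := by
    have h1 : ψ (l • n) = Q.re l * ψ n + Q.im l * ψ (Q.θ • n) := by
      conv_lhs => rw [Q.eq_add l]
      rw [add_smul, mul_smul, algebraMap_smul, algebraMap_smul, map_add, map_smul, map_smul]
      rfl
    have h2 : ψ (Q.θ • l • n) = Q.re l * ψ (Q.θ • n) +
        Q.im l * (Q.p * ψ (Q.θ • n) - Q.q * ψ n) := by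
      conv_lhs => rw [Q.eq_add l]
      rw [add_smul, mul_smul, algebraMap_smul, algebraMap_smul, smul_add, smul_comm Q.θ,
        smul_comm Q.θ (Q.im l), smul_smul, Q.mul_self, sub_smul, mul_smul, algebraMap_smul,
        algebraMap_smul, map_add, map_smul ψ (Q.re l), map_smul ψ (Q.im l), map_sub,
        map_smul ψ Q.p, map_smul ψ Q.q]
      rfl
    rw [h1, h2, RingHom.id_apply, smul_eq_mul]
    conv_rhs => rw [Q.eq_add l]
    simp only [map_add, map_mul, map_sub, conj_θ]
    linear_combination (-Q.d * algebraMap F L (Q.im l) * algebraMap F L (ψ n)) * Q.mul_self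

theorem dualOfDual_apply (ψ : Module.Dual F N) (n : N) : dualOfDual Q ψ n =
    Q.d * (algebraMap F L (ψ (Q.θ • n)) - Q.conj Q.θ * algebraMap F L (ψ n)) := rfl

theorem conj_d : Q.conj Q.d = - Q.d := by
  have h1 := congrArg Q.conj Q.mul_d
  simp only [map_mul, map_sub, map_ofNat, conj_θ, AlgHom.commutes, map_one] at h1
  linear_combination (-Q.conj Q.d) * Q.mul_d - Q.d * h1

theorem trDual_dualOfDual (ψ : Module.Dual F N) : trDual Q (dualOfDual Q ψ) = ψ := by
  ext n
  have : Function.Injective (algebraMap F L) :=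
    Function.LeftInverse.injective Q.re_algebraMap
  apply this
  rw [trDual_apply, dualOfDual_apply]
  simp only [map_mul, map_sub, conj_θ, AlgHom.commutes, conj_d]
  linear_combination algebraMap F L (ψ n) * Q.mul_d

theorem trDual_injective : Function.Injective (trDual Q : Module.Dual L N → Module.Dual F N) := by
  intro φ χ h
  have key : ∀ φ : Module.Dual L N, dualOfDual Q (trDual Q φ) = φ := by
    intro φ
    ext n
    rw [dualOfDual_apply, trDual_apply, trDual_apply, map_smul, smul_eq_mul, map_mul]
    linear_combination φ n * Q.mul_d - Q.d * φ n * Q.conj_θ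
  rw [← key φ, h, key χ]

theorem dualOfDual_trDual (φ : Module.Dual L N) : dualOfDual Q (trDual Q φ) = φ :=
  trDual_injective Q (trDual_dualOfDual Q _)

/-- The trace identifies L-linear with F-linear forms on N, so the F-linear coordinates of a vector
are determined by its L-linear ones. This is what makes `toExt` injective. -/
theorem evalDual_eq_tr (w : A ⊗[F] N) (ψ : Module.Dual F N) :
    evalDual w ψ = Q.tr (co w (dualOfDual Q ψ)) := by
  rw [← evalDual_trDual, trDual_dualOfDual]

/-- The ideal of the locus where the span of a vector degenerates. -/
noncomputable def normIdeal (w : A ⊗[F] N) : Ideal A :=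
  Ideal.span (Set.range fun φ : Module.Dual L N => Q.nm (co w φ))

theorem nm_mem_normIdeal (w : A ⊗[F] N) (φ : Module.Dual L N) :
    Q.nm (co w φ) ∈ normIdeal Q w := Ideal.subset_span ⟨φ, rfl⟩

theorem normIdeal_mapVec (f : A →ₐ[F] B) (w : A ⊗[F] N) :
    normIdeal Q (mapVec f w) = (normIdeal Q w).map f.toRingHom := by
  rw [normIdeal, normIdeal, Ideal.map_span, ← Set.range_comp]
  congr 2
  ext φ
  simp only [co_mapVec, nm_mapA, Function.comp_apply]
  rfl

/-- By polarization of the norm, the trace of conj(co w φ) · co w (l ψ) lies in the norm ideal for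
every l ∈ L. These are the traces of l times the product, and the trace form is nondegenerate. -/
theorem conjA_co_mul_co_mem (w : A ⊗[F] N) (φ ψ : Module.Dual L N) :
    Q.conjA (co w φ) * co w ψ ∈ (normIdeal Q w).map (scal : A →ₐ[F] L ⊗[F] A) := by
  refine Q.mem_map_of_tr_mem fun l => ?_
  have h : (l ⊗ₜ[F] (1 : A)) * (Q.conjA (co w φ) * co w ψ) =
      Q.conjA (co w φ) * co w (l • ψ) := by
    rw [map_smul, Algebra.smul_def, Algebra.TensorProduct.algebraMap_apply]
    simp only [Algebra.algebraMap_self, RingHom.id_apply]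
    ring
  have h2 := Q.nm_add (co w φ) (co w (l • ψ))
  rw [h, ← add_sub_cancel_left (Q.nm (co w φ) + Q.nm (co w (l • ψ)))
    (Q.tr (Q.conjA (co w φ) * co w (l • ψ))), ← h2, ← map_add]
  exact Ideal.sub_mem _ (nm_mem_normIdeal _ _ _)
    (Ideal.add_mem _ (nm_mem_normIdeal _ _ _) (nm_mem_normIdeal _ _ _))

theorem normIdeal_le_iff (w : A ⊗[F] N) (I : Ideal A) :
    normIdeal Q w ≤ I ↔ ∀ φ, Q.nm (co w φ) ∈ I := by
  rw [normIdeal, Ideal.span_le]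
  exact ⟨fun h φ => h ⟨φ, rfl⟩, fun h => by rintro _ ⟨φ, rfl⟩; exact h φ⟩

theorem unimodular_of_normIdeal_eq_top {w : A ⊗[F] N} (h : normIdeal Q w = ⊤) :
    Unimodular (toExt L w) := by
  have : (normIdeal Q w).map (scal : A →ₐ[F] L ⊗[F] A) ≤ Ideal.span (Set.range (co w)) := by
    rw [normIdeal, Ideal.map_span, Ideal.span_le]
    rintro _ ⟨_, ⟨φ, rfl⟩, rfl⟩
    rw [scal_nm]
    exact Ideal.mul_mem_right _ _ (Ideal.subset_span ⟨φ, rfl⟩)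
  rw [h, Ideal.map_top, top_le_iff] at this
  exact this

/-- The product of the coordinate ideal and its conjugate lies in the extended norm ideal; if the
first is the unit ideal, so are all three, and the norm ideal is recovered by contraction. -/
theorem normIdeal_eq_top_of_unimodular {w : A ⊗[F] N} (h : Unimodular (toExt L w)) :
    normIdeal Q w = ⊤ := by
  have h1 : Ideal.span (Set.range (co w)) = (⊤ : Ideal (L ⊗[F] A)) := h
  have h2 : (Ideal.span (Set.range (co w))).map Q.conjA * Ideal.span (Set.range (co w)) ≤
      (normIdeal Q w).map (scal : A →ₐ[F] L ⊗[F] A) := by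
    rw [Ideal.map_span, Ideal.span_mul_span', Ideal.span_le]
    rintro _ ⟨_, ⟨_, ⟨φ, rfl⟩, rfl⟩, _, ⟨ψ, rfl⟩, rfl⟩
    exact conjA_co_mul_co_mem Q w φ ψ
  rw [h1, Ideal.map_top, Ideal.mul_top, top_le_iff] at h2
  rw [Ideal.eq_top_iff_one, ← Q.scal_mem_map_iff, h2]
  trivial

/-- Multiplicativity of the norm. When v generates an L-line, its norm ideal is the unit ideal, and
the norm ideal of w = l v is principal, generated by the norm of l. -/
theorem normIdeal_of_toExt_eq_smul {v w : A ⊗[F] N} {l : L ⊗[F] A}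
    (h : toExt L w = l • toExt L v) : normIdeal Q w = Ideal.span {Q.nm l} * normIdeal Q v := by
  have : ∀ φ, Q.nm (co w φ) = Q.nm l * Q.nm (co v φ) := fun φ => by
    rw [co, h, evalDual_smul, nm_mul]; rfl
  rw [normIdeal, normIdeal, Ideal.span_mul_span']
  congr 1
  ext x
  simp [this]

theorem toExt_surjective :
    Function.Surjective (toExt L : A ⊗[F] N →ₗ[F] (L ⊗[F] A) ⊗[L] N) := by
  intro w
  induction w with
  | zero => exact ⟨0, map_zero _⟩
  | tmul x n =>
    induction x with
    | zero => exact ⟨0, by rw [map_zero, zero_tmul]⟩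
    | tmul l a =>
      refine ⟨a ⊗ₜ (l • n), ?_⟩
      rw [toExt_tmul, ← smul_tmul, smul_tmul', smul_eq_mul, mul_one]
    | add x y hx hy =>
      obtain ⟨v, hv⟩ := hx
      obtain ⟨w, hw⟩ := hy
      exact ⟨v + w, by rw [map_add, hv, hw, add_tmul]⟩
  | add x y hx hy =>
    obtain ⟨v, hv⟩ := hx
    obtain ⟨w, hw⟩ := hy
    exact ⟨v + w, by rw [map_add, hv, hw]⟩

variable [Module.Free L N] [Module.Finite L N]

theorem toExt_injective (Q : Quadratic F L) [Module.Finite F L] :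
    Function.Injective (toExt L : A ⊗[F] N →ₗ[F] (L ⊗[F] A) ⊗[L] N) := by
  have : Module.Free F N := Module.Free.trans (R := F) (S := L) (M := N)
  have : Module.Finite F N := Module.Finite.trans L N
  intro v w h
  refine vec_ext fun ψ => ?_
  rw [evalDual_eq_tr Q, evalDual_eq_tr Q, co, h]
  rfl

/-- Over a field, the annihilator of a vector is nonzero if and only if its norm ideal vanishes. -/
theorem exists_ann_iff {K : Type u} [Field K] [Algebra F K] (v : K ⊗[F] N) (hv : Unimodular v) :
    (∃ a : L ⊗[F] K, a ≠ 0 ∧ a • toExt L v = 0) ↔ normIdeal Q v = ⊥ := by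
  constructor
  · rintro ⟨a, ha, hav⟩
    rw [← le_bot_iff, normIdeal_le_iff]
    intro φ
    by_contra hn
    have hu := (Q.isUnit_iff _).2 (isUnit_iff_ne_zero.2 hn)
    apply ha
    rw [← hu.mul_left_eq_zero, co, ← evalDual_smul, hav, evalDual_zero]
  · intro h
    obtain ⟨φ, hφ⟩ : ∃ φ : Module.Dual L N, co v φ ≠ 0 := by
      by_contra! hc
      have : Ideal.span (Set.range (evalDual v)) = ⊥ := by
        rw [Ideal.span_eq_bot]
        rintro _ ⟨ψ, rfl⟩
        rw [evalDual_eq_tr Q, hc]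
        simp [tr]
      rw [show Ideal.span (Set.range (evalDual v)) = ⊤ from hv] at this
      exact top_ne_bot this
    -- The conjugate of a nonzero coordinate annihilates v: its products with all coordinates lie in
    -- the extended norm ideal, which is zero.
    refine ⟨Q.conjA (co v φ), ?_, ?_⟩
    · intro h0
      apply hφ
      rw [← Q.conjA_conjA (co v φ), h0, map_zero]
    · refine vec_ext fun ψ => ?_
      have := conjA_co_mul_co_mem Q v φ ψ
      rw [h, Ideal.map_bot] at this
      rw [evalDual_smul, evalDual_zero]
      exact this

end Ext

end

/-! ### Ideal sheaves on affine schemes and invertible ideals -/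

section

section SpecIdeal

variable {A B : Type u} [CommRing A] [CommRing B]

/-- The ideal sheaf on `Spec A` defined by an ideal of `A`. -/
noncomputable def specIdeal (J : Ideal A) : (Spec (.of A)).IdealSheafData :=
  .ofIdealTop (J.comap (Scheme.ΓSpecIso (.of A)).hom.hom)

theorem specIdeal_ideal_top (J : Ideal A) :
    (specIdeal J).ideal ⟨⊤, isAffineOpen_top _⟩ = J.comap (Scheme.ΓSpecIso (.of A)).hom.hom :=
  Scheme.IdealSheafData.equivOfIsAffine.right_inv _

theorem ΓSpecIso_surjective : Function.Surjective (Scheme.ΓSpecIso (.of A)).hom.hom :=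
  fun a => ⟨(Scheme.ΓSpecIso (.of A)).inv.hom a, by
    change ((Scheme.ΓSpecIso (.of A)).inv ≫ (Scheme.ΓSpecIso (.of A)).hom).hom a = a
    rw [Iso.inv_hom_id]; rfl⟩

theorem specIdeal_le_iff {J K : Ideal A} : specIdeal J ≤ specIdeal K ↔ J ≤ K := by
  rw [← Ideal.comap_le_comap_iff_of_surjective _ ΓSpecIso_surjective, ← specIdeal_ideal_top,
    ← specIdeal_ideal_top]
  exact ⟨fun h => h _, Scheme.IdealSheafData.le_of_isAffine⟩

theorem specIdeal_injective : Function.Injective (specIdeal : Ideal A → _) := fun _ _ h =>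
  le_antisymm (specIdeal_le_iff.1 h.le) (specIdeal_le_iff.1 h.ge)

theorem specIdeal_surjective (I : (Spec (.of A)).IdealSheafData) : ∃ J : Ideal A, specIdeal J = I := by
  refine ⟨(I.ideal ⟨⊤, isAffineOpen_top _⟩).comap (Scheme.ΓSpecIso (.of A)).inv.hom, ?_⟩
  apply Scheme.IdealSheafData.ext_of_isAffine
  rw [specIdeal_ideal_top, Ideal.comap_comap]
  have : (Scheme.ΓSpecIso (.of A)).inv.hom.comp (Scheme.ΓSpecIso (.of A)).hom.hom =
      RingHom.id _ := by
    rw [← CommRingCat.hom_comp, Iso.hom_inv_id]; rfl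
  rw [this, Ideal.comap_id]

theorem map_specIdeal (f : A →+* B) (J : Ideal B) :
    (specIdeal J).map (Spec.map (CommRingCat.ofHom f)) = specIdeal (J.comap f) := by
  apply Scheme.IdealSheafData.ext_of_isAffine
  rw [Scheme.IdealSheafData.ideal_map _ _ _ (isAffineOpen_top _), specIdeal_ideal_top]
  have := specIdeal_ideal_top J
  refine (congrArg (Ideal.comap _) this).trans ?_
  rw [Ideal.comap_comap]
  refine (Ideal.comap_comap _ _).trans (congrArg (fun g => Ideal.comap g J) ?_)
  exact congrArg (fun g => g.hom) (Scheme.ΓSpecIso_naturality (CommRingCat.ofHom f))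

/-- Inverse image of ideal sheaves is adjoint to direct image, as extension of ideals is to
contraction, so `map_specIdeal` suffices. -/
theorem comap_specIdeal (f : A →+* B) (J : Ideal A) :
    (specIdeal J).comap (Spec.map (CommRingCat.ofHom f)) = specIdeal (J.map f) := by
  refine eq_of_forall_ge_iff fun K => ?_
  obtain ⟨K, rfl⟩ := specIdeal_surjective K
  rw [← Scheme.IdealSheafData.le_map_iff_comap_le, map_specIdeal, specIdeal_le_iff,
    specIdeal_le_iff, Ideal.map_le_iff_le_comap]

theorem mem_support_specIdeal {J : Ideal A} {x : Spec (.of A)} :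
    x ∈ (specIdeal J).support ↔ J ≤ x.asIdeal := by
  rw [Scheme.IdealSheafData.mem_support_iff_of_mem (U := ⟨⊤, isAffineOpen_top _⟩) trivial,
    specIdeal_ideal_top]
  rw [Scheme.mem_zeroLocus_iff]
  constructor
  · intro h a ha
    obtain ⟨b, rfl⟩ := ΓSpecIso_surjective a
    have := h b ha
    rw [basicOpen_eq_of_affine'] at this
    exact not_not.1 this
  · intro h b hb
    rw [basicOpen_eq_of_affine']
    exact not_not.2 (h hb)

theorem radical_specIdeal {J : Ideal A} (hJ : J.IsRadical) :
    (specIdeal J).radical = specIdeal J := by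
  apply Scheme.IdealSheafData.ext_of_isAffine
  rw [specIdeal_ideal_top]
  change Ideal.radical _ = _
  rw [specIdeal_ideal_top, ← Ideal.comap_radical, hJ.radical]

theorem radical_comap {X Y : Scheme.{u}} (f : X ⟶ Y) [IsOpenImmersion f] (I : Y.IdealSheafData)
    (hI : I.radical = I) : (I.comap f).radical = I.comap f := by
  ext U : 2
  change Ideal.radical _ = _
  rw [Scheme.IdealSheafData.ideal_comap_of_isOpenImmersion, ← Ideal.comap_radical]
  congr 1
  conv_rhs => rw [← hI]
  rfl

theorem radical_vanishingIdeal {X : Scheme.{u}} (Z : TopologicalSpace.Closeds X) :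
    (Scheme.IdealSheafData.vanishingIdeal Z).radical =
      Scheme.IdealSheafData.vanishingIdeal Z := by
  refine le_antisymm ?_ (Scheme.IdealSheafData.le_radical _)
  rw [← Scheme.IdealSheafData.le_support_iff_le_vanishingIdeal,
    Scheme.IdealSheafData.support_radical,
    Scheme.IdealSheafData.le_support_iff_le_vanishingIdeal]

theorem map_mem_nonZeroDivisors_of_equiv (e : A ≃+* B) {s : A} (hs : s ∈ nonZeroDivisors A) :
    e s ∈ nonZeroDivisors B := by
  rw [mem_nonZeroDivisors_iff_right] at hs ⊢
  intro x hx
  have := hs (e.symm x) (e.injective (by rw [map_mul, e.apply_symm_apply, hx, map_zero]))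
  rw [← e.apply_symm_apply x, this, map_zero]

/-- `IsInvertibleIdeal` speaks of affine open subsets, while the computations take place on open
immersions from Spec A; this translates between the two. -/
theorem exists_equiv_ideal {X : Scheme.{u}} (I : X.IdealSheafData) (a : Spec (.of A) ⟶ X)
    [IsOpenImmersion a] : ∃ (V : X.affineOpens) (_ : V.1 = a.opensRange) (e : Γ(X, V) ≃+* A),
      ∀ J, I.comap a = specIdeal J ↔ I.ideal V = J.comap (e : Γ(X, V) →+* A) := by
  let V : X.affineOpens := ⟨a ''ᵁ ⊤, (isAffineOpen_top _).image_of_isOpenImmersion a⟩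
  let e : Γ(X, V) ≃+* A :=
    ((a.appIso ⊤).trans (Scheme.ΓSpecIso (.of A))).commRingCatIsoToRingEquiv
  refine ⟨V, ?_, e, fun J => ?_⟩
  · exact a.image_top_eq_opensRange
  · have h1 : (I.comap a).ideal ⟨⊤, isAffineOpen_top _⟩ =
        (I.ideal V).comap (a.appIso ⊤).inv.hom :=
      Scheme.IdealSheafData.ideal_comap_of_isOpenImmersion _ _ _
    have h2 : (I.ideal V) =
        ((I.comap a).ideal ⟨⊤, isAffineOpen_top _⟩).comap (a.appIso ⊤).hom.hom := by
      rw [h1, Ideal.comap_comap, ← CommRingCat.hom_comp, Iso.hom_inv_id]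
      exact (Ideal.comap_id _).symm
    have h3 : J.comap (e : Γ(X, V) →+* A) = ((specIdeal J).ideal ⟨⊤, isAffineOpen_top _⟩).comap
        (a.appIso ⊤).hom.hom := by
      rw [specIdeal_ideal_top, Ideal.comap_comap]
      rfl
    rw [h2, h3]
    refine ⟨fun h => by rw [h], fun h => Scheme.IdealSheafData.ext_of_isAffine ?_⟩
    refine Ideal.comap_injective_of_surjective (a.appIso ⊤).hom.hom ?_ h
    exact (a.appIso ⊤).commRingCatIsoToRingEquiv.surjective

theorem isInvertibleIdeal_of_local {X : Scheme.{u}} {I : X.IdealSheafData}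
    (h : ∀ x : X, ∃ (A : Type u) (_ : CommRing A) (a : Spec (.of A) ⟶ X) (s : A),
      IsOpenImmersion a ∧ x ∈ Set.range a ∧ s ∈ nonZeroDivisors A ∧
      I.comap a = specIdeal (Ideal.span {s})) : IsInvertibleIdeal I := by
  intro x
  obtain ⟨A, _, a, s, ha, hx, hs, hI⟩ := h x
  obtain ⟨V, hV, e, he⟩ := exists_equiv_ideal I a
  refine ⟨V, ?_, e.symm s, map_mem_nonZeroDivisors_of_equiv _ hs, ?_⟩
  · rw [hV]; exact hx
  · rw [(he _).1 hI]
    exact (Ideal.map_symm e (I := Ideal.span {s})).symm.trans (by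
      rw [Ideal.map_span, Set.image_singleton])

theorem IsInvertibleIdeal.exists_local {X : Scheme.{u}} {I : X.IdealSheafData}
    (h : IsInvertibleIdeal I) (x : X) : ∃ (A : Type u) (_ : CommRing A) (a : Spec (.of A) ⟶ X)
      (s : A), IsOpenImmersion a ∧ x ∈ Set.range a ∧ s ∈ nonZeroDivisors A ∧
      I.comap a = specIdeal (Ideal.span {s}) := by
  obtain ⟨V, hxV, hs⟩ := h x
  have := V.2.isOpenImmersion_fromSpec
  obtain ⟨W, hW, e, he⟩ := exists_equiv_ideal I V.2.fromSpec
  obtain rfl : W = V := Subtype.ext (hW.trans V.2.opensRange_fromSpec)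
  obtain ⟨s, hs, hI⟩ := hs
  refine ⟨Γ(X, W), inferInstance, W.2.fromSpec, e s, inferInstance, ?_,
    map_mem_nonZeroDivisors_of_equiv _ hs, ?_⟩
  · rw [W.2.range_fromSpec]; exact hxV
  · rw [he, hI]
    have := Ideal.comap_symm e.symm (I := Ideal.span {e s})
    refine Eq.trans ?_ this.symm
    rw [Ideal.map_span, Set.image_singleton]
    simp

theorem mem_nonZeroDivisors_of_flat {f : A →+* B}
    (hf : f.Flat) {s : A} (hs : s ∈ nonZeroDivisors A) : f s ∈ nonZeroDivisors B := by
  let _ := f.toAlgebra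
  have hfl : Module.Flat A B := hf
  have h := Module.Flat.isSMulRegular_of_nonZeroDivisors (M := B) hs
  rw [mem_nonZeroDivisors_iff_right]
  intro b hb
  apply h
  change f s * b = f s * 0
  rw [mul_zero, mul_comm, hb]

theorem mem_nonZeroDivisors_of_isOpenImmersion {f : A →+* B}
    [hf : IsOpenImmersion (Spec.map (CommRingCat.ofHom f))] {s : A} (hs : s ∈ nonZeroDivisors A) :
    f s ∈ nonZeroDivisors B :=
  mem_nonZeroDivisors_of_flat ((Flat.SpecMap_iff (f := CommRingCat.ofHom f)).1 inferInstance) hs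

end SpecIdeal

end

/-! ### Universal vectors on charts; radicality of the norm ideal -/

section

open Quadratic

section Chart

variable {R M : Type u} [CommRing R] [AddCommGroup M] [Module R M]
  {A : Type u} [CommRing A] [Algebra R A]

theorem specMap_id : specMap (AlgHom.id R A) = 𝟙 _ := by
  ext1
  exact Spec.map_id _

theorem awayRing_hom_ext {φ : Module.Dual R M} [Module.Free R M] [Module.Finite R M]
    {χ χ' : AwayRing φ →ₐ[R] A} (h : ∀ ψ, χ (ratio φ ψ) = χ' (ratio φ ψ)) : χ = χ' := by
  obtain ⟨v, -, hv, -, -⟩ := exists_point_of_chart χ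
  ext x
  obtain ⟨n, a, ha, rfl⟩ := exists_fraction_eq φ x
  rw [algHom_fraction χ v hv, algHom_fraction χ' v fun ψ => (hv ψ).trans (h ψ)]

/-- The point [v] factors through the chart, which gives χ. The vector with coordinates χ(ψ/φ) is
proportional to v, and the factor is 1 because both have φ-coordinate 1. -/
theorem exists_hom_of_evalDual_eq_one {φ : Module.Dual R M} [Module.Free R M] [Module.Finite R M]
    (v : A ⊗[R] M) (hv : evalDual v φ = 1) :
    ∃ χ : AwayRing φ →ₐ[R] A, ∀ ψ, χ (ratio φ ψ) = evalDual v ψ := by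
  have hv' : Unimodular v := unimodular_of_isUnit (φ := φ) (hv ▸ isUnit_one)
  have hr : Set.range (point v hv').left ⊆ Set.range (chart φ).left := by
    rw [range_chart]
    rintro _ ⟨p, rfl⟩
    refine point_mem_nonvanishing.2 ?_
    rw [hv]
    exact (Ideal.ne_top_iff_one _).1 p.2.ne_top
  let t : specOver R A ⟶ specOver R (AwayRing φ) :=
    Over.homMk (IsOpenImmersion.lift (chart φ).left (point v hv').left hr) (by
      rw [← Over.w (chart φ), IsOpenImmersion.lift_fac_assoc, Over.w (point v hv')])
  have ht : t ≫ chart φ = point v hv' := by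
    ext1; exact IsOpenImmersion.lift_fac _ _ _
  obtain ⟨χ, hχ⟩ := exists_specMap_eq t
  refine ⟨χ, fun ψ => ?_⟩
  obtain ⟨w, hw', hw, h1, h2⟩ := exists_point_of_chart χ
  rw [← hχ, ht, point_eq_iff] at h2
  obtain ⟨m, rfl⟩ := h2
  rw [evalDual_smul, h1, mul_one] at hv
  rw [← hw, evalDual_smul, hv, one_mul]

/-- The universal vector on a chart. -/
theorem exists_univ_vec (φ : Module.Dual R M) [Module.Free R M] [Module.Finite R M] :
    ∃ (v : AwayRing φ ⊗[R] M) (hv : Unimodular v), (∀ ψ, evalDual v ψ = ratio φ ψ) ∧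
      evalDual v φ = 1 ∧ chart φ = point v hv := by
  obtain ⟨v, hv, h1, h2, h3⟩ := exists_point_of_chart (AlgHom.id R (AwayRing φ))
  refine ⟨v, hv, h1, h2, ?_⟩
  rw [← h3, specMap_id, Category.id_comp]

noncomputable def univVec (φ : Module.Dual R M) [Module.Free R M] [Module.Finite R M] :
    AwayRing φ ⊗[R] M := (exists_univ_vec φ).choose

variable (φ : Module.Dual R M) [Module.Free R M] [Module.Finite R M]

theorem evalDual_univVec (ψ : Module.Dual R M) : evalDual (univVec φ) ψ = ratio φ ψ :=
  (exists_univ_vec φ).choose_spec.choose_spec.1 ψ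

theorem unimodular_univVec : Unimodular (univVec φ) := (exists_univ_vec φ).choose_spec.choose

theorem chart_eq_point : chart φ = point (univVec φ) (unimodular_univVec φ) :=
  (exists_univ_vec φ).choose_spec.choose_spec.2.2

theorem exists_mapVec_univVec {φ : Module.Dual R M} (v : A ⊗[R] M) (hv : evalDual v φ = 1) :
    ∃ χ : AwayRing φ →ₐ[R] A, mapVec χ (univVec φ) = v := by
  obtain ⟨χ, hχ⟩ := exists_hom_of_evalDual_eq_one v hv
  refine ⟨χ, vec_ext fun ψ => ?_⟩
  rw [evalDual_mapVec, evalDual_univVec, hχ]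

end Chart

theorem isReduced_symmetricAlgebra (R M : Type u) [CommRing R] [_root_.IsReduced R]
    [AddCommGroup M] [Module R M] [Module.Free R M] : _root_.IsReduced (SymmetricAlgebra R M) :=
  isReduced_of_injective
    (SymmetricAlgebra.equivMvPolynomial (Module.Free.chooseBasis R M)).toRingEquiv.toRingHom
    (AlgEquiv.injective _)

/-- The universal algebra with a linear map sending a given element to `1` is reduced. -/
theorem exists_universal_normalized {L P : Type u} [CommRing L] [_root_.IsReduced L] [AddCommGroup P]
    [Module L P] [Module.Free L P] (p : P) : ∃ (D : Type u) (_ : CommRing D) (_ : Algebra L D),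
      _root_.IsReduced D ∧ ∃ x : P →ₗ[L] D, x p = 1 ∧
      ∀ (C : Type u) [CommRing C] [Algebra L C] (y : P →ₗ[L] C), y p = 1 →
        ∃ β : D →ₐ[L] C, ∀ z, β (x z) = y z := by
  let S := SymmetricAlgebra L P
  have : _root_.IsReduced S := isReduced_symmetricAlgebra L P
  -- The normalized map is z ↦ z/p. Only existence of β is required, so the full localization serves
  -- as well as its part of degree zero.
  let D := Localization.Away (SymmetricAlgebra.ι L P p : S)
  have hu : IsUnit (algebraMap S D (SymmetricAlgebra.ι L _ p)) :=
    IsLocalization.Away.algebraMap_isUnit _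
  obtain ⟨c, hc⟩ := hu.exists_right_inv
  refine ⟨D, inferInstance, inferInstance, inferInstanceAs (_root_.IsReduced (Localization _)), LinearMap.mulRight L c ∘ₗ
    (IsScalarTower.toAlgHom L S D).toLinearMap ∘ₗ SymmetricAlgebra.ι L P, hc, ?_⟩
  intro C _ _ y hy
  let β₀ : S →ₐ[L] C := SymmetricAlgebra.lift y
  have hβ₀ : ∀ z, β₀ (SymmetricAlgebra.ι L _ z) = y z :=
    fun z => SymmetricAlgebra.lift_ι_apply _ _
  let β : D →+* C :=
    IsLocalization.Away.lift (SymmetricAlgebra.ι L P p : S) (g := β₀.toRingHom)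
      (by rw [show β₀.toRingHom _ = 1 from (hβ₀ p).trans hy]; exact isUnit_one)
  have hβ : ∀ s, β (algebraMap S D s) = β₀ s := fun s => IsLocalization.Away.lift_eq _ _ s
  have hβc : β c = 1 := by
    have := congrArg β hc
    rwa [map_mul, hβ, hβ₀, hy, one_mul, map_one] at this
  refine ⟨⟨β, fun r => ?_⟩, fun z => ?_⟩
  · change β (algebraMap S D (algebraMap L S r)) = _
    rw [hβ, AlgHom.commutes]
  · change β (algebraMap S D (SymmetricAlgebra.ι L _ z) * c) = _
    rw [map_mul, hβc, mul_one, hβ, hβ₀]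

variable {F L N : Type u} [Field F] [CommRing L] [Algebra F L] [AddCommGroup N] [Module F N]
  [Module L N] [IsScalarTower F L N] [Module.Free L N] [Module.Finite L N]
  [Module.Free F N] [Module.Finite F N] (Q : Quadratic F L)

/-- The norm ideal of a universal normalized vector is radical: modulo the conjugate coordinates,
its base embeds into a localization of a polynomial ring over `L`. -/
theorem isRadical_normIdeal_of_universal [_root_.IsReduced L] {A : Type u} [CommRing A] [Algebra F A]
    {ψ : Module.Dual F N} {w : A ⊗[F] N} (hw : evalDual w ψ = 1)
    (lift : ∀ (B : Type u) [CommRing B] [Algebra F B] (v : B ⊗[F] N), evalDual v ψ = 1 →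
      ∃ χ : A →ₐ[F] B, mapVec χ w = v)
    (ext : ∀ (B : Type u) [CommRing B] [Algebra F B] (χ χ' : A →ₐ[F] B),
      mapVec χ w = mapVec χ' w → χ = χ') : (normIdeal Q w).IsRadical := by
  let φ₀ := dualOfDual Q ψ
  obtain ⟨D, _, _, _, x, hx₀, hx⟩ := exists_universal_normalized (L := L) φ₀
  let _ : Algebra F D := Algebra.compHom D (algebraMap F L)
  have : IsScalarTower F L D := .of_algebraMap_eq fun _ => rfl
  let l : Module.Dual F N →ₗ[F] D :=
    { toFun := fun χ => x (dualOfDual Q χ)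
      map_add' := fun χ χ' => by
        rw [← map_add]; congr 1; ext n; simp [dualOfDual_apply]; ring
      map_smul' := fun r χ => by
        rw [RingHom.id_apply, ← algebraMap_smul L r (x _), ← map_smul]
        congr 1; ext n; simp [dualOfDual_apply, Algebra.smul_def]; ring }
  obtain ⟨u, hu⟩ := exists_vec l
  obtain ⟨α, hα⟩ := lift D u (by rw [hu]; exact hx₀)
  have hα : ∀ χ, α (evalDual w χ) = x (dualOfDual Q χ) := fun χ => by
    rw [← evalDual_mapVec, hα, hu]; rfl
  -- On the locus J the conjugate coordinates vanish and the coordinates are free up to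
  -- normalization. The maps α and β compare A with this locus and show that the contraction of J to
  -- A is the kernel of a map to the reduced ring D.
  let J : Ideal (L ⊗[F] A) :=
    Ideal.span (Set.range fun φ : Module.Dual L N => Q.conjA (co w φ))
  have hmk : ∀ φ, Ideal.Quotient.mk J (scal (evalDual w (trDual Q φ))) =
      Ideal.Quotient.mk J (co w φ) := by
    intro φ
    rw [evalDual_trDual, scal_tr, map_add, add_eq_left, Ideal.Quotient.eq_zero_iff_mem]
    exact Ideal.subset_span ⟨φ, rfl⟩
  -- Modulo J a coordinate equals its trace, so the coordinate at φ₀, whose trace is 1, becomes 1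
  -- and the universal property of D applies.
  obtain ⟨β, hβ⟩ := hx _ ((Ideal.Quotient.mkₐ L J).toLinearMap ∘ₗ co w) (by
    change Ideal.Quotient.mk J _ = 1
    rw [← hmk, trDual_dualOfDual, hw, map_one, map_one])
  have key : ∀ a, β (α a) = Ideal.Quotient.mk J (scal a) := by
    have : (β.restrictScalars F).comp α = (Ideal.Quotient.mkₐ F J).comp scal := by
      refine ext _ _ _ (vec_ext fun χ => ?_)
      rw [evalDual_mapVec, evalDual_mapVec]
      change β (α _) = Ideal.Quotient.mk J (scal _)
      rw [hα, hβ]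
      change Ideal.Quotient.mk J _ = _
      rw [← hmk, trDual_dualOfDual]
    intro a
    exact DFunLike.congr_fun this a
  let αL : L ⊗[F] A →ₐ[L] D :=
    Algebra.TensorProduct.lift (Algebra.ofId L D) α fun _ _ => Commute.all _ _
  have hαL : ∀ a, αL (scal a) = α a := fun a => by simp [αL]
  have htr : ∀ φ, αL (scal (Q.tr (co w φ))) = x φ := fun φ => by
    rw [hαL, ← evalDual_trDual, hα, dualOfDual_trDual]
  -- The traces of co w φ against 1 and θ are sent to x φ and θ x φ. Comparing them leaves (2θ − p)
  -- times the image of the conjugate coordinate, and 2θ − p is invertible.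
  have hco : ∀ φ, αL (Q.conjA (co w φ)) = 0 := fun φ => by
    have h1 := htr φ
    have h2 := htr (Q.θ • φ)
    have h3 : Q.gen A = algebraMap L _ Q.θ := rfl
    have h4 := congrArg αL (Q.gen_different A)
    simp only [map_smul, Algebra.smul_def, scal_tr, map_add, map_mul, conjA_gen, ← h3, map_sub,
      map_one] at h1 h2 h4
    rw [← h1, h3, AlgHom.commutes] at h2
    rw [h3, AlgHom.commutes, map_ofNat] at h4
    linear_combination (-αL (Q.conjA (co w φ))) * h4 - αL (Q.d ⊗ₜ 1) * h2
  have hnm : ∀ φ, α (Q.nm (co w φ)) = 0 := fun φ => by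
    rw [← hαL, scal_nm, map_mul, hco, mul_zero]
  intro g hg
  obtain ⟨n, hn⟩ := hg
  -- α kills all norms, hence gⁿ, and D is reduced. Then β places g in J, and conjugation, which
  -- fixes g, places it in the conjugate of J as well.
  have h0 : α g = 0 := by
    have h1 : normIdeal Q w ≤ RingHom.ker α :=
      (normIdeal_le_iff _ _ _).2 fun φ => hnm φ
    have h2 : α (g ^ n) = 0 := h1 hn
    rw [map_pow] at h2
    exact eq_zero_of_pow_eq_zero h2
  have h1 : scal g ∈ J := by
    rw [← Ideal.Quotient.eq_zero_iff_mem, ← key, h0, map_zero]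
  have h2 : (scal g : L ⊗[F] A) ∈ Ideal.span (Set.range (co w)) := by
    have := Ideal.mem_map_of_mem Q.conjA h1
    rw [conjA_scal, Ideal.map_span, ← Set.range_comp] at this
    simpa only [Function.comp_def, conjA_conjA] using this
  have hle : J * Ideal.span (Set.range (co w)) ≤
      (normIdeal Q w).map (scal : A →ₐ[F] L ⊗[F] A) := by
    rw [Ideal.span_mul_span', Ideal.span_le]
    rintro _ ⟨_, ⟨φ, rfl⟩, _, ⟨χ, rfl⟩, rfl⟩
    exact conjA_co_mul_co_mem Q _ φ χ
  -- J and its conjugate are comaximal, so their intersection is their product, which lies in the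
  -- extended norm ideal.
  have h3 : co w φ₀ + Q.conjA (co w φ₀) = 1 := by
    rw [← scal_tr, ← evalDual_trDual, trDual_dualOfDual, hw, map_one]
  rw [← Q.scal_mem_map_iff, ← mul_one (scal g), ← h3, mul_add]
  refine Ideal.add_mem _ (hle (Ideal.mul_mem_mul h1 (Ideal.subset_span ⟨φ₀, rfl⟩))) ?_
  rw [mul_comm]
  exact hle (Ideal.mul_mem_mul (Ideal.subset_span ⟨φ₀, rfl⟩) h2)

theorem isRadical_normIdeal_univVec [_root_.IsReduced L] (ψ : Module.Dual F N) :
    (normIdeal Q (univVec ψ)).IsRadical := by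
  refine isRadical_normIdeal_of_universal Q (ψ := ψ) ?_ ?_ ?_
  · rw [evalDual_univVec, ratio_self]
  · intro B _ _ v hv
    exact exists_mapVec_univVec v hv
  · intro B _ _ χ χ' h
    refine awayRing_hom_ext fun φ => ?_
    rw [← evalDual_univVec, ← evalDual_mapVec, h, evalDual_mapVec]

end

/-! ### The degeneracy locus and its reduced ideal sheaf -/

section

open Quadratic

variable {F L N : Type u} [Field F] [CommRing L] [Algebra F L] [AddCommGroup N] [Module F N]
  [Module L N] [IsScalarTower F L N] (Q : Quadratic F L)

theorem normIdeal_smul_unit {A : Type u} [CommRing A] [Algebra F A] (m : Aˣ) (w : A ⊗[F] N) :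
    normIdeal Q ((m : A) • w) = normIdeal Q w := by
  rw [normIdeal_of_toExt_eq_smul Q (toExt_smul (m : A) w), Q.nm_scal,
    Ideal.span_singleton_eq_top.2 (m.isUnit.mul m.isUnit), Ideal.top_mul]

theorem exists_residueField {R A : Type u} [CommRing R] [CommRing A] [Algebra R A]
    (P : PrimeSpectrum A) : ∃ (K : Type u) (_ : Field K) (_ : Algebra R K) (χ : A →ₐ[R] K),
      ∀ a, χ a = 0 ↔ a ∈ P.asIdeal :=
  ⟨P.asIdeal.ResidueField, inferInstance, inferInstance,
    IsScalarTower.toAlgHom R A P.asIdeal.ResidueField,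
    fun _ => Ideal.algebraMap_residueField_eq_zero⟩

variable [Module.Free L N] [Module.Finite L N] [Module.Free F N] [Module.Finite F N]

/-- A degenerate line over a field K, rescaled so that its ψ-coordinate is 1, is a homomorphism from
the chart ring to K that kills the norm ideal. Conversely, a prime containing the norm ideal yields
such a line over its residue field. -/
theorem chart_mem_annLocus_iff (ψ : Module.Dual F N) (y : Spec (.of (AwayRing ψ))) :
    (chart ψ).left y ∈ annLocus F L N ↔ normIdeal Q (univVec ψ) ≤ y.asIdeal := by
  constructor
  · rintro ⟨K, _, _, v, hv, ha, ⟨p, hp⟩⟩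
    have hb := (exists_ann_iff Q v hv).1 ha
    have hne : evalDual v ψ ≠ 0 := by
      have : (point v hv).left p ∈ nonvanishing ψ := by
        have h1 : (chart ψ).left y ∈ Set.range (chart ψ).left := ⟨y, rfl⟩
        rw [range_chart] at h1
        rw [hp]; exact h1
      have h1 := (point_mem_nonvanishing (hv := hv)).1 this
      intro h0
      exact h1 (h0 ▸ p.asIdeal.zero_mem)
    obtain ⟨χ, hχ⟩ := exists_mapVec_univVec (φ := ψ) ((evalDual v ψ)⁻¹ • v)
      (by rw [evalDual_smul, inv_mul_cancel₀ hne])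
    have h1 : normIdeal Q (mapVec χ (univVec ψ)) = ⊥ := by
      rw [hχ, ← hb]
      exact normIdeal_smul_unit Q (Units.mk0 _ (inv_ne_zero hne)) v
    have h2 : point (mapVec χ (univVec ψ)) ((unimodular_univVec ψ).map χ) = point v hv :=
      point_eq_iff.2 ⟨Units.mk0 _ (inv_ne_zero hne), hχ⟩
    rw [← specMap_comp_point χ _ (unimodular_univVec ψ), ← chart_eq_point] at h2
    have h3 : (chart ψ).left ((specMap χ).left p) = (chart ψ).left y := by
      rw [← hp, ← h2]; rfl
    rw [← (chart ψ).left.isOpenEmbedding.injective h3]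
    rw [normIdeal_mapVec, Ideal.map_eq_bot_iff_le_ker] at h1
    intro a ha
    change χ.toRingHom a ∈ p.asIdeal
    rw [show χ.toRingHom a = 0 from h1 ha]
    exact p.asIdeal.zero_mem
  · intro h
    obtain ⟨K, _, _, χ, hχ⟩ := exists_residueField (R := F) (A := AwayRing ψ) y
    refine ⟨K, inferInstance, inferInstance, mapVec χ (univVec ψ), (unimodular_univVec ψ).map χ,
      (exists_ann_iff Q _ ((unimodular_univVec ψ).map χ)).2 ?_, ?_⟩
    · rw [normIdeal_mapVec, Ideal.map_eq_bot_iff_le_ker]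
      intro a ha
      exact (hχ a).2 (h ha)
    · rw [← specMap_comp_point χ _ (unimodular_univVec ψ), ← chart_eq_point]
      let z : Spec (.of K) := (⊥ : PrimeSpectrum K)
      refine ⟨z, ?_⟩
      have hz : (specMap χ).left z = y := by
        apply PrimeSpectrum.ext
        ext a
        exact hχ a
      exact congrArg (chart ψ).left hz

theorem exists_chart_eq {R M : Type u} [CommRing R] [AddCommGroup M] [Module R M]
    (x : (projSpace R M).left) : ∃ (ψ : Module.Dual R M) (y : Spec (.of (AwayRing ψ))),
      (chart ψ).left y = x := by
  have h : x ∈ ⨆ φ : Module.Dual R M, nonvanishing φ := by rw [iSup_nonvanishing]; trivial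
  rw [TopologicalSpace.Opens.mem_iSup] at h
  obtain ⟨ψ, hψ⟩ := h
  have : x ∈ Set.range (chart ψ).left := by rw [range_chart]; exact hψ
  exact ⟨ψ, this⟩

theorem isClosed_annLocus (Q : Quadratic F L) : IsClosed (annLocus F L N) := by
  rw [← isOpen_compl_iff, isOpen_iff_forall_mem_open]
  intro x hx
  obtain ⟨ψ, y, rfl⟩ := exists_chart_eq x
  refine ⟨(chart ψ).left '' (PrimeSpectrum.zeroLocus (normIdeal Q (univVec ψ)))ᶜ, ?_, ?_, ?_⟩
  · rintro _ ⟨z, hz, rfl⟩ h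
    exact hz ((chart_mem_annLocus_iff Q ψ z).1 h)
  · exact (chart ψ).left.isOpenEmbedding.isOpenMap _
      (PrimeSpectrum.isClosed_zeroLocus _).isOpen_compl
  · exact ⟨y, fun h => hx ((chart_mem_annLocus_iff Q ψ y).2 h), rfl⟩

theorem eq_of_radical_of_support {X : Scheme.{u}} {I J : X.IdealSheafData} (hI : I.radical = I)
    (hJ : J.radical = J) (h : ∀ x, x ∈ I.support ↔ x ∈ J.support) : I = J := by
  rw [← hI, ← hJ, ← Scheme.IdealSheafData.vanishingIdeal_support,
    ← Scheme.IdealSheafData.vanishingIdeal_support]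
  congr 1
  ext x
  exact h x

theorem mem_support_annIdeal (Q : Quadratic F L) (x : (projSpace F N).left) :
    x ∈ (annIdeal F L N).support ↔ x ∈ annLocus F L N := by
  change x ∈ closure (annLocus F L N) ↔ _
  rw [(isClosed_annLocus Q).closure_eq]

/-- Both ideal sheaves are radical and have the same support. Radicality of the norm ideal is where
reducedness of L enters. -/
theorem comap_chart_annIdeal [_root_.IsReduced L] (ψ : Module.Dual F N) :
    (annIdeal F L N).comap (chart ψ).left = specIdeal (normIdeal Q (univVec ψ)) := by
  refine eq_of_radical_of_support ?_ ?_ fun y => ?_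
  · exact radical_comap (chart ψ).left _ (radical_vanishingIdeal _)
  · exact radical_specIdeal (isRadical_normIdeal_univVec Q ψ)
  · have h1 := mem_support_specIdeal (J := normIdeal Q (univVec ψ)) (x := y)
    refine Iff.trans ?_ ((chart_mem_annLocus_iff Q ψ y).trans h1.symm)
    rw [← mem_support_annIdeal Q, Scheme.IdealSheafData.support_comap]
    exact Iff.rfl

theorem comap_point_annIdeal [_root_.IsReduced L] {A : Type u} [CommRing A] [Algebra F A]
    {w : A ⊗[F] N} (hw : Unimodular w) {ψ : Module.Dual F N} (h : evalDual w ψ = 1) :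
    (annIdeal F L N).comap (point w hw).left = specIdeal (normIdeal Q w) := by
  obtain ⟨χ, rfl⟩ := exists_mapVec_univVec w h
  rw [← specMap_comp_point χ _ (unimodular_univVec ψ), ← chart_eq_point, Over.comp_left,
    Scheme.IdealSheafData.comap_comp, comap_chart_annIdeal Q, normIdeal_mapVec]
  exact comap_specIdeal _ _

variable [_root_.IsReduced L]

theorem isInvertibleIdeal_comap_annIdeal {T : Over (Spec (.of F))} (h : T ⟶ projSpace F N)
    (H : ∀ x : T.left, ∃ (A : Type u) (_ : CommRing A) (_ : Algebra F A) (a : specOver F A ⟶ T)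
      (ψ : Module.Dual F N) (w : A ⊗[F] N) (hw : Unimodular w) (s : A), IsOpenImmersion a.left ∧
      x ∈ Set.range a.left ∧ evalDual w ψ = 1 ∧ a ≫ h = point w hw ∧ s ∈ nonZeroDivisors A ∧
      normIdeal Q w = Ideal.span {s}) : IsInvertibleIdeal ((annIdeal F L N).comap h.left) := by
  refine isInvertibleIdeal_of_local fun x => ?_
  obtain ⟨A, _, _, a, ψ, w, hw, s, ha, hx, h1, h2, hs, hI⟩ := H x
  refine ⟨A, _, a.left, s, ha, hx, hs, ?_⟩
  rw [← hI, ← comap_point_annIdeal Q hw h1, ← h2, Over.comp_left,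
    Scheme.IdealSheafData.comap_comp]
  rfl

/-- One neighbourhood makes the ideal principal and another gives a normalized vector for the line.
On a common refinement both hold, since nonzerodivisors survive open immersions by flatness. -/
theorem IsInvertibleIdeal.exists_local_point {T : Over (Spec (.of F))} {h : T ⟶ projSpace F N}
    (H : IsInvertibleIdeal ((annIdeal F L N).comap h.left)) {x : T.left} {U : T.left.Opens}
    (hx : x ∈ U) : ∃ (A : Type u) (_ : CommRing A) (_ : Algebra F A) (a : specOver F A ⟶ T)
      (ψ : Module.Dual F N) (w : A ⊗[F] N) (hw : Unimodular w) (s : A), IsOpenImmersion a.left ∧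
      x ∈ Set.range a.left ∧ Set.range a.left ⊆ U ∧ evalDual w ψ = 1 ∧ a ≫ h = point w hw ∧
      s ∈ nonZeroDivisors A ∧ normIdeal Q w = Ideal.span {s} := by
  obtain ⟨A, _, a, s, ha, ⟨p, rfl⟩, hs, hI⟩ := H.exists_local x
  obtain ⟨B, _, _, b, ψ, w, hw, hb, ⟨r, hr⟩, hU, h1, h2⟩ := LineSpan.exists_local_point h hx
  let _ : Algebra F A := (Spec.preimage (a ≫ T.hom)).hom.toAlgebra
  let a' : specOver F A ⟶ T := Over.homMk a (Spec.map_preimage _).symm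
  have ha' : IsOpenImmersion a'.left := ha
  obtain ⟨C, _, _, f, g, hf, ⟨t, ht⟩, he, hg⟩ := exists_common_refinement b a' r (by
    rw [hr]; exact ⟨p, rfl⟩)
  have hf' : IsOpenImmersion (specMap g).left := hg hb
  have hw' := hw.map f
  have h1' : evalDual (mapVec f w) ψ = 1 := by rw [evalDual_mapVec, h1, map_one]
  refine ⟨C, _, _, specMap f ≫ b, ψ, mapVec f w, hw', g s, ?_, ?_, ?_, h1', ?_, ?_, ?_⟩
  · rw [Over.comp_left]; exact IsOpenImmersion.comp _ _
  · refine ⟨t, ?_⟩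
    rw [← hr, ← ht]; rfl
  · refine subset_trans ?_ hU
    rintro _ ⟨z, rfl⟩
    exact ⟨(specMap f).left z, rfl⟩
  · rw [Category.assoc, h2, specMap_comp_point]
  · have : IsOpenImmersion (Spec.map (CommRingCat.ofHom g.toRingHom)) := hf'
    exact mem_nonZeroDivisors_of_isOpenImmersion (f := g.toRingHom) hs
  · apply specIdeal_injective
    rw [← comap_point_annIdeal Q hw' h1', ← specMap_comp_point f w hw, ← h2, ← Category.assoc, he,
      Category.assoc, Over.comp_left, Over.comp_left, Scheme.IdealSheafData.comap_comp,
      Scheme.IdealSheafData.comap_comp]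
    refine (congrArg (fun I => Scheme.IdealSheafData.comap I (specMap g).left) hI).trans ?_
    refine (comap_specIdeal g.toRingHom _).trans ?_
    rw [Ideal.map_span, Set.image_singleton]
    rfl

end

/-! ### The generic line; density of the complement of S(N) -/

section

open Quadratic

/-- The generic vector of a vector space. -/
theorem exists_generic_vec (F M : Type u) [Field F] [AddCommGroup M] [Module F M]
    [Module.Finite F M] : ∃ (K : Type u) (_ : Field K) (_ : Algebra F K) (v : K ⊗[F] M),
      Function.Injective (evalSym v) ∧
      ∃ (v' : SymmetricAlgebra F (Module.Dual F M) ⊗[F] M),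
        mapVec (evalSym v) v' = v ∧
        ∀ ψ, evalDual v' ψ = SymmetricAlgebra.ι F _ ψ := by
  let S := SymmetricAlgebra F (Module.Dual F M)
  let f : S →ₐ[F] FractionRing S := IsScalarTower.toAlgHom F S (FractionRing S)
  obtain ⟨v', hv'⟩ := exists_vec (SymmetricAlgebra.ι F (Module.Dual F M))
  have hf : evalSym (mapVec f v') = f := by
    apply SymmetricAlgebra.algHom_ext
    ext φ
    simp [evalSym_ι, hv']
  refine ⟨FractionRing S, inferInstance, inferInstance, mapVec f v', ?_, v', ?_, fun ψ => by rw [hv']⟩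
  · rw [hf]
    exact IsFractionRing.injective S (FractionRing S)
  · rw [hf]

/-- K is the fraction field of the polynomial ring of M and v its tautological vector. The chart
ring embeds by evaluation at c v with c the inverse of the ψ-coordinate of v: the fraction a/ψᵏ goes
to cᵏ a(v), which is nonzero for a ≠ 0. -/
theorem exists_generic_chart {F M : Type u} [Field F] [AddCommGroup M] [Module F M]
    [Module.Finite F M] {ψ : Module.Dual F M} (hψ : ψ ≠ 0) :
    ∃ (K : Type u) (_ : Field K) (_ : Algebra F K) (v : K ⊗[F] M)
      (v' : SymmetricAlgebra F (Module.Dual F M) ⊗[F] M) (χ : AwayRing ψ →ₐ[F] K) (c : K),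
      Function.Injective (evalSym v) ∧ mapVec (evalSym v) v' = v ∧
      (∀ φ, evalDual v' φ = SymmetricAlgebra.ι F _ φ) ∧ Function.Injective χ ∧ c ≠ 0 ∧
      mapVec χ (univVec ψ) = c • v := by
  obtain ⟨K, _, _, v, hinj, v', hv', hvι⟩ := exists_generic_vec F M
  have hv : ∀ φ, evalDual v φ = evalSym v (SymmetricAlgebra.ι F _ φ) := fun φ => (evalSym_ι v φ).symm
  obtain ⟨n, hn⟩ : ∃ n, ψ n ≠ 0 := by
    by_contra! h
    exact hψ (LinearMap.ext h)
  have hne : evalDual v ψ ≠ 0 := by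
    intro h0
    rw [hv, map_eq_zero_iff _ hinj] at h0
    have := congrArg (evalSym ((1 : F) ⊗ₜ[F] n)) h0
    rw [evalSym_ι, map_zero, evalDual_tmul, smul_eq_mul, mul_one] at this
    exact hn this
  obtain ⟨χ, hχ⟩ := exists_hom_of_evalDual_eq_one (φ := ψ) ((evalDual v ψ)⁻¹ • v)
      (by rw [evalDual_smul, inv_mul_cancel₀ hne])
  refine ⟨K, _, _, v, v', χ, (evalDual v ψ)⁻¹, hinj, hv', hvι, ?_, inv_ne_zero hne,
    vec_ext fun φ => by rw [evalDual_mapVec, evalDual_univVec, hχ]⟩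
  rw [injective_iff_map_eq_zero]
  intro a ha
  obtain ⟨k, a, hk, rfl⟩ := exists_fraction_eq ψ a
  rw [algHom_fraction χ _ (fun φ => (hχ φ).symm), evalSym_smul _ _ hk, mul_eq_zero,
    map_eq_zero_iff _ hinj] at ha
  have h0 : a = 0 := ha.resolve_left (pow_ne_zero _ (inv_ne_zero hne))
  apply HomogeneousLocalization.val_injective
  rw [val_fraction, h0, Localization.mk_zero, HomogeneousLocalization.val_zero]

theorem mapVec_evalSym_of_evalDual_eq_ι {F M : Type u} [Field F] [AddCommGroup M] [Module F M]
    [Module.Finite F M] {v' : SymmetricAlgebra F (Module.Dual F M) ⊗[F] M}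
    (h : ∀ φ, evalDual v' φ = SymmetricAlgebra.ι F _ φ) {A : Type u} [CommRing A] [Algebra F A]
    (w : A ⊗[F] M) : mapVec (evalSym w) v' = w := vec_ext fun φ => by
  rw [evalDual_mapVec, h, evalSym_ι]

theorem subsingleton_awayRing_zero {F M : Type u} [Field F] [AddCommGroup M] [Module F M] :
    Subsingleton (AwayRing (0 : Module.Dual F M)) := by
  refine subsingleton_of_zero_eq_one ?_
  exact ((ratio_self (0 : Module.Dual F M)).symm.trans (map_zero _)).symm

variable {F L N : Type u} [Field F] [CommRing L] [Algebra F L] [AddCommGroup N] [Module F N]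
  [Module L N] [IsScalarTower F L N] (Q : Quadratic F L)
  [Module.Free L N] [Module.Finite L N] [Module.Free F N] [Module.Finite F N]

/-- A nonempty open set contains the generic point of some chart, so it suffices that the generic
line is nondegenerate. Otherwise the norms of all coordinates vanish as polynomials, hence at every
vector of N; but a basis vector over L has a coordinate equal to 1. -/
theorem dense_compl_annLocus (Q : Quadratic F L) : Dense (annLocus F L N)ᶜ := by
  rw [dense_iff_inter_open]
  rintro W hW ⟨x, hx⟩
  obtain ⟨ψ, y, rfl⟩ := exists_chart_eq x
  have hψ : ψ ≠ 0 := by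
    rintro rfl
    have h1 : (1 : AwayRing (0 : Module.Dual F N)) = 0 :=
      subsingleton_awayRing_zero.elim _ _
    exact (Ideal.ne_top_iff_one _).1 (show PrimeSpectrum (AwayRing (0 : Module.Dual F N)) from y).2.ne_top
      (h1 ▸ Ideal.zero_mem _)
  obtain ⟨n, hn⟩ : ∃ n, ψ n ≠ 0 := by
    by_contra! h
    exact hψ (LinearMap.ext h)
  obtain ⟨K, _, _, v, v', χ, c, hinj, hv', hvι, hχinj, hc, hχv⟩ := exists_generic_chart hψ
  let z : Spec (.of (AwayRing ψ)) := PrimeSpectrum.comap χ.toRingHom (⊥ : PrimeSpectrum K)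
  have hz : ∀ a, a ∈ z.asIdeal ↔ a = 0 := fun a => by
    change χ a = 0 ↔ _
    rw [map_eq_zero_iff _ hχinj]
  refine ⟨(chart ψ).left z, ?_, ?_⟩
  · have hs : z ⤳ y := by
      refine (PrimeSpectrum.le_iff_specializes (R := AwayRing ψ) _ _).1 ?_
      intro a ha
      rw [(hz a).1 ha]
      exact Ideal.zero_mem _
    exact (hs.map (chart ψ).left.continuous).mem_open hW hx
  · intro hmem
    have h1 := (chart_mem_annLocus_iff Q ψ z).1 hmem
    have h2 : normIdeal Q (univVec ψ) = ⊥ := by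
      rw [eq_bot_iff]
      intro a ha
      exact (hz a).1 (h1 ha)
    have h3 : normIdeal Q v = ⊥ := by
      rw [← normIdeal_smul_unit Q (Units.mk0 c hc) v]
      change normIdeal Q (c • v) = ⊥
      rw [← hχv, normIdeal_mapVec, h2, Ideal.map_bot]
    have h4 : ∀ φ, Q.nm (co v' φ) = 0 := fun φ => by
      have := nm_mem_normIdeal Q v φ
      rw [h3, Ideal.mem_bot, ← hv', co_mapVec, nm_mapA, map_eq_zero_iff _ hinj] at this
      exact this
    have h5 : ∀ (m : N) φ, Q.nm (co ((1 : F) ⊗ₜ[F] m) φ) = 0 := fun m φ => by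
      rw [← mapVec_evalSym_of_evalDual_eq_ι hvι ((1 : F) ⊗ₜ[F] m), co_mapVec, nm_mapA, h4, map_zero]
    have hN : Nontrivial N := ⟨n, 0, fun h => hn (by rw [h, map_zero])⟩
    have hL : Nontrivial L := Module.nontrivial L N
    let b := Module.Free.chooseBasis L N
    obtain ⟨i⟩ : Nonempty (Module.Free.ChooseBasisIndex L N) := b.index_nonempty
    have := h5 (b i) (b.coord i)
    rw [co_tmul, b.coord_apply, b.repr_self, Finsupp.single_eq_same,
      ← Algebra.TensorProduct.one_def, nm_one] at this
    exact one_ne_zero this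

end

/-! ### Representability of Zariski sheaves covered by open charts -/

section

open Opposite

variable {S : Scheme.{u}} (W : (Over S)ᵒᵖ ⥤ Type u)

theorem map_homMk_homMk {T T' T'' : Over S} (a : T'' ⟶ T') (b : T' ⟶ T) (c : T'' ⟶ T)
    (h : a.left ≫ b.left = c.left) (x : W.obj (op T)) :
    W.map a.op (W.map b.op x) = W.map c.op x := by
  have : c = a ≫ b := by ext1; exact h.symm
  rw [this, op_comp, W.map_comp]
  rfl

theorem map_of_left_eq_id {T : Over S} (a : T ⟶ T) (h : a.left = 𝟙 _) (x : W.obj (op T)) :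
    W.map a.op x = x := by
  have : a = 𝟙 T := by ext1; exact h
  rw [this, op_id, W.map_id]
  rfl

/-- Equality of pairs is expressed by restriction along an identity morphism, so that no casts
between the sets of sections over equal structure morphisms occur. -/
theorem sigma_eq_iff {T : Scheme.{u}} {s s' : T ⟶ S} {x : W.obj (op (Over.mk s))}
    {x' : W.obj (op (Over.mk s'))} :
    (⟨s, x⟩ : Σ s : T ⟶ S, W.obj (op (Over.mk s))) = ⟨s', x'⟩ ↔
      ∃ h : s' = s, W.map (Over.homMk (𝟙 T) ((Category.id_comp _).trans h.symm) :
        Over.mk s' ⟶ Over.mk s).op x = x' := by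
  constructor
  · intro h
    obtain ⟨rfl, h⟩ := Sigma.mk.inj_iff.1 h
    obtain rfl := eq_of_heq h
    exact ⟨rfl, map_of_left_eq_id _ _ rfl _⟩
  · rintro ⟨rfl, h⟩
    rw [map_of_left_eq_id W _ rfl] at h
    rw [h]

/-- Restriction of a morphism to `S` together with a section. -/
def totalMap {T T' : Scheme.{u}} (a : T' ⟶ T) (x : Σ s : T ⟶ S, W.obj (op (Over.mk s))) :
    Σ s : T' ⟶ S, W.obj (op (Over.mk s)) :=
  ⟨a ≫ x.1, W.map (Over.homMk a : Over.mk (a ≫ x.1) ⟶ Over.mk x.1).op x.2⟩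

theorem totalMap_eq_iff {T T' : Scheme.{u}} (a : T' ⟶ T) {s : T ⟶ S} {s' : T' ⟶ S}
    (x : W.obj (op (Over.mk s))) (x' : W.obj (op (Over.mk s'))) :
    totalMap W a ⟨s, x⟩ = ⟨s', x'⟩ ↔
      ∃ h : a ≫ s = s', W.map (Over.homMk a h : Over.mk s' ⟶ Over.mk s).op x = x' := by
  refine (sigma_eq_iff W).trans ⟨fun ⟨h, h'⟩ => ⟨h.symm, ?_⟩, fun ⟨h, h'⟩ => ⟨h.symm, ?_⟩⟩
  · exact (map_homMk_homMk W _ _ _ (Category.id_comp _) _).symm.trans h'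
  · exact (map_homMk_homMk W _ _ _ (Category.id_comp _) _).trans h'

theorem totalMap_id {T : Scheme.{u}} (x : Σ s : T ⟶ S, W.obj (op (Over.mk s))) :
    totalMap W (𝟙 T) x = x := by
  obtain ⟨s, x⟩ := x
  exact (totalMap_eq_iff W _ _ _).2 ⟨Category.id_comp _, map_of_left_eq_id W _ rfl _⟩

theorem totalMap_comp {T T' T'' : Scheme.{u}} (a : T'' ⟶ T') (b : T' ⟶ T)
    (x : Σ s : T ⟶ S, W.obj (op (Over.mk s))) :
    totalMap W (a ≫ b) x = totalMap W a (totalMap W b x) := by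
  obtain ⟨s, x⟩ := x
  refine (totalMap_eq_iff W _ _ _).2 ⟨Category.assoc _ _ _, ?_⟩
  exact (map_homMk_homMk W _ _ _ rfl _).symm

/-- The functor on schemes that classifies a morphism to `S` with a section of a given functor on
`S`-schemes. -/
def totalFunctor : Scheme.{u}ᵒᵖ ⥤ Type u where
  obj T := Σ s : T.unop ⟶ S, W.obj (op (Over.mk s))
  map f := ↾ totalMap W f.unop
  map_id T := by
    refine ConcreteCategory.hom_ext _ _ fun x => ?_
    exact totalMap_id W x
  map_comp f g := by
    refine ConcreteCategory.hom_ext _ _ fun x => ?_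
    exact totalMap_comp W g.unop f.unop x

theorem totalMap_eq_totalMap_iff {T T₁ T₂ : Scheme.{u}} (a : T ⟶ T₁) (b : T ⟶ T₂) {s₁ : T₁ ⟶ S}
    {s₂ : T₂ ⟶ S} (x : W.obj (op (Over.mk s₁))) (y : W.obj (op (Over.mk s₂))) :
    totalMap W a ⟨s₁, x⟩ = totalMap W b ⟨s₂, y⟩ ↔
      ∃ h : a ≫ s₁ = b ≫ s₂, W.map (Over.homMk a h : Over.mk (b ≫ s₂) ⟶ Over.mk s₁).op x =
        W.map (Over.homMk b : Over.mk (b ≫ s₂) ⟶ Over.mk s₂).op y :=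
  totalMap_eq_iff W a x _

/-- The Zariski sheaf condition for a functor on `S`-schemes. -/
def IsZariskiSheaf : Prop :=
  ∀ (T : Over S) (𝒰 : Scheme.OpenCover.{u + 1} T.left)
    (x : ∀ j, W.obj (op (Over.mk (𝒰.f j ≫ T.hom)))),
    (∀ j k (Z : Over S) (a : Z ⟶ Over.mk (𝒰.f j ≫ T.hom)) (b : Z ⟶ Over.mk (𝒰.f k ≫ T.hom)),
      a.left ≫ 𝒰.f j = b.left ≫ 𝒰.f k → W.map a.op (x j) = W.map b.op (x k)) →
    ∃! y : W.obj (op T), ∀ j, W.map (Over.homMk (𝒰.f j) : Over.mk (𝒰.f j ≫ T.hom) ⟶ T).op y = x j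

/-- The morphisms to S glue first. The sections, rewritten over the restrictions of the glued
morphism, then glue by the sheaf condition over S. -/
theorem isSheaf_totalFunctor (hW : IsZariskiSheaf W) :
    Presieve.IsSheaf Scheme.zariskiTopology (totalFunctor W) := by
  rw [Precoverage.isSheaf_toGrothendieck_iff_of_isStableUnderBaseChange]
  rintro T R hR x hx
  obtain ⟨(𝒰 : Scheme.OpenCover T), rfl⟩ := Scheme.exists_cover_of_mem_pretopology hR
  have hx' : ∀ j k (Z : Scheme.{u}) (a : Z ⟶ 𝒰.X j) (b : Z ⟶ 𝒰.X k), a ≫ 𝒰.f j = b ≫ 𝒰.f k →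
      totalMap W a (x (𝒰.f j) (.mk j)) = totalMap W b (x (𝒰.f k) (.mk k)) :=
    fun j k Z a b h => hx a b (.mk j) (.mk k) h
  let s : T ⟶ S := 𝒰.glueMorphisms (fun j => (x (𝒰.f j) (.mk j)).1) (fun j k =>
    congrArg Sigma.fst (hx' j k _ _ _ pullback.condition))
  have hs : ∀ j, 𝒰.f j ≫ s = (x (𝒰.f j) (.mk j)).1 := fun j => 𝒰.ι_glueMorphisms _ _ j
  have aux : ∀ (Z : Scheme.{u}) (z : Σ s : Z ⟶ S, W.obj (op (Over.mk s))) (s' : Z ⟶ S),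
      s' = z.1 → ∃ y, z = ⟨s', y⟩ := by
    rintro Z ⟨s, y⟩ _ rfl
    exact ⟨y, rfl⟩
  choose y hy using fun j => aux _ (x (𝒰.f j) (.mk j)) (𝒰.f j ≫ s) (hs j)
  obtain ⟨z, hz, hz'⟩ := hW (Over.mk s) 𝒰 y (by
    intro j k Z a b hab
    have h1 := hx' j k _ a.left b.left hab
    rw [hy, hy, totalMap_eq_totalMap_iff] at h1
    obtain ⟨h, h1⟩ := h1
    have h2 : Z.hom = b.left ≫ 𝒰.f k ≫ s := (Over.w b).symm
    have h3 := congrArg (W.map (Over.homMk (𝟙 Z.left) ((Category.id_comp _).trans h2.symm) :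
      Z ⟶ Over.mk (b.left ≫ 𝒰.f k ≫ s)).op) h1
    exact ((map_homMk_homMk W _ _ a (Category.id_comp _) _).symm.trans h3).trans
      (map_homMk_homMk W _ _ b (Category.id_comp _) _))
  refine ⟨⟨s, z⟩, ?_, ?_⟩
  · rintro Z _ ⟨j⟩
    refine Eq.trans ?_ (hy j).symm
    exact (totalMap_eq_iff W (𝒰.f j) z (y j)).2 ⟨rfl, hz j⟩
  · rintro ⟨s', z'⟩ h
    have h1 : ∀ j, totalMap W (𝒰.f j) ⟨s', z'⟩ = ⟨𝒰.f j ≫ s, y j⟩ :=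
      fun j => (h (𝒰.f j) (.mk j)).trans (hy j)
    obtain rfl : s' = s := by
      refine 𝒰.hom_ext _ _ fun j => ?_
      exact congrArg Sigma.fst (h1 j)
    congr 1
    refine hz' _ fun j => ?_
    obtain ⟨_, h2⟩ := (totalMap_eq_iff W _ _ _).1 (h1 j)
    exact h2

/-- The universal element equips Z with a morphism to S and a section, and this section is universal
among S-schemes. -/
theorem isRepresentable_of_totalFunctor {Z : Scheme.{u}}
    (r : (totalFunctor W).RepresentableBy Z) : W.IsRepresentable := by
  obtain ⟨s, z, hz⟩ : ∃ (s : Z ⟶ S) (z : W.obj (op (Over.mk s))), r.homEquiv (𝟙 Z) = ⟨s, z⟩ :=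
    ⟨_, _, rfl⟩
  have hr : ∀ (T : Scheme.{u}) (a : T ⟶ Z), r.homEquiv a = totalMap W a ⟨s, z⟩ := by
    intro T a
    rw [← hz]
    exact r.homEquiv_eq a
  have hbij : ∀ T : Over S, Function.Bijective
      (fun a : T ⟶ Over.mk s => (W.map a.op z : W.obj (op T))) := by
    intro T
    constructor
    · intro a b hab
      ext1
      apply r.homEquiv.injective
      rw [hr, hr]
      refine ((totalMap_eq_iff W a.left z (s' := T.hom) (W.map a.op z)).2 ⟨Over.w a, rfl⟩).trans
        ((totalMap_eq_iff W b.left z (s' := T.hom) (W.map a.op z)).2 ⟨Over.w b, hab.symm⟩).symm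
    · intro y
      obtain ⟨a, ha⟩ := r.homEquiv.surjective
        (⟨T.hom, y⟩ : Σ s : T.left ⟶ S, W.obj (op (Over.mk s)))
      obtain ⟨h, h'⟩ := (totalMap_eq_iff W a z (s' := T.hom) y).1 ((hr _ a).symm.trans ha)
      exact ⟨Over.homMk a h, h'⟩
  refine ⟨Over.mk s, ⟨⟨fun {T} => Equiv.ofBijective _ (hbij T), ?_⟩⟩⟩
  intro T T' f g
  change W.map (f ≫ g).op z = W.map f.op (W.map g.op z)
  rw [op_comp, W.map_comp]
  rfl

/-- A Zariski sheaf that is covered by representable open subfunctors is representable. -/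
theorem isRepresentable_of_charts (hW : IsZariskiSheaf W) {ι : Type u} (X : ι → Over S)
    (α : ∀ i, W.obj (op (X i)))
    (inj : ∀ i T (a b : T ⟶ X i), W.map a.op (α i) = W.map b.op (α i) → a = b)
    (isOpen : ∀ i T (y : W.obj (op T)), ∃ U : T.left.Opens, ∀ T' (a : T' ⟶ T),
      (∃ b : T' ⟶ X i, W.map b.op (α i) = W.map a.op y) ↔ Set.range a.left ⊆ U)
    (cover : ∀ T (y : W.obj (op T)) (t : T.left), ∃ (i : ι) (T' : Over S) (a : T' ⟶ T),
      IsOpenImmersion a.left ∧ t ∈ Set.range a.left ∧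
      ∃ b : T' ⟶ X i, W.map b.op (α i) = W.map a.op y) : W.IsRepresentable := by
  let G : Sheaf Scheme.zariskiTopology.{u} (Type u) :=
    ⟨totalFunctor W, (isSheaf_iff_isSheaf_of_type _ _).2 (isSheaf_totalFunctor W hW)⟩
  let α' : ∀ i, (totalFunctor W).obj (op (X i).left) := fun i => ⟨(X i).hom, α i⟩
  let f : ∀ i, yoneda.obj (X i).left ⟶ G.1 := fun i => yonedaEquiv.symm (α' i)
  have hfapp : ∀ i (Z : Scheme.{u}) (b : Z ⟶ (X i).left),
      (f i).app (op Z) b = totalMap W b (α' i) := fun i Z b => rfl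
  -- The fibre product of a chart with T over the functor is the open subset of T on which the given
  -- section comes from the chart.
  have hf : ∀ i, IsOpenImmersion.presheaf (f i) := by
    intro i
    refine MorphismProperty.relative.of_exists fun T g => ?_
    obtain ⟨s, y, hy⟩ : ∃ (s : T ⟶ S) (y : W.obj (op (Over.mk s))), yonedaEquiv g = ⟨s, y⟩ :=
      ⟨_, _, rfl⟩
    have hg : ∀ (Z : Scheme.{u}) (a : Z ⟶ T), g.app (op Z) a = totalMap W a ⟨s, y⟩ := by
      intro Z a
      rw [← hy]
      exact (map_yonedaEquiv g a).symm
    obtain ⟨U, hU⟩ := isOpen i (Over.mk s) y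
    obtain ⟨b, hb⟩ := (hU (Over.mk (U.ι ≫ s)) (Over.homMk U.ι)).2
      (by simp)
    refine ⟨U, yoneda.map b.left, U.ι, ?_, inferInstance⟩
    refine IsPullback.of_forall_isPullback_app fun Z => ?_
    obtain ⟨Z⟩ := Z
    rw [Types.isPullback_iff]
    refine ⟨?_, ?_, ?_⟩
    · refine ConcreteCategory.hom_ext _ _ fun a => ?_
      refine (hfapp i Z _).trans (Eq.trans ?_ (hg Z _).symm)
      change totalMap W (a ≫ b.left) ⟨(X i).hom, α i⟩ = totalMap W (a ≫ U.ι) ⟨s, y⟩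
      rw [totalMap_comp, totalMap_comp]
      congr 1
      refine (totalMap_eq_totalMap_iff W _ _ _ _).2 ⟨Over.w b, ?_⟩
      exact hb
    · rintro a a' ⟨-, h⟩
      exact (cancel_mono U.ι).1 h
    · intro x₂ x₃ h
      have h' : totalMap W x₂ ⟨(X i).hom, α i⟩ = totalMap W x₃ ⟨s, y⟩ :=
        ((hfapp i Z x₂).symm.trans h).trans (hg Z x₃)
      obtain ⟨h1, h2⟩ := (totalMap_eq_totalMap_iff W _ _ _ _).1 h'
      have h3 := (hU (Over.mk (x₃ ≫ s)) (Over.homMk x₃)).1 ⟨Over.homMk x₂ h1, h2⟩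
      have h4 : IsOpenImmersion.lift U.ι x₃ (by simpa using h3) ≫ U.ι = x₃ :=
        IsOpenImmersion.lift_fac _ _ _
      refine ⟨IsOpenImmersion.lift U.ι x₃ (by simpa using h3), ?_, h4⟩
      have h5 := inj i (Over.mk (x₃ ≫ s)) (Over.homMk (IsOpenImmersion.lift U.ι x₃
        (by simpa using h3)) (by
          change _ ≫ U.ι ≫ s = x₃ ≫ s
          rw [reassoc_of% h4]) ≫ b) (Over.homMk x₂ h1) (by
        refine Eq.trans ?_ h2.symm
        rw [op_comp, W.map_comp]
        refine (congrArg (W.map _) hb).trans ?_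
        exact map_homMk_homMk W _ _ _ h4 y)
      exact congrArg (fun z => z.left) h5
  have : Presheaf.IsLocallySurjective Scheme.zariskiTopology (Sigma.desc f) := by
    constructor
    rintro T ⟨s, y⟩
    choose i T' a ha hat b hb using cover (Over.mk s) y
    let 𝒰 : Scheme.OpenCover.{u} T := Scheme.Cover.mkOfCovers (P := @IsOpenImmersion) T
      (fun t => (T' t).left) (fun t => (a t).left) (fun t => ⟨t, hat t⟩) ha
    refine GrothendieckTopology.superset_covering _ ?_ 𝒰.mem_grothendieckTopology
    rintro Z _ ⟨_, c, _, ⟨t⟩, rfl⟩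
    refine ⟨(Sigma.ι (fun i => yoneda.obj (X i).left) (i t)).app (op Z) (c ≫ (b t).left), ?_⟩
    have h1 : Sigma.ι (fun i => yoneda.obj (X i).left) (i t) ≫ Sigma.desc f = f (i t) :=
      Sigma.ι_desc _ _
    refine (congrArg (fun z : _ ⟶ G.1 => (ConcreteCategory.hom (NatTrans.app z (op Z))) (c ≫ (b t).left)) h1).trans ?_
    refine (hfapp _ _ _).trans ?_
    change totalMap W (c ≫ (b t).left) ⟨(X (i t)).hom, α (i t)⟩ =
      totalMap W (c ≫ (a t).left) ⟨s, y⟩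
    have e1 := (totalMap_eq_iff W (b t).left (α (i t)) (s' := (T' t).hom) _).2
      ⟨Over.w (b t), hb t⟩
    have e2 := (totalMap_eq_iff W (a t).left y (s' := (T' t).hom) _).2
      ⟨Over.w (a t), rfl⟩
    exact (totalMap_comp W c (b t).left _).trans ((congrArg (totalMap W c)
      (e1.trans e2.symm)).trans (totalMap_comp W c (a t).left _).symm)
  exact isRepresentable_of_totalFunctor W (Scheme.LocalRepresentability.representableBy hf)

end

/-! ### Weil restrictions are Zariski sheaves -/

section

open Opposite

variable {S S' : Scheme.{u}} (i : S' ⟶ S)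

theorem overPullback_map_fst {T T' : Over S} (a : T' ⟶ T) :
    ((Over.pullback i).map a).left ≫ pullback.fst T.hom i = pullback.fst T'.hom i ≫ a.left :=
  pullback.lift_fst _ _ _

theorem overPullback_map_snd {T T' : Over S} (a : T' ⟶ T) :
    ((Over.pullback i).map a).left ≫ pullback.snd T.hom i = pullback.snd T'.hom i :=
  pullback.lift_snd _ _ _

theorem isPullback_overPullback_map {T T' : Over S} (a : T' ⟶ T) :
    IsPullback ((Over.pullback i).map a).left (pullback.fst T'.hom i) (pullback.fst T.hom i)
      a.left := by
  refine (IsPullback.of_right (h₁₂ := pullback.snd T.hom i) (h₂₂ := T.hom) (v₁₃ := i) ?_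
    (overPullback_map_fst i a) (IsPullback.of_hasPullback T.hom i).flip)
  have h1 := overPullback_map_snd i a
  have h2 := Over.w a
  rw [h1, h2]
  exact (IsPullback.of_hasPullback T'.hom i).flip

instance isOpenImmersion_overPullback_map {T T' : Over S} (a : T' ⟶ T) [IsOpenImmersion a.left] :
    IsOpenImmersion ((Over.pullback i).map a).left :=
  MorphismProperty.of_isPullback (P := @IsOpenImmersion) (isPullback_overPullback_map i a).flip
    inferInstance

theorem mem_range_overPullback_map {T T' : Over S} (a : T' ⟶ T)
    (x : ((Over.pullback i).obj T).left) :
    x ∈ Set.range ((Over.pullback i).map a).left ↔ pullback.fst T.hom i x ∈ Set.range a.left := by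
  constructor
  · rintro ⟨y, rfl⟩
    refine ⟨pullback.fst T'.hom i y, ?_⟩
    have := congrArg (fun f => f y) (overPullback_map_fst i a)
    simpa using this.symm
  · rintro ⟨t, ht⟩
    obtain ⟨y, hy, -⟩ := Scheme.exists_preimage_of_isPullback
      (isPullback_overPullback_map i a) x t ht.symm
    exact ⟨y, hy⟩

/-- The Weil restriction of a scheme along `S' ⟶ S` is a Zariski sheaf. -/
theorem isZariskiSheaf_overPullback_yoneda (X : Over S') :
    IsZariskiSheaf ((Over.pullback i).op ⋙ yoneda.obj X) := by
  intro T 𝒰 (u : ∀ j, (Over.pullback i).obj (Over.mk (𝒰.f j ≫ T.hom)) ⟶ X) hu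
  replace hu : ∀ j k (Z : Over S) (a : Z ⟶ Over.mk (𝒰.f j ≫ T.hom))
      (b : Z ⟶ Over.mk (𝒰.f k ≫ T.hom)), a.left ≫ 𝒰.f j = b.left ≫ 𝒰.f k →
      (Over.pullback i).map a ≫ u j = (Over.pullback i).map b ≫ u k := hu
  let c : ∀ j, Over.mk (𝒰.f j ≫ T.hom) ⟶ T := fun j => Over.homMk (𝒰.f j)
  have hc : ∀ j, IsOpenImmersion (c j).left := fun j => 𝒰.map_prop j
  let 𝒱 : Scheme.OpenCover.{u + 1} ((Over.pullback i).obj T).left :=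
    Scheme.Cover.mkOfCovers (P := @IsOpenImmersion) 𝒰.I₀
      (fun j => ((Over.pullback i).obj (Over.mk (𝒰.f j ≫ T.hom))).left)
      (fun j => ((Over.pullback i).map (c j)).left)
      (fun x => by
        obtain ⟨y, hy⟩ := 𝒰.covers (pullback.fst T.hom i x)
        exact ⟨_, (mem_range_overPullback_map i (c _) x).2 ⟨y, hy⟩⟩)
      (fun j => inferInstance)
  have hglue : ∀ j k, pullback.fst (𝒱.f j) (𝒱.f k) ≫ (u j).left =
      pullback.snd (𝒱.f j) (𝒱.f k) ≫ (u k).left := by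
    intro j k
    let p : pullback (𝒱.f j) (𝒱.f k) ⟶ ((Over.pullback i).obj (Over.mk (𝒰.f j ≫ T.hom))).left :=
      pullback.fst (𝒱.f j) (𝒱.f k)
    let q : pullback (𝒱.f j) (𝒱.f k) ⟶ ((Over.pullback i).obj (Over.mk (𝒰.f k ≫ T.hom))).left :=
      pullback.snd (𝒱.f j) (𝒱.f k)
    have hpq : p ≫ ((Over.pullback i).map (c j)).left = q ≫ ((Over.pullback i).map (c k)).left :=
      pullback.condition
    let p' := p ≫ pullback.fst (Over.mk (𝒰.f j ≫ T.hom)).hom i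
    let q' := q ≫ pullback.fst (Over.mk (𝒰.f k ≫ T.hom)).hom i
    have hpq' : p' ≫ 𝒰.f j = q' ≫ 𝒰.f k := by
      have h1 := overPullback_map_fst i (c j)
      have h2 := overPullback_map_fst i (c k)
      have h3 := congrArg (· ≫ pullback.fst T.hom i) hpq
      simp only [Category.assoc, h1, h2] at h3
      simpa [p', q', c] using h3
    have hsnd : p ≫ pullback.snd (Over.mk (𝒰.f j ≫ T.hom)).hom i =
        q ≫ pullback.snd (Over.mk (𝒰.f k ≫ T.hom)).hom i := by
      have h1 := overPullback_map_snd i (c j)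
      have h2 := overPullback_map_snd i (c k)
      have h3 := congrArg (· ≫ pullback.snd T.hom i) hpq
      simpa only [Category.assoc, h1, h2] using h3
    let Z : Over S := Over.mk (p' ≫ 𝒰.f j ≫ T.hom)
    let a : Z ⟶ Over.mk (𝒰.f j ≫ T.hom) := Over.homMk p'
    let b : Z ⟶ Over.mk (𝒰.f k ≫ T.hom) := Over.homMk q' (by
      change q' ≫ 𝒰.f k ≫ T.hom = p' ≫ 𝒰.f j ≫ T.hom
      rw [← Category.assoc, ← hpq', Category.assoc])
    have h := congrArg (fun f => f.left) (hu j k Z a b hpq')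
    simp only [Over.comp_left] at h
    -- The hypothesis concerns base changes of S-schemes. So the overlap is regarded as an S-scheme
    -- Z and mapped to its base change by the identity and the projection to S'.
    let s : pullback (𝒱.f j) (𝒱.f k) ⟶ ((Over.pullback i).obj Z).left :=
      pullback.lift (𝟙 _) (p ≫ pullback.snd (Over.mk (𝒰.f j ≫ T.hom)).hom i) (by
        have := pullback.condition (f := (Over.mk (𝒰.f j ≫ T.hom)).hom) (g := i)
        rw [Category.assoc, ← this, Category.id_comp]
        exact (Category.assoc _ _ _))
    have hsa : s ≫ ((Over.pullback i).map a).left = p := by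
      apply pullback.hom_ext
      · rw [Category.assoc, overPullback_map_fst]
        exact (pullback.lift_fst_assoc _ _ _ _).trans (Category.id_comp _)
      · rw [Category.assoc, overPullback_map_snd]
        exact pullback.lift_snd _ _ _
    have hsb : s ≫ ((Over.pullback i).map b).left = q := by
      apply pullback.hom_ext
      · rw [Category.assoc, overPullback_map_fst]
        exact (pullback.lift_fst_assoc _ _ _ _).trans (Category.id_comp _)
      · rw [Category.assoc, overPullback_map_snd]
        exact (pullback.lift_snd _ _ _).trans hsnd
    have h' := congrArg (s ≫ ·) h
    exact ((congrArg (· ≫ (u j).left) hsa).symm.trans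
      ((Category.assoc _ _ _).trans (h'.trans (Category.assoc _ _ _).symm))).trans
      (congrArg (· ≫ (u k).left) hsb)
  let v : ((Over.pullback i).obj T).left ⟶ X.left := 𝒱.glueMorphisms (fun j => (u j).left) hglue
  have hv : ∀ j, ((Over.pullback i).map (c j)).left ≫ v = (u j).left :=
    fun j => 𝒱.ι_glueMorphisms _ hglue j
  let y : (Over.pullback i).obj T ⟶ X := Over.homMk v (by
    refine 𝒱.hom_ext _ _ fun (j : 𝒰.I₀) => ?_
    have h1 := Over.w (u j)
    have h2 := Over.w ((Over.pullback i).map (c j))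
    have h3 := congrArg (· ≫ X.hom) (hv j)
    exact ((Category.assoc _ _ _).symm.trans h3).trans (h1.trans h2.symm))
  refine ⟨y, fun j => ?_, fun y' hy' => ?_⟩
  · exact Over.OverMorphism.ext (hv j)
  · refine Over.OverMorphism.ext (𝒱.hom_ext _ _ fun (j : 𝒰.I₀) => ?_)
    have h1 : (Over.pullback i).map (c j) ≫ y' = u j := hy' j
    exact (congrArg (fun f => f.left) h1).trans (hv j).symm

end

/-! ### Sections of the Weil restriction given by vectors -/

section

open Opposite Quadratic

variable {F L N : Type u} [Field F] [CommRing L] [Algebra F L] [AddCommGroup N] [Module F N]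
  [Module L N] [IsScalarTower F L N]
variable {A B : Type u} [CommRing A] [Algebra F A] [CommRing B] [Algebra F B]

variable (F L) in
/-- The base change functor from `F`-schemes to `L`-schemes. -/
noncomputable abbrev extFunctor : Over (Spec (.of F)) ⥤ Over (Spec (.of L)) :=
  Over.pullback (Spec.map (CommRingCat.ofHom (algebraMap F L)))

theorem pullbackSpecOverIso_hom_fst : (pullbackSpecOverIso F L A).hom ≫
    Spec.map (CommRingCat.ofHom (scal : A →ₐ[F] L ⊗[F] A).toRingHom) =
      pullback.fst (specOver F A).hom (Spec.map (CommRingCat.ofHom (algebraMap F L))) :=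
  (Category.assoc _ _ _).trans ((congrArg ((pullbackSymmetry _ _).hom ≫ ·)
    (pullbackSpecIso_hom_snd F L A)).trans (pullbackSymmetry_hom_comp_snd _ _))

theorem pullbackSpecOverIso_hom_snd : (pullbackSpecOverIso F L A).hom ≫
    Spec.map (CommRingCat.ofHom (algebraMap L (L ⊗[F] A))) =
      pullback.snd (specOver F A).hom (Spec.map (CommRingCat.ofHom (algebraMap F L))) :=
  (Category.assoc _ _ _).trans ((congrArg ((pullbackSymmetry _ _).hom ≫ ·)
    (pullbackSpecIso_hom_fst' F L A)).trans (pullbackSymmetry_hom_comp_fst _ _))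

variable (F L A) in
/-- The base change of an affine `F`-scheme to `L`. -/
noncomputable def extIso : (extFunctor F L).obj (specOver F A) ≅ specOver L (L ⊗[F] A) :=
  Over.isoMk (pullbackSpecOverIso F L A) pullbackSpecOverIso_hom_snd

theorem extIso_naturality (f : A →ₐ[F] B) :
    (extFunctor F L).map (specMap f) ≫ (extIso F L A).hom =
      (extIso F L B).hom ≫ specMap (mapA f) := by
  rw [← Iso.inv_comp_eq, ← Category.assoc, ← Iso.eq_comp_inv]
  apply Over.OverMorphism.ext
  apply pullback.hom_ext
  · have h1 : (pullbackSpecOverIso F L B).inv ≫ pullback.fst (specOver F B).hom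
        (Spec.map (CommRingCat.ofHom (algebraMap F L))) =
        Spec.map (CommRingCat.ofHom (scal : B →ₐ[F] L ⊗[F] B).toRingHom) :=
      (Iso.inv_comp_eq _).2 pullbackSpecOverIso_hom_fst.symm
    have h2 : (pullbackSpecOverIso F L A).inv ≫ pullback.fst (specOver F A).hom
        (Spec.map (CommRingCat.ofHom (algebraMap F L))) =
        Spec.map (CommRingCat.ofHom (scal : A →ₐ[F] L ⊗[F] A).toRingHom) :=
      (Iso.inv_comp_eq _).2 pullbackSpecOverIso_hom_fst.symm
    change ((pullbackSpecOverIso F L B).inv ≫ ((extFunctor F L).map (specMap f)).left) ≫ _ =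
      (Spec.map (CommRingCat.ofHom (mapA f).toRingHom) ≫ (pullbackSpecOverIso F L A).inv) ≫ _
    rw [Category.assoc, Category.assoc]
    refine (congrArg _ (overPullback_map_fst _ (specMap f))).trans ?_
    refine ((Category.assoc _ _ _).symm.trans (congrArg (· ≫ (specMap f).left) h1)).trans ?_
    refine Eq.trans ?_ (congrArg (Spec.map (CommRingCat.ofHom (mapA f).toRingHom) ≫ ·) h2).symm
    refine (Spec.map_comp _ _).symm.trans ((congrArg Spec.map ?_).trans (Spec.map_comp _ _))
    ext a
    exact (mapA_scal f a).symm
  · have h1 : (pullbackSpecOverIso F L B).inv ≫ pullback.snd (specOver F B).hom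
        (Spec.map (CommRingCat.ofHom (algebraMap F L))) =
        Spec.map (CommRingCat.ofHom (algebraMap L (L ⊗[F] B))) :=
      (Iso.inv_comp_eq _).2 pullbackSpecOverIso_hom_snd.symm
    have h2 : (pullbackSpecOverIso F L A).inv ≫ pullback.snd (specOver F A).hom
        (Spec.map (CommRingCat.ofHom (algebraMap F L))) =
        Spec.map (CommRingCat.ofHom (algebraMap L (L ⊗[F] A))) :=
      (Iso.inv_comp_eq _).2 pullbackSpecOverIso_hom_snd.symm
    change ((pullbackSpecOverIso F L B).inv ≫ ((extFunctor F L).map (specMap f)).left) ≫ _ =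
      (Spec.map (CommRingCat.ofHom (mapA f).toRingHom) ≫ (pullbackSpecOverIso F L A).inv) ≫ _
    rw [Category.assoc, Category.assoc]
    refine (congrArg _ (overPullback_map_snd _ (specMap f))).trans ?_
    refine h1.trans ?_
    refine Eq.trans ?_ (congrArg (Spec.map (CommRingCat.ofHom (mapA f).toRingHom) ≫ ·) h2).symm
    exact (Over.w (specMap (mapA f))).symm

/-- The section of the Weil restriction of `ℙ_L(N)` given by a vector. -/
noncomputable def wpt (v : A ⊗[F] N) (hv : Unimodular (toExt L v)) :
    (extFunctor F L).obj (specOver F A) ⟶ projSpace L N :=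
  (extIso F L A).hom ≫ point (toExt L v) hv

theorem Unimodular.toExt_map {v : A ⊗[F] N} (hv : Unimodular (toExt L v)) (f : A →ₐ[F] B) :
    Unimodular (toExt L (mapVec f v)) := by
  rw [toExt_mapVec]
  exact hv.map _

theorem extFunctor_map_wpt (f : A →ₐ[F] B) (v : A ⊗[F] N) (hv : Unimodular (toExt L v)) :
    (extFunctor F L).map (specMap f) ≫ wpt v hv = wpt (mapVec f v) (hv.toExt_map f) := by
  rw [wpt, ← Category.assoc, extIso_naturality, Category.assoc, specMap_comp_point, wpt]
  congr 1
  exact point_congr (toExt_mapVec f v).symm _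

theorem unimodular_toExt_of_co_eq_one {v : A ⊗[F] N} {φ : Module.Dual L N} (h : co v φ = 1) :
    Unimodular (toExt L v) :=
  unimodular_of_isUnit (φ := φ) (by rw [← co, h]; exact isUnit_one)

/-- Sections of the Weil restriction are determined locally. -/
theorem weil_ext {X : Over (Spec (.of L))} {T : Over (Spec (.of F))}
    {y y' : (extFunctor F L).obj T ⟶ X}
    (h : ∀ t : T.left, ∃ (A : Type u) (_ : CommRing A) (_ : Algebra F A) (a : specOver F A ⟶ T),
      IsOpenImmersion a.left ∧ t ∈ Set.range a.left ∧
        (extFunctor F L).map a ≫ y = (extFunctor F L).map a ≫ y') : y = y' := by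
  ext1
  refine Scheme.hom_ext_of_local fun z => ?_
  obtain ⟨A, _, _, a, ha, ht, he⟩ := h (pullback.fst T.hom _ z)
  exact ⟨_, ((extFunctor F L).map a).left, inferInstance,
    (mem_range_overPullback_map _ a z).2 ht, congrArg (fun f => f.left) he⟩

variable [Module.Free L N] [Module.Finite L N]

theorem wpt_eq_iff (v w : A ⊗[F] N) (hv : Unimodular (toExt L v)) (hw : Unimodular (toExt L w)) :
    wpt v hv = wpt w hw ↔ ∃ m : (L ⊗[F] A)ˣ, toExt L v = (m : L ⊗[F] A) • toExt L w := by
  rw [wpt, wpt, cancel_epi, point_eq_iff]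

/-- The normalization at φ removes the ambiguity by a unit. So the sections in the chart of φ
correspond to vectors v with co v φ = 1, an affine condition. -/
theorem eq_of_wpt_eq [Module.Finite F L] (Q : Quadratic F L) {v w : A ⊗[F] N}
    {hv : Unimodular (toExt L v)} {hw : Unimodular (toExt L w)} {φ : Module.Dual L N}
    (hvφ : co v φ = 1) (hwφ : co w φ = 1) (h : wpt v hv = wpt w hw) : v = w := by
  obtain ⟨m, hm⟩ := (wpt_eq_iff v w hv hw).1 h
  have h1 := congrArg (fun x => evalDual x φ) hm
  simp only [evalDual_smul] at h1
  change co v φ = m * co w φ at h1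
  rw [hvφ, hwφ, mul_one] at h1
  rw [← h1, one_smul] at hm
  exact toExt_injective Q hm

theorem exists_wpt_of_range_subset {φ : Module.Dual L N}
    (y : (extFunctor F L).obj (specOver F A) ⟶ projSpace L N)
    (hy : Set.range y.left ⊆ nonvanishing φ) :
    ∃ (v : A ⊗[F] N) (hv : Unimodular (toExt L v)), co v φ = 1 ∧ y = wpt v hv := by
  obtain ⟨v, hv, h1, h2⟩ := exists_point_of_range_subset (φ := φ) ((extIso F L A).inv ≫ y) (by
    rw [Over.comp_left]
    rintro _ ⟨z, rfl⟩
    rw [Scheme.Hom.comp_apply]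
    exact hy ⟨_, rfl⟩)
  obtain ⟨v, rfl⟩ := toExt_surjective v
  exact ⟨v, hv, h1, by rw [wpt, ← h2, Iso.hom_inv_id_assoc]⟩

theorem range_wpt_subset {v : A ⊗[F] N} {hv : Unimodular (toExt L v)} {φ : Module.Dual L N}
    (h : co v φ = 1) : Set.range (wpt v hv).left ⊆ nonvanishing φ := by
  rintro _ ⟨z, rfl⟩
  rw [wpt, Over.comp_left, Scheme.Hom.comp_apply]
  refine (point_mem_nonvanishing (p := (extIso F L A).hom.left z)).2 ?_
  change co v φ ∉ _
  rw [h]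
  exact fun h' => (PrimeSpectrum.isPrime _).ne_top ((Ideal.eq_top_iff_one _).2 h')

end

/-! ### Charts and representability of the Weil restriction -/

section

open Opposite Quadratic

variable {F L N : Type u} [Field F] [CommRing L] [Algebra F L] [AddCommGroup N] [Module F N]
  [Module L N] [IsScalarTower F L N]

section ChartRing

variable [Module.Free F N] [Module.Finite F N]

/-- The condition co v φ = 1 amounts to two linear equations over F, on its components along 1 and
θ. So B is the polynomial ring of the vector space N modulo these equations. -/
theorem exists_universal_normalized_co (Q : Quadratic F L) (φ : Module.Dual L N) :
    ∃ (B : Type u) (_ : CommRing B) (_ : Algebra F B) (v : B ⊗[F] N), co v φ = 1 ∧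
      (∀ (A : Type u) [CommRing A] [Algebra F A] (w : A ⊗[F] N), co w φ = 1 →
        ∃ χ : B →ₐ[F] A, mapVec χ v = w) ∧
      ∀ (A : Type u) [CommRing A] [Algebra F A] (χ χ' : B →ₐ[F] A),
        mapVec χ v = mapVec χ' v → χ = χ' := by
  let P := SymmetricAlgebra F (Module.Dual F N)
  obtain ⟨v₀, hv₀⟩ := exists_vec (A := P) (SymmetricAlgebra.ι F (Module.Dual F N))
  let J : Ideal P := Ideal.span {Q.reA (co v₀ φ) - 1, Q.imA (co v₀ φ)}
  let π : P →ₐ[F] P ⧸ J := Ideal.Quotient.mkₐ F J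
  have hev : ∀ (A : Type u) [CommRing A] [Algebra F A] (w : A ⊗[F] N),
      mapVec (evalSym w) v₀ = w := by
    intro A _ _ w
    refine vec_ext fun ψ => ?_
    rw [evalDual_mapVec, hv₀, evalSym_ι]
  refine ⟨P ⧸ J, inferInstance, inferInstance, mapVec π v₀, ?_, ?_, ?_⟩
  · rw [co_mapVec, Q.ext_iff, reA_mapA, imA_mapA, reA_one, imA_one]
    constructor
    · rw [← sub_eq_zero, ← map_one π, ← map_sub]
      exact Ideal.Quotient.eq_zero_iff_mem.2 (Ideal.subset_span (by simp))
    · exact Ideal.Quotient.eq_zero_iff_mem.2 (Ideal.subset_span (by simp))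
  · intro A _ _ w hw
    have h := congrArg (fun z => co z φ) (hev A w)
    simp only [co_mapVec] at h
    rw [hw, Q.ext_iff, reA_mapA, imA_mapA, reA_one, imA_one] at h
    refine ⟨Ideal.Quotient.liftₐ J (evalSym w) ?_, ?_⟩
    · intro a ha
      have : J ≤ RingHom.ker (evalSym w) := by
        rw [Ideal.span_le]
        rintro _ (rfl | rfl)
        · change evalSym w _ = 0
          rw [map_sub, h.1, map_one, sub_self]
        · exact h.2
      exact this ha
    · refine vec_ext fun ψ => ?_
      rw [evalDual_mapVec, evalDual_mapVec, hv₀]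
      exact (Ideal.Quotient.liftₐ_apply J _ _ _).trans (evalSym_ι _ _)
  · intro A _ _ χ χ' h
    have : χ.comp π = χ'.comp π := by
      refine SymmetricAlgebra.algHom_ext (LinearMap.ext fun ψ => ?_)
      have := congrArg (fun z => evalDual z ψ) h
      simp only [evalDual_mapVec, hv₀] at this
      exact this
    refine AlgHom.ext fun x => ?_
    obtain ⟨x, rfl⟩ := Ideal.Quotient.mk_surjective x
    exact congrArg (fun g => g x) this

end ChartRing

section Fibre

variable {A : Type u} [CommRing A] [Algebra F A]

/-- The fibres of `Spec (L ⊗ A) ⟶ Spec A` have at most two points up to generization. -/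
theorem le_or_le_comap_conjA (Q : Quadratic F L) {P P' : Ideal (L ⊗[F] A)} [hP : P.IsPrime]
    (h : P'.comap (scal : A →ₐ[F] L ⊗[F] A) ≤ P.comap (scal : A →ₐ[F] L ⊗[F] A)) :
    P' ≤ P ∨ P' ≤ P.comap (Q.conjA : L ⊗[F] A →ₐ[F] L ⊗[F] A) := by
  -- For x in P', the norm of x lies in P, so x or its conjugate does. Prime avoidance for two
  -- ideals then puts P' inside one of them.
  have : (P' : Set (L ⊗[F] A)) ⊆
      P ∪ P.comap (Q.conjA : L ⊗[F] A →ₐ[F] L ⊗[F] A) := by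
    intro x hx
    have h1 : Q.nm x ∈ P'.comap (scal : A →ₐ[F] L ⊗[F] A) := by
      rw [Ideal.mem_comap, scal_nm]
      exact Ideal.mul_mem_right _ _ hx
    have h2 := h h1
    rw [Ideal.mem_comap, scal_nm] at h2
    exact hP.mem_or_mem h2
  exact Ideal.subset_union.1 this

theorem add_mem_nonvanishing {R M : Type u} [CommRing R] [AddCommGroup M] [Module R M]
    {φ ψ : Module.Dual R M} {x : (projSpace R M).left} (h : x ∈ nonvanishing φ)
    (h' : x ∉ nonvanishing ψ) : x ∈ nonvanishing (φ + ψ) := by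
  intro h1
  apply h
  have h2 : SymmetricAlgebra.ι R _ ψ ∈ x.asHomogeneousIdeal.toIdeal := not_not.1 h'
  change SymmetricAlgebra.ι R _ (φ + ψ) ∈ x.asHomogeneousIdeal.toIdeal at h1
  rw [map_add] at h1
  exact (Ideal.add_mem_iff_left _ h2).1 h1

/-- If φ works only at x and ψ only at y, then φ + ψ works at both. No assumption on the size of
residue fields is needed, because only two points are involved. -/
theorem exists_nonvanishing_of_pair {R M : Type u} [CommRing R] [AddCommGroup M] [Module R M]
    (x y : (projSpace R M).left) : ∃ φ : Module.Dual R M, x ∈ nonvanishing φ ∧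
      y ∈ nonvanishing φ := by
  have key : ∀ z : (projSpace R M).left, ∃ φ : Module.Dual R M, z ∈ nonvanishing φ := by
    intro z
    have : z ∈ ⨆ φ : Module.Dual R M, nonvanishing φ := by rw [iSup_nonvanishing]; trivial
    exact TopologicalSpace.Opens.mem_iSup.1 this
  obtain ⟨φ, hφ⟩ := key x
  obtain ⟨ψ, hψ⟩ := key y
  by_cases h1 : y ∈ nonvanishing φ
  · exact ⟨φ, hφ, h1⟩
  by_cases h2 : x ∈ nonvanishing ψ
  · exact ⟨ψ, h2, hψ⟩
  exact ⟨φ + ψ, add_mem_nonvanishing hφ h2, add_comm ψ φ ▸ add_mem_nonvanishing hψ h1⟩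

/-- All primes over p are contained in P or in its conjugate, so a form that vanishes at neither of
these two points vanishes nowhere on the fibre. This is why the charts cover the Weil restriction.
-/
theorem exists_nonvanishing_on_fibre (Q : Quadratic F L)
    (h : specOver L (L ⊗[F] A) ⟶ projSpace L N) (p : Ideal A) :
    ∃ φ : Module.Dual L N, ∀ P : Spec (.of (L ⊗[F] A)),
      P.asIdeal.comap (scal : A →ₐ[F] L ⊗[F] A) = p → h.left P ∈ nonvanishing φ := by
  by_cases hP : ∃ P : Spec (.of (L ⊗[F] A)),
      P.asIdeal.comap (scal : A →ₐ[F] L ⊗[F] A) = p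
  · obtain ⟨P, rfl⟩ := hP
    have hPprime : P.asIdeal.IsPrime := PrimeSpectrum.isPrime P
    let P₂ : Spec (.of (L ⊗[F] A)) :=
      ⟨P.asIdeal.comap (Q.conjA : L ⊗[F] A →ₐ[F] L ⊗[F] A), Ideal.comap_isPrime _ _⟩
    obtain ⟨φ, h1, h2⟩ := exists_nonvanishing_of_pair (h.left P) (h.left P₂)
    refine ⟨φ, fun P' hP' => ?_⟩
    have key : ∀ P₁ : Spec (.of (L ⊗[F] A)), P'.asIdeal ≤ P₁.asIdeal →
        h.left P₁ ∈ nonvanishing φ → h.left P' ∈ nonvanishing φ := by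
      intro P₁ hle hmem
      have : P' ⤳ P₁ := (PrimeSpectrum.le_iff_specializes _ _).1 hle
      exact (this.map h.left.continuous).mem_open (nonvanishing φ).isOpen hmem
    rcases le_or_le_comap_conjA Q hP'.le with h3 | h3
    · exact key P h3 h1
    · exact key P₂ h3 h2
  · exact ⟨0, fun P h => (hP ⟨P, h⟩).elim⟩

/-- A section of the Weil restriction lands locally in one of the charts. -/
theorem exists_nonvanishing_fst (Q : Quadratic F L) {T : Over (Spec (.of F))}
    (y : (extFunctor F L).obj T ⟶ projSpace L N) (t : T.left) :
    ∃ φ : Module.Dual L N, ∀ z : ((extFunctor F L).obj T).left,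
      pullback.fst T.hom (Spec.map (CommRingCat.ofHom (algebraMap F L))) z = t →
        y.left z ∈ nonvanishing φ := by
  obtain ⟨A, _, _, a, ha, ⟨p, rfl⟩, -⟩ := exists_affine_nhd T (U := ⊤) (x := t) trivial
  obtain ⟨φ, hφ⟩ := exists_nonvanishing_on_fibre Q
    ((extIso F L A).inv ≫ (extFunctor F L).map a ≫ y) (PrimeSpectrum.asIdeal p)
  refine ⟨φ, fun z hz => ?_⟩
  obtain ⟨z, rfl⟩ := (mem_range_overPullback_map _ a z).2 ⟨p, hz.symm⟩
  have h1 : a.left (pullback.fst (specOver F A).hom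
      (Spec.map (CommRingCat.ofHom (algebraMap F L))) z) = a.left p := by
    rw [← hz, ← Scheme.Hom.comp_apply, ← Scheme.Hom.comp_apply, overPullback_map_fst]
  have h2 := ha.base_open.injective h1
  have h3 := hφ ((extIso F L A).hom.left z) (by
    rw [← h2, ← pullbackSpecOverIso_hom_fst]
    rfl)
  have h4 : ((extIso F L A).inv ≫ (extFunctor F L).map a ≫ y).left ((extIso F L A).hom.left z) =
      y.left (((extFunctor F L).map a).left z) := by
    rw [← Scheme.Hom.comp_apply, ← Over.comp_left, Iso.hom_inv_id_assoc, Over.comp_left,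
      Scheme.Hom.comp_apply]
  rwa [h4] at h3

end Fibre

section Chart

/-- The projection is finite, hence closed; the image of the vanishing locus of φ is closed, and its
complement is the desired open set. -/
theorem exists_opens_nonvanishing [Module.Finite F L] {T : Over (Spec (.of F))}
    (y : (extFunctor F L).obj T ⟶ projSpace L N) (φ : Module.Dual L N) :
    ∃ U : T.left.Opens, ∀ t, t ∈ U ↔ ∀ z : ((extFunctor F L).obj T).left,
      pullback.fst T.hom (Spec.map (CommRingCat.ofHom (algebraMap F L))) z = t →
        y.left z ∈ nonvanishing φ := by
  have hfin : IsFinite (Spec.map (CommRingCat.ofHom (algebraMap F L))) := by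
    rw [IsFinite.SpecMap_iff]
    exact RingHom.finite_algebraMap.2 inferInstance
  have hcl : IsClosedMap (pullback.fst T.hom (Spec.map (CommRingCat.ofHom (algebraMap F L)))) :=
    Scheme.Hom.isClosedMap _
  refine ⟨⟨((pullback.fst T.hom _) '' (y.left ⁻¹' (nonvanishing φ))ᶜ)ᶜ,
    (hcl _ ((nonvanishing φ).isOpen.preimage y.left.continuous).isClosed_compl).isOpen_compl⟩,
    fun t => ⟨fun ht z hz => ?_, ?_⟩⟩
  · by_contra h
    exact ht ⟨z, h, hz⟩
  · rintro h ⟨z, hz, hzt⟩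
    exact hz (h z hzt)

theorem range_subset_iff_of_nonvanishing {T : Over (Spec (.of F))}
    {y : (extFunctor F L).obj T ⟶ projSpace L N} {φ : Module.Dual L N} {U : T.left.Opens}
    (hU : ∀ t, t ∈ U ↔ ∀ z : ((extFunctor F L).obj T).left,
      pullback.fst T.hom (Spec.map (CommRingCat.ofHom (algebraMap F L))) z = t →
        y.left z ∈ nonvanishing φ) {T' : Over (Spec (.of F))} (a : T' ⟶ T) :
    Set.range a.left ⊆ U ↔
      Set.range ((extFunctor F L).map a ≫ y).left ⊆ nonvanishing φ := by
  constructor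
  · rintro h _ ⟨z, rfl⟩
    rw [Over.comp_left, Scheme.Hom.comp_apply]
    refine (hU _).1 (h ⟨pullback.fst T'.hom _ z, rfl⟩) _ ?_
    rw [← Scheme.Hom.comp_apply, ← Scheme.Hom.comp_apply, overPullback_map_fst]
  · rintro h _ ⟨t, rfl⟩
    refine (hU _).2 fun z hz => ?_
    obtain ⟨z, rfl⟩ := (mem_range_overPullback_map _ a z).2 ⟨t, hz.symm⟩
    rw [← Scheme.Hom.comp_apply, ← Over.comp_left]
    exact h ⟨_, rfl⟩

variable [Module.Free L N] [Module.Finite L N] [Module.Finite F L]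
variable {B : Type u} [CommRing B] [Algebra F B] {v : B ⊗[F] N} {φ : Module.Dual L N}

/-- A section that lands in a chart comes from the universal section of the chart. -/
theorem exists_factor_of_range_subset (Q : Quadratic F L) (hv : co v φ = 1)
    (huniv : ∀ (A : Type u) [CommRing A] [Algebra F A] (w : A ⊗[F] N), co w φ = 1 →
      ∃ χ : B →ₐ[F] A, mapVec χ v = w) {T : Over (Spec (.of F))}
    (hinj : ∀ (A : Type u) [CommRing A] [Algebra F A] (χ χ' : B →ₐ[F] A),
        mapVec χ v = mapVec χ' v → χ = χ')
    (y : (extFunctor F L).obj T ⟶ projSpace L N) (hy : Set.range y.left ⊆ nonvanishing φ) :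
    ∃ b : T ⟶ specOver F B,
      (extFunctor F L).map b ≫ wpt v (unimodular_toExt_of_co_eq_one hv) = y := by
  obtain ⟨b, hb⟩ := exists_hom_of_local (T := T) (Y := specOver F B)
    (fun A _ _ a x => (extFunctor F L).map x ≫ wpt v (unimodular_toExt_of_co_eq_one hv) =
      (extFunctor F L).map a ≫ y)
    (fun A A' _ _ _ _ f a x _ _ h => by
      rw [Functor.map_comp, Functor.map_comp, Category.assoc, Category.assoc, h])
    (fun A _ _ a x x' _ h h' => by
      obtain ⟨χ, rfl⟩ := exists_specMap_eq x
      obtain ⟨χ', rfl⟩ := exists_specMap_eq x'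
      rw [extFunctor_map_wpt] at h h'
      rw [hinj A χ χ' (eq_of_wpt_eq Q (φ := φ) (by rw [co_mapVec, hv, map_one])
        (by rw [co_mapVec, hv, map_one]) (h.trans h'.symm))])
    (fun t => by
      obtain ⟨A, _, _, a, ha, ht, -⟩ := exists_affine_nhd T (U := ⊤) (x := t) trivial
      obtain ⟨w, hw, hwφ, hwy⟩ := exists_wpt_of_range_subset (φ := φ)
        ((extFunctor F L).map a ≫ y) (by
          rw [Over.comp_left]
          rintro _ ⟨z, rfl⟩
          rw [Scheme.Hom.comp_apply]
          exact hy ⟨_, rfl⟩)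
      obtain ⟨χ, rfl⟩ := huniv A w hwφ
      exact ⟨A, _, _, a, specMap χ, ha, ht, by rw [extFunctor_map_wpt, hwy]⟩)
  refine ⟨b, weil_ext fun t => ?_⟩
  obtain ⟨A, _, _, a, ha, ht, -⟩ := exists_affine_nhd T (U := ⊤) (x := t) trivial
  obtain ⟨w, hw, hwφ, hwy⟩ := exists_wpt_of_range_subset (φ := φ)
    ((extFunctor F L).map a ≫ y) (by
      rw [Over.comp_left]
      rintro _ ⟨z, rfl⟩
      rw [Scheme.Hom.comp_apply]
      exact hy ⟨_, rfl⟩)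
  obtain ⟨χ, rfl⟩ := huniv A w hwφ
  have h1 : (extFunctor F L).map (specMap χ) ≫ wpt v (unimodular_toExt_of_co_eq_one hv) =
      (extFunctor F L).map a ≫ y := by rw [extFunctor_map_wpt, hwy]
  refine ⟨A, _, _, a, ha, ht, ?_⟩
  rw [← Category.assoc, ← Functor.map_comp, hb A a _ ha h1, h1]

/-- The charts are the affine schemes of vectors with co v φ = 1, one for each φ. A section comes
from the chart exactly on the open set over which φ vanishes nowhere on the fibres. -/
theorem isRepresentable_weilFunctor (Q : Quadratic F L) :
    (weilFunctor F L (projSpace L N)).IsRepresentable := by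
  have : Module.Free F N := Module.Free.trans (R := F) (S := L) (M := N)
  have : Module.Finite F N := Module.Finite.trans L N
  choose B _ _ v hv huniv hinj using exists_universal_normalized_co (F := F) (N := N) Q
  have hopen : ∀ (φ : Module.Dual L N) (T : Over (Spec (.of F)))
      (y : (extFunctor F L).obj T ⟶ projSpace L N), ∃ U : T.left.Opens,
      (∀ t, t ∈ U ↔ ∀ z : ((extFunctor F L).obj T).left,
      pullback.fst T.hom (Spec.map (CommRingCat.ofHom (algebraMap F L))) z = t →
        y.left z ∈ nonvanishing φ) ∧
      ∀ T' (a : T' ⟶ T), (∃ b : T' ⟶ specOver F (B φ), (extFunctor F L).map b ≫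
        wpt (v φ) (unimodular_toExt_of_co_eq_one (hv φ)) = (extFunctor F L).map a ≫ y) ↔
          Set.range a.left ⊆ U := by
    intro φ T y
    obtain ⟨U, hU⟩ := exists_opens_nonvanishing y φ
    refine ⟨U, hU, fun T' a => ⟨?_, fun h => ?_⟩⟩
    · rintro ⟨b, hb⟩
      rw [range_subset_iff_of_nonvanishing hU, ← hb, Over.comp_left]
      rintro _ ⟨z, rfl⟩
      rw [Scheme.Hom.comp_apply]
      exact range_wpt_subset (hv φ) ⟨_, rfl⟩
    · exact exists_factor_of_range_subset Q (hv φ) (huniv φ) (hinj φ) _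
        ((range_subset_iff_of_nonvanishing hU a).1 h)
  refine isRepresentable_of_charts _ (isZariskiSheaf_overPullback_yoneda _ _)
    (fun φ : ULift.{u} (Module.Dual L N) => specOver F (B φ.down))
    (fun φ => wpt (v φ.down) (unimodular_toExt_of_co_eq_one (hv φ.down))) ?_ ?_ ?_
  · intro φ T a b (hab : (extFunctor F L).map a ≫ _ = (extFunctor F L).map b ≫ _)
    refine over_hom_ext fun t => ?_
    obtain ⟨A, _, _, c, hc, ht, -⟩ := exists_affine_nhd T (U := ⊤) (x := t) trivial
    refine ⟨A, _, _, c, hc, ht, ?_⟩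
    obtain ⟨χ, hχ⟩ := exists_specMap_eq (c ≫ a)
    obtain ⟨χ', hχ'⟩ := exists_specMap_eq (c ≫ b)
    rw [hχ, hχ']
    have h := congrArg ((extFunctor F L).map c ≫ ·) hab
    simp only [← Category.assoc, ← Functor.map_comp] at h
    rw [hχ, hχ', extFunctor_map_wpt, extFunctor_map_wpt] at h
    rw [hinj _ A χ χ' (eq_of_wpt_eq Q (φ := φ.down) (by rw [co_mapVec, hv, map_one])
        (by rw [co_mapVec, hv, map_one]) h)]
  · intro φ T y
    obtain ⟨U, -, hU⟩ := hopen φ.down T y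
    exact ⟨U, hU⟩
  · intro T y t
    obtain ⟨φ, hφ⟩ := exists_nonvanishing_fst Q y t
    obtain ⟨U, hU, hU'⟩ := hopen φ T y
    have ht : t ∈ U := (hU t).2 hφ
    refine ⟨⟨φ⟩, Over.mk (U.ι ≫ T.hom), Over.homMk U.ι, ?_, ?_, ?_⟩
    · exact inferInstanceAs (IsOpenImmersion U.ι)
    · change t ∈ Set.range U.ι
      simpa using ht
    · refine (hU' _ _).2 ?_
      change Set.range U.ι ⊆ U
      simp

end Chart

end

/-! ### Points and open charts of ℙ(N, L) -/

section

open Opposite Quadratic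

variable {F L N : Type u} [Field F] [CommRing L] [Algebra F L] [AddCommGroup N] [Module F N]
  [Module L N] [IsScalarTower F L N]
variable {A B : Type u} [CommRing A] [Algebra F A] [CommRing B] [Algebra F B]
variable {R : Over (Spec (.of F))} (e : (weilFunctor F L (projSpace L N)).RepresentableBy R)

theorem homEquiv_comp_weil {T T' : Over (Spec (.of F))} (a : T' ⟶ T) (l : T ⟶ R) :
    (e.homEquiv (a ≫ l) : (extFunctor F L).obj T' ⟶ projSpace L N) =
      (extFunctor F L).map a ≫ e.homEquiv l :=
  e.homEquiv_comp a l

/-- The point of the Weil restriction given by a vector. -/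
noncomputable def rpt (v : A ⊗[F] N) (hv : Unimodular (toExt L v)) : specOver F A ⟶ R :=
  e.homEquiv.symm (wpt v hv)

theorem homEquiv_rpt (v : A ⊗[F] N) (hv : Unimodular (toExt L v)) :
    e.homEquiv (rpt e v hv) = wpt v hv :=
  e.homEquiv.apply_symm_apply _

theorem specMap_comp_rpt (f : A →ₐ[F] B) (v : A ⊗[F] N) (hv : Unimodular (toExt L v)) :
    specMap f ≫ rpt e v hv = rpt e (mapVec f v) (hv.toExt_map f) := by
  apply e.homEquiv.injective
  rw [homEquiv_rpt]
  refine (homEquiv_comp_weil e _ _).trans ?_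
  rw [homEquiv_rpt, extFunctor_map_wpt]

theorem exists_opens_range_iff [Module.Finite F L] (φ : Module.Dual L N) :
    ∃ U : R.left.Opens, ∀ (T : Over (Spec (.of F))) (l : T ⟶ R), Set.range l.left ⊆ U ↔
      Set.range (e.homEquiv l : (extFunctor F L).obj T ⟶ projSpace L N).left ⊆
        nonvanishing φ := by
  obtain ⟨U, hU⟩ := exists_opens_nonvanishing
    (e.homEquiv (𝟙 R) : (extFunctor F L).obj R ⟶ projSpace L N) φ
  refine ⟨U, fun T l => (range_subset_iff_of_nonvanishing hU l).trans ?_⟩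
  rw [← homEquiv_comp_weil, Category.comp_id]

/-- The open subset of the Weil restriction on which a linear form `φ` vanishes nowhere on the
fibre of the universal line. -/
noncomputable def spanOpens [Module.Finite F L] (φ : Module.Dual L N) : R.left.Opens :=
  (exists_opens_range_iff e φ).choose

theorem range_subset_spanOpens_iff [Module.Finite F L] {φ : Module.Dual L N}
    {T : Over (Spec (.of F))} (l : T ⟶ R) : Set.range l.left ⊆ spanOpens e φ ↔
      Set.range (e.homEquiv l : (extFunctor F L).obj T ⟶ projSpace L N).left ⊆
        nonvanishing φ :=
  (exists_opens_range_iff e φ).choose_spec T l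

variable [Module.Free L N] [Module.Finite L N]

theorem rpt_eq_iff (v w : A ⊗[F] N) (hv : Unimodular (toExt L v)) (hw : Unimodular (toExt L w)) :
    rpt e v hv = rpt e w hw ↔ ∃ m : (L ⊗[F] A)ˣ, toExt L v = (m : L ⊗[F] A) • toExt L w := by
  rw [← wpt_eq_iff v w hv hw, rpt, rpt, e.homEquiv.symm.injective.eq_iff]

theorem eq_of_rpt_eq [Module.Finite F L] (Q : Quadratic F L) {v w : A ⊗[F] N}
    {hv : Unimodular (toExt L v)} {hw : Unimodular (toExt L w)} {φ : Module.Dual L N}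
    (hvφ : co v φ = 1) (hwφ : co w φ = 1) (h : rpt e v hv = rpt e w hw) : v = w :=
  eq_of_wpt_eq Q hvφ hwφ (e.homEquiv.symm.injective h)

theorem exists_rpt_of_range_subset [Module.Finite F L] {φ : Module.Dual L N}
    (l : specOver F A ⟶ R) (hl : Set.range l.left ⊆ spanOpens e φ) :
    ∃ (v : A ⊗[F] N) (hv : Unimodular (toExt L v)), co v φ = 1 ∧ l = rpt e v hv := by
  rw [range_subset_spanOpens_iff] at hl
  obtain ⟨v, hv, h1, h2⟩ := exists_wpt_of_range_subset _ hl
  exact ⟨v, hv, h1, e.homEquiv.injective (h2.trans (homEquiv_rpt e v hv).symm)⟩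

theorem iSup_spanOpens [Module.Finite F L] (Q : Quadratic F L) :
    ⨆ φ : Module.Dual L N, spanOpens e φ = ⊤ := by
  rw [eq_top_iff]
  intro t _
  obtain ⟨φ, hφ⟩ := exists_nonvanishing_fst Q
    (e.homEquiv (𝟙 R) : (extFunctor F L).obj R ⟶ projSpace L N) t
  obtain ⟨U, hU⟩ := exists_opens_nonvanishing
    (e.homEquiv (𝟙 R) : (extFunctor F L).obj R ⟶ projSpace L N) φ
  have ht : t ∈ U := (hU t).2 hφ
  -- `spanOpens` is characterized only through morphisms that land in it, so membership of t is read
  -- off from the inclusion of a neighbourhood.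
  let a : Over.mk (U.ι ≫ R.hom) ⟶ R := Over.homMk U.ι
  have h1 : Set.range a.left ⊆ U := by
    change Set.range U.ι ⊆ U
    simp
  rw [range_subset_iff_of_nonvanishing hU, ← homEquiv_comp_weil, Category.comp_id,
    ← range_subset_spanOpens_iff] at h1
  refine TopologicalSpace.Opens.mem_iSup.2 ⟨φ, h1 ?_⟩
  change t ∈ Set.range U.ι
  simpa using ht

end

/-! ### Dividing a vector by one of its coordinates; pairs of a line and an L-line -/

section

open Opposite Quadratic

variable {F L N : Type u} [Field F] [CommRing L] [Algebra F L] [AddCommGroup N] [Module F N]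
  [Module L N] [IsScalarTower F L N]
variable {A B : Type u} [CommRing A] [Algebra F A] [CommRing B] [Algebra F B]

section Factor

variable (Q : Quadratic F L)

/-- The quotients of the norms by s generate the unit ideal: if all lay in p, then s would lie in s
p, and cancelling s would give 1 ∈ p. -/
theorem exists_eq_mul_of_normIdeal_eq_span {w : A ⊗[F] N} {s : A} (hs : s ∈ nonZeroDivisors A)
    (h : normIdeal Q w = Ideal.span {s}) (p : Ideal A) (hp : p ≠ ⊤) :
    ∃ (φ : Module.Dual L N) (n : A), Q.nm (co w φ) = s * n ∧ n ∉ p := by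
  have h1 : ∀ φ : Module.Dual L N, ∃ n, Q.nm (co w φ) = s * n := fun φ =>
    Ideal.mem_span_singleton'.1 (h ▸ nm_mem_normIdeal Q w φ) |>.imp fun n hn => by
      rw [← hn, mul_comm]
  choose n hn using h1
  by_contra! hc
  have h2 : normIdeal Q w ≤ Ideal.span {s} * p := by
    rw [normIdeal_le_iff]
    intro φ
    rw [hn]
    exact Ideal.mul_mem_mul (Ideal.mem_span_singleton_self s) (hc φ _ (hn φ))
  have h3 : s ∈ Ideal.span {s} * p := h2 (h ▸ Ideal.mem_span_singleton_self s)
  obtain ⟨z, hz, hz'⟩ := Ideal.mem_span_singleton_mul.1 h3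
  have h4 : z = 1 := by
    have : s * z = s * 1 := by rw [hz', mul_one]
    exact (mul_cancel_left_mem_nonZeroDivisors hs).1 this
  exact hp ((Ideal.eq_top_iff_one _).2 (h4 ▸ hz))

theorem mem_nonZeroDivisors_of_toExt_eq_smul {v w : A ⊗[F] N} {l : L ⊗[F] A} {s : A}
    (hs : s ∈ nonZeroDivisors A) (hI : normIdeal Q w = Ideal.span {s})
    (h : toExt L w = l • toExt L v) : l ∈ nonZeroDivisors (L ⊗[F] A) := by
  apply Q.mem_nonZeroDivisors_of_nm
  have h1 : Ideal.span {s} ≤ Ideal.span {Q.nm l} := by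
    rw [← hI, normIdeal_of_toExt_eq_smul Q h]
    exact Ideal.mul_le_left (I := Ideal.span {Q.nm l}) (J := normIdeal Q v)
  obtain ⟨c, hc⟩ := Ideal.span_singleton_le_span_singleton.1 h1
  rw [hc] at hs
  exact (mul_mem_nonZeroDivisors.1 hs).1

variable [Module.Free L N] [Module.Finite L N]

/-- Put c = co w φ, so that c times its conjugate is s n. The conjugate of c times co w ψ equals s y
for some y; multiplying by c and cancelling s shows that c divides co w ψ. The quotients depend
linearly on ψ because c is a nonzerodivisor, and they are the coordinates of v. -/
theorem exists_factor_of_normIdeal_eq_span {w : A ⊗[F] N} {s n : A} {φ : Module.Dual L N}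
    (hs : s ∈ nonZeroDivisors A) (h : normIdeal Q w = Ideal.span {s})
    (hn : Q.nm (co w φ) = s * n) (hu : IsUnit n) :
    co w φ ∈ nonZeroDivisors (L ⊗[F] A) ∧
      ∃ v : A ⊗[F] N, co v φ = 1 ∧ toExt L w = co w φ • toExt L v := by
  have hnz : co w φ ∈ nonZeroDivisors (L ⊗[F] A) := by
    apply Q.mem_nonZeroDivisors_of_nm
    rw [hn]
    exact mul_mem hs hu.mem_nonZeroDivisors
  have hss : (scal s : L ⊗[F] A) ∈ nonZeroDivisors (L ⊗[F] A) := Q.scal_mem_nonZeroDivisors hs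
  obtain ⟨u, rfl⟩ := hu
  have key : ∀ ψ : Module.Dual L N, ∃ y, co w ψ = co w φ * y := by
    intro ψ
    have h1 := conjA_co_mul_co_mem Q w φ ψ
    rw [h, Ideal.map_span, Set.image_singleton, Ideal.mem_span_singleton'] at h1
    obtain ⟨y, hy⟩ := h1
    refine ⟨scal ((u⁻¹ : Aˣ) : A) * y, ?_⟩
    have h2 : (scal s : L ⊗[F] A) * (scal (u : A) * co w ψ) = scal s * (co w φ * y) := by
      have h3 := Q.scal_nm (co w φ)
      rw [hn, map_mul] at h3
      rw [← mul_assoc, h3, mul_assoc, ← hy]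
      change co w φ * (y * scal s) = _
      ring
    have h4 := (mul_cancel_left_mem_nonZeroDivisors hss).1 h2
    have h5 : (scal ((u⁻¹ : Aˣ) : A) : L ⊗[F] A) * scal (u : A) = 1 := by
      rw [← map_mul, Units.inv_mul, map_one]
    calc co w ψ = scal ((u⁻¹ : Aˣ) : A) * scal (u : A) * co w ψ := by rw [h5, one_mul]
      _ = _ := by rw [mul_assoc, h4]; ring
  choose y hy using key
  have hcancel : ∀ a b, co w φ * a = co w φ * b → a = b := fun a b =>
    (mul_cancel_left_mem_nonZeroDivisors hnz).1
  obtain ⟨V, hV⟩ := exists_vec (R := L) (M := N) (A := L ⊗[F] A)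
    { toFun := y
      map_add' := fun a b => hcancel _ _ (by rw [← hy, map_add, hy, hy b]; ring)
      map_smul' := fun c a => hcancel _ _ (by
        rw [← hy, map_smul, hy a, RingHom.id_apply, mul_smul_comm]) }
  have hV : ∀ ψ, evalDual V ψ = y ψ := fun ψ => congrArg (fun g => g ψ) hV
  obtain ⟨v, rfl⟩ := toExt_surjective V
  refine ⟨hnz, v, ?_, vec_ext fun ψ => ?_⟩
  · refine (hV φ).trans (hcancel _ _ ?_)
    rw [← hy, mul_one]
  · rw [evalDual_smul, hV]
    exact hy ψ

/-- The minors of v and v' are killed by the nonzerodivisor l, hence vanish. This is the uniqueness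
of the L-line through a given line. -/
theorem exists_unit_of_smul_eq {v v' : A ⊗[F] N} {l m : L ⊗[F] A}
    (hl : l ∈ nonZeroDivisors (L ⊗[F] A)) (hv : Unimodular (toExt L v))
    (hv' : Unimodular (toExt L v')) (h : l • toExt L v = m • toExt L v') :
    ∃ m : (L ⊗[F] A)ˣ, toExt L v = (m : L ⊗[F] A) • toExt L v' := by
  refine exists_unit_smul_of_minors hv hv' fun φ ψ => ?_
  apply (mul_cancel_left_mem_nonZeroDivisors hl).1
  have h1 := fun φ : Module.Dual L N => congrArg (fun z => evalDual z φ) h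
  simp only [evalDual_smul] at h1
  linear_combination evalDual (toExt L v') ψ * h1 φ - evalDual (toExt L v') φ * h1 ψ

end Factor

variable {R : Over (Spec (.of F))} (e : (weilFunctor F L (projSpace L N)).RepresentableBy R)

/-- A line and an `L`-line that contains it, locally generated by vectors. -/
def SpanRel (x : specOver F A ⟶ projSpace F N) (y : specOver F A ⟶ R) : Prop :=
  ∃ (w : A ⊗[F] N) (hw : Unimodular w) (v : A ⊗[F] N) (hv : Unimodular (toExt L v))
    (l : L ⊗[F] A), toExt L w = l • toExt L v ∧ x = point w hw ∧ y = rpt e v hv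

theorem SpanRel.comp {x : specOver F A ⟶ projSpace F N} {y : specOver F A ⟶ R}
    (h : SpanRel e x y) (f : A →ₐ[F] B) : SpanRel e (specMap f ≫ x) (specMap f ≫ y) := by
  obtain ⟨w, hw, v, hv, l, h, rfl, rfl⟩ := h
  refine ⟨mapVec f w, hw.map f, mapVec f v, hv.toExt_map f, mapA f l, ?_,
    specMap_comp_point f w hw, specMap_comp_rpt e f v hv⟩
  rw [toExt_mapVec, h, toExt_mapVec]
  generalize toExt L v = V
  induction V with
  | zero => simp
  | tmul a n => simp [smul_tmul']
  | add a b ha hb => rw [smul_add, map_add, ha, hb, map_add, smul_add]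

/-- A family of lines and a family of `L`-lines that contain them. -/
def IsSpanPair {T : Over (Spec (.of F))} (x : T ⟶ projSpace F N) (y : T ⟶ R) : Prop :=
  ∀ t : T.left, ∃ (A : Type u) (_ : CommRing A) (_ : Algebra F A) (a : specOver F A ⟶ T),
    IsOpenImmersion a.left ∧ t ∈ Set.range a.left ∧ SpanRel e (a ≫ x) (a ≫ y)

theorem exists_affine_nhd_lift {R : Type u} [CommRing R] {T T' T₁ : Over (Spec (.of R))} (f : T' ⟶ T)
    (a : T₁ ⟶ T) [IsOpenImmersion a.left] {t : T'.left} (ht : f.left t ∈ Set.range a.left) :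
    ∃ (B : Type u) (_ : CommRing B) (_ : Algebra R B) (b : specOver R B ⟶ T')
      (c : specOver R B ⟶ T₁), IsOpenImmersion b.left ∧ t ∈ Set.range b.left ∧
        b ≫ f = c ≫ a := by
  obtain ⟨B, _, _, b, hb, htb, hU⟩ := exists_affine_nhd T' (U := f.left ⁻¹ᵁ a.left.opensRange)
    (x := t) ht
  have h : Set.range (b ≫ f).left ⊆ Set.range a.left := by
    rw [Over.comp_left]
    rintro _ ⟨z, rfl⟩
    rw [Scheme.Hom.comp_apply]
    exact hU ⟨z, rfl⟩
  refine ⟨B, _, _, b, Over.homMk (IsOpenImmersion.lift a.left (b ≫ f).left h) ?_, hb, htb, ?_⟩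
  · rw [← Over.w a, IsOpenImmersion.lift_fac_assoc, Over.w]
  · ext1
    exact (IsOpenImmersion.lift_fac _ _ _).symm

theorem IsSpanPair.comp {T T' : Over (Spec (.of F))} {x : T ⟶ projSpace F N} {y : T ⟶ R}
    (h : IsSpanPair e x y) (f : T' ⟶ T) : IsSpanPair e (f ≫ x) (f ≫ y) := by
  intro t
  obtain ⟨A, _, _, a, ha, ht, hr⟩ := h (f.left t)
  obtain ⟨B, _, _, b, c, hb, htb, he⟩ := exists_affine_nhd_lift f a ht
  obtain ⟨g, rfl⟩ := exists_specMap_eq c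
  refine ⟨B, _, _, b, hb, htb, ?_⟩
  rw [← Category.assoc, ← Category.assoc, he, Category.assoc, Category.assoc]
  exact hr.comp e g

theorem IsSpanPair.of_local {T : Over (Spec (.of F))} {x : T ⟶ projSpace F N} {y : T ⟶ R}
    (h : ∀ t : T.left, ∃ (T' : Over (Spec (.of F))) (a : T' ⟶ T), IsOpenImmersion a.left ∧
      t ∈ Set.range a.left ∧ IsSpanPair e (a ≫ x) (a ≫ y)) : IsSpanPair e x y := by
  intro t
  obtain ⟨T', a, ha, ⟨t', rfl⟩, h⟩ := h t
  obtain ⟨A, _, _, b, hb, ⟨z, rfl⟩, hr⟩ := h t'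
  refine ⟨A, _, _, b ≫ a, ?_, ⟨z, by rw [Over.comp_left, Scheme.Hom.comp_apply]⟩, ?_⟩
  · rw [Over.comp_left]
    infer_instance
  · rwa [Category.assoc, Category.assoc]

end

/-! ### The span map on U and the unique L-line through a line -/

section

open Opposite Quadratic

variable {F L N : Type u} [Field F] [CommRing L] [Algebra F L] [AddCommGroup N] [Module F N]
  [Module L N] [IsScalarTower F L N]
variable {A B : Type u} [CommRing A] [Algebra F A] [CommRing B] [Algebra F B]
variable [Module.Free L N] [Module.Finite L N] [Module.Free F N] [Module.Finite F N]

theorem toExt_smul_mapVec {v w : A ⊗[F] N} {l : L ⊗[F] A} (h : toExt L w = l • toExt L v)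
    (f : A →ₐ[F] B) : toExt L (mapVec f w) = mapA f l • toExt L (mapVec f v) := by
  rw [toExt_mapVec, h, toExt_mapVec]
  exact vec_ext fun φ => by simp only [evalDual_mapVec, evalDual_smul, map_mul]

theorem point_mem_annLocus_iff (Q : Quadratic F L) {w : A ⊗[F] N} (hw : Unimodular w)
    (p : Spec (.of A)) :
    (point w hw).left p ∈ annLocus F L N ↔ normIdeal Q w ≤ p.asIdeal := by
  obtain ⟨B, _, _, b, ψ, v, hv, hb, ⟨r, hr⟩, -, h1, h2⟩ :=
    exists_local_point (point w hw) (U := ⊤) (x := p) trivial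
  obtain ⟨f, rfl⟩ := exists_specMap_eq b
  have h3 : normIdeal Q v = (normIdeal Q w).map f.toRingHom := by
    rw [specMap_comp_point, point_eq_iff] at h2
    obtain ⟨m, hm⟩ := h2
    rw [← normIdeal_mapVec, hm, normIdeal_smul_unit]
  have h4 : (point w hw).left p = (point v hv).left r := by
    rw [← h2, ← hr, Over.comp_left, Scheme.Hom.comp_apply]
  obtain ⟨χ, rfl⟩ := exists_mapVec_univVec v h1
  rw [h4, ← specMap_comp_point χ _ (unimodular_univVec ψ), ← chart_eq_point, Over.comp_left,
    Scheme.Hom.comp_apply]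
  have h5 : normIdeal Q (univVec ψ) ≤ ((specMap χ).left r).asIdeal ↔
      normIdeal Q (mapVec χ (univVec ψ)) ≤ r.asIdeal := by
    rw [normIdeal_mapVec, Ideal.map_le_iff_le_comap]
    rfl
  refine (chart_mem_annLocus_iff Q ψ _).trans (h5.trans ?_)
  rw [h3, Ideal.map_le_iff_le_comap, ← hr]
  rfl

theorem normIdeal_eq_top_of_range (Q : Quadratic F L) {w : A ⊗[F] N} {hw : Unimodular w}
    (h : Set.range (point w hw).left ⊆ (annLocus F L N)ᶜ) : normIdeal Q w = ⊤ := by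
  by_contra hne
  obtain ⟨m, hm, hle⟩ := Ideal.exists_le_maximal _ hne
  exact h ⟨(⟨m, hm.isPrime⟩ : PrimeSpectrum A), rfl⟩
    ((point_mem_annLocus_iff Q hw ⟨m, hm.isPrime⟩).2 hle)

theorem range_point_subset (Q : Quadratic F L) {w : A ⊗[F] N} (hw : Unimodular w)
    (h : normIdeal Q w = ⊤) : Set.range (point w hw).left ⊆ (annLocus F L N)ᶜ := by
  rintro _ ⟨p, rfl⟩ hp
  have h1 := (point_mem_annLocus_iff Q hw p).1 hp
  rw [h] at h1
  exact (PrimeSpectrum.isPrime p).ne_top (top_le_iff.1 h1)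

variable {R : Over (Spec (.of F))} (e : (weilFunctor F L (projSpace L N)).RepresentableBy R)

theorem IsLineSpanMap.comp_eq {U : (projSpace F N).left.Opens}
    {f : Over.mk (U.ι ≫ (projSpace F N).hom) ⟶ R} {e} (hf : IsLineSpanMap e U f)
    {v : A ⊗[F] N} {hv : Unimodular v} {p : specOver F A ⟶ Over.mk (U.ι ≫ (projSpace F N).hom)}
    (h : p.left ≫ U.ι = (point v hv).left) :
    ∃ hv' : Unimodular (toExt L v), p ≫ f = rpt e v hv' := by
  obtain ⟨hv', h'⟩ := hf.map_point A v hv p h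
  refine ⟨hv', e.homEquiv.injective ?_⟩
  rw [homEquiv_rpt]
  exact Over.OverMorphism.ext h'

/-- On U the norm ideal is the unit ideal, so w itself generates an L-line. Rescaling w by a unit of
A does not change that L-line, so the local definitions glue. -/
theorem exists_isLineSpanMap (Q : Quadratic F L) :
    ∃ (U : (projSpace F N).left.Opens) (f : Over.mk (U.ι ≫ (projSpace F N).hom) ⟶ R),
      IsLineSpanMap e U f := by
  let U : (projSpace F N).left.Opens := ⟨(annLocus F L N)ᶜ, (isClosed_annLocus Q).isOpen_compl⟩
  let T : Over (Spec (.of F)) := Over.mk (U.ι ≫ (projSpace F N).hom)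
  let j : T ⟶ projSpace F N := Over.homMk U.ι
  have hj : ∀ (A : Type u) [CommRing A] [Algebra F A] (a : specOver F A ⟶ T) (w : A ⊗[F] N)
      (hw : Unimodular w), a ≫ j = point w hw → Unimodular (toExt L w) := by
    intro A _ _ a w hw h
    refine unimodular_of_normIdeal_eq_top Q (normIdeal_eq_top_of_range Q (hw := hw) ?_)
    rw [← h, Over.comp_left]
    rintro _ ⟨z, rfl⟩
    rw [Scheme.Hom.comp_apply]
    exact (a.left z).2
  obtain ⟨f, hf⟩ := comp_eq_of_local (T := T) (Y := R)
    (fun A _ _ a y => ∃ (w : A ⊗[F] N) (hw : Unimodular w) (hw' : Unimodular (toExt L w)),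
      a ≫ j = point w hw ∧ y = rpt e w hw')
    (by
      rintro A B _ _ _ _ f a y ⟨w, hw, hw', h, rfl⟩
      exact ⟨mapVec f w, hw.map f, hw'.toExt_map f, by
        rw [Category.assoc, h, specMap_comp_point], specMap_comp_rpt e f w hw'⟩)
    (by
      rintro A _ _ a y y' ⟨w, hw, hw', h, rfl⟩ ⟨v, hv, hv', h', rfl⟩
      obtain ⟨m, hm⟩ := point_eq_iff.1 (h.symm.trans h')
      refine (rpt_eq_iff e w v hw' hv').2 ⟨m.map (scal : A →ₐ[F] L ⊗[F] A).toMonoidHom, ?_⟩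
      rw [hm, toExt_smul]
      rfl)
    (by
      intro x
      obtain ⟨A, _, _, a, φ, w, hw, ha, hx, -, -, h⟩ := exists_local_point j (U := ⊤) (x := x) trivial
      exact ⟨A, _, _, a, rpt e w (hj A a w hw h), ha, hx, w, hw, _, h, rfl⟩)
  refine ⟨U, f, rfl, dense_compl_annLocus Q, ?_⟩
  intro A _ _ v hv p hp
  have hp' : p ≫ j = point v hv := by ext1; exact hp
  have hv' := hj A p v hv hp'
  refine ⟨hv', ?_⟩
  rw [hf A p _ ⟨v, hv, hv', hp', rfl⟩, homEquiv_rpt]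
  rfl

variable [Module.Finite F L] [_root_.IsReduced L]

theorem rpt_eq_of_toExt_eq_smul {w w' v v' : A ⊗[F] N} {l l' : L ⊗[F] A} {s : A}
    (Q : Quadratic F L) (hs : s ∈ nonZeroDivisors A) (hI : normIdeal Q w = Ideal.span {s})
    (hw : Unimodular w) (hw' : Unimodular w') (hww' : point w hw = point w' hw')
    (hv : Unimodular (toExt L v)) (hv' : Unimodular (toExt L v'))
    (h : toExt L w = l • toExt L v) (h' : toExt L w' = l' • toExt L v') :
    rpt e v hv = rpt e v' hv' := by
  obtain ⟨m, hm⟩ := point_eq_iff.1 hww'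
  refine (rpt_eq_iff e v v' hv hv').2 (exists_unit_of_smul_eq
    (mem_nonZeroDivisors_of_toExt_eq_smul Q hs hI h) hv hv' (m := (scal (m : A)) * l') ?_)
  rw [← h, hm, toExt_smul, h', smul_smul]

/-- If the inverse image of the degeneracy locus is a Cartier divisor, then the lines of a family
of lines are contained in a unique family of `L`-lines. -/
theorem existsUnique_isSpanPair (Q : Quadratic F L) {T : Over (Spec (.of F))}
    {x : T ⟶ projSpace F N} (H : IsInvertibleIdeal ((annIdeal F L N).comap x.left)) :
    ∃! y : T ⟶ R, IsSpanPair e x y := by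
  have hloc : ∀ t : T.left, ∃ (A : Type u) (_ : CommRing A) (_ : Algebra F A)
      (a : specOver F A ⟶ T) (w : A ⊗[F] N) (hw : Unimodular w) (s : A), IsOpenImmersion a.left ∧
      t ∈ Set.range a.left ∧ a ≫ x = point w hw ∧ s ∈ nonZeroDivisors A ∧
      normIdeal Q w = Ideal.span {s} := by
    intro t
    obtain ⟨A, _, _, a, ψ, w, hw, s, ha, ht, -, -, h2, hs, hI⟩ :=
      H.exists_local_point Q (U := ⊤) (x := t) trivial
    exact ⟨A, _, _, a, w, hw, s, ha, ht, h2, hs, hI⟩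
  have hmap : ∀ (A B : Type u) [CommRing A] [Algebra F A] [CommRing B] [Algebra F B]
      (f : A →ₐ[F] B), IsOpenImmersion (specMap f).left → ∀ (w : A ⊗[F] N) (s : A),
      s ∈ nonZeroDivisors A → normIdeal Q w = Ideal.span {s} →
      f s ∈ nonZeroDivisors B ∧ normIdeal Q (mapVec f w) = Ideal.span {f s} := by
    intro A B _ _ _ _ f hf w s hs hI
    have hf' : IsOpenImmersion (Spec.map (CommRingCat.ofHom f.toRingHom)) := hf
    refine ⟨mem_nonZeroDivisors_of_isOpenImmersion (f := f.toRingHom) hs, ?_⟩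
    rw [normIdeal_mapVec, hI, Ideal.map_span, Set.image_singleton]
    rfl
  have hspan : ∀ t : T.left, ∃ (A : Type u) (_ : CommRing A) (_ : Algebra F A)
      (a : specOver F A ⟶ T) (w : A ⊗[F] N) (hw : Unimodular w) (s : A) (v : A ⊗[F] N)
      (_ : Unimodular (toExt L v)) (l : L ⊗[F] A), IsOpenImmersion a.left ∧
      t ∈ Set.range a.left ∧ a ≫ x = point w hw ∧ s ∈ nonZeroDivisors A ∧
      normIdeal Q w = Ideal.span {s} ∧ toExt L w = l • toExt L v := by
    intro t
    obtain ⟨A, _, _, a, w, hw, s, ha, ⟨p, rfl⟩, h2, hs, hI⟩ := hloc t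
    have hp : (PrimeSpectrum.asIdeal p) ≠ ⊤ := (PrimeSpectrum.isPrime p).ne_top
    obtain ⟨φ, n, hn, hnp⟩ := exists_eq_mul_of_normIdeal_eq_span Q hs hI _ hp
    -- Since n is not in p, the basic open set of n is a neighbourhood of p; there n is a unit and w
    -- can be divided by its coordinate at φ.
    let f : A →ₐ[F] Localization.Away n := IsScalarTower.toAlgHom F A (Localization.Away n)
    have hf : IsOpenImmersion (specMap f).left :=
      inferInstanceAs (IsOpenImmersion (Spec.map (CommRingCat.ofHom
        (algebraMap A (Localization.Away n)))))
    obtain ⟨hs', hI'⟩ := hmap A _ f hf w s hs hI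
    obtain ⟨hnz, v, hv, hwv⟩ := exists_factor_of_normIdeal_eq_span Q (n := f n) (φ := φ) hs' hI'
      (by rw [co_mapVec, nm_mapA, hn, map_mul])
      (IsLocalization.Away.algebraMap_isUnit (S := Localization.Away n) n)
    refine ⟨_, _, _, specMap f ≫ a, mapVec f w, hw.map f, f s, v,
      unimodular_toExt_of_co_eq_one hv, _, ?_, ?_, ?_, hs', hI', hwv⟩
    · rw [Over.comp_left]; infer_instance
    · have : p ∈ Set.range (specMap f).left := by
        have h := PrimeSpectrum.localization_away_comap_range (Localization.Away n) n
        have h' : p ∈ (PrimeSpectrum.basicOpen n : Set (PrimeSpectrum A)) := hnp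
        rw [← h] at h'
        exact h'
      obtain ⟨q, hq⟩ := this
      exact ⟨q, by rw [Over.comp_left, Scheme.Hom.comp_apply, hq]⟩
    · rw [Category.assoc, h2, specMap_comp_point]
  -- The relation records the nonzerodivisor s, which survives open immersions but not arbitrary
  -- base change; hence this form of the gluing lemma.
  obtain ⟨y, hy⟩ := exists_hom_of_local (T := T) (Y := R)
    (fun A _ _ a y => ∃ (w : A ⊗[F] N) (hw : Unimodular w) (s : A) (v : A ⊗[F] N)
      (hv : Unimodular (toExt L v)) (l : L ⊗[F] A), a ≫ x = point w hw ∧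
      s ∈ nonZeroDivisors A ∧ normIdeal Q w = Ideal.span {s} ∧ toExt L w = l • toExt L v ∧
      y = rpt e v hv)
    (by
      rintro A B _ _ _ _ f a y - hf ⟨w, hw, s, v, hv, l, h1, h2, h3, h4, rfl⟩
      obtain ⟨hs', hI'⟩ := hmap A _ f hf w s h2 h3
      exact ⟨mapVec f w, hw.map f, f s, mapVec f v, hv.toExt_map f, mapA f l,
        by rw [Category.assoc, h1, specMap_comp_point], hs', hI', toExt_smul_mapVec h4 f,
        specMap_comp_rpt e f v hv⟩)
    (by
      rintro A _ _ a y y' - ⟨w, hw, s, v, hv, l, h1, h2, h3, h4, rfl⟩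
        ⟨w', hw', s', v', hv', l', h1', h2', h3', h4', rfl⟩
      exact rpt_eq_of_toExt_eq_smul e Q h2 h3 hw hw' (h1.symm.trans h1') hv hv' h4 h4')
    (by
      intro t
      obtain ⟨A, _, _, a, w, hw, s, v, hv, l, ha, ht, h1, h2, h3, h4⟩ := hspan t
      exact ⟨A, _, _, a, rpt e v hv, ha, ht, w, hw, s, v, hv, l, h1, h2, h3, h4, rfl⟩)
  refine ⟨y, fun t => ?_, fun y' hy' => over_hom_ext fun t => ?_⟩
  · obtain ⟨A, _, _, a, w, hw, s, v, hv, l, ha, ht, h1, h2, h3, h4⟩ := hspan t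
    have h5 := hy A a _ ha ⟨w, hw, s, v, hv, l, h1, h2, h3, h4, rfl⟩
    exact ⟨A, _, _, a, ha, ht, w, hw, v, hv, l, h4, h1, h5⟩
  · obtain ⟨A, _, _, a, w, hw, s, v, hv, l, ha, ⟨p, hp⟩, h1, h2, h3, h4⟩ := hspan t
    have h5 := hy A a _ ha ⟨w, hw, s, v, hv, l, h1, h2, h3, h4, rfl⟩
    obtain ⟨A', _, _, a', ha', ht', w', hw', v', hv', l', h4', h1', h5'⟩ := hy' t
    obtain ⟨C, _, _, f, g, hf, ⟨q, hq⟩, he, -⟩ :=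
      exists_common_refinement a a' p (by rw [hp]; exact ht')
    obtain ⟨hs', hI'⟩ := hmap A _ f hf w s h2 h3
    refine ⟨C, _, _, specMap f ≫ a, ?_, ⟨q, ?_⟩, ?_⟩
    · rw [Over.comp_left]; infer_instance
    · rw [Over.comp_left, Scheme.Hom.comp_apply, hq, hp]
    · rw [Category.assoc, Category.assoc, h5, ← Category.assoc, he, Category.assoc, h5',
        specMap_comp_rpt, specMap_comp_rpt]
      refine (rpt_eq_of_toExt_eq_smul e Q hs' hI' (hw.map f) (hw'.map g) ?_ _ _
        (toExt_smul_mapVec h4 f) (toExt_smul_mapVec h4' g)).symm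
      rw [← specMap_comp_point f w hw, ← specMap_comp_point g w' hw', ← h1, ← h1', ← Category.assoc,
        he, Category.assoc]

end

/-! ### Extensions of the span map across a Cartier divisor -/

section

open Opposite Quadratic

variable {F L N : Type u} [Field F] [CommRing L] [Algebra F L] [AddCommGroup N] [Module F N]
  [Module L N] [IsScalarTower F L N]
variable {A B : Type u} [CommRing A] [Algebra F A] [CommRing B] [Algebra F B]
variable [Module.Free L N] [Module.Finite L N] [Module.Free F N] [Module.Finite F N]
variable {R : Over (Spec (.of F))} {e : (weilFunctor F L (projSpace L N)).RepresentableBy R}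
variable {U : (projSpace F N).left.Opens} {f : Over.mk (U.ι ≫ (projSpace F N).hom) ⟶ R}
  {X : Scheme.{u}} {π : X ⟶ (projSpace F N).left} {g : Over.mk (π ≫ (projSpace F N).hom) ⟶ R}

/-- When the norm ideal of w is the unit ideal, the point lies over U, where g is prescribed by the
span map. -/
theorem Extends.exists_comp_eq_rpt (Q : Quadratic F L) (hf : IsLineSpanMap e U f)
    (hE : Extends f π g) (a : specOver F A ⟶ Over.mk (π ≫ (projSpace F N).hom))
    {w : A ⊗[F] N} {hw : Unimodular w} (ha : a.left ≫ π = (point w hw).left)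
    (hI : normIdeal Q w = ⊤) : ∃ hw' : Unimodular (toExt L w), a ≫ g = rpt e w hw' := by
  have hr : Set.range a.left ⊆ Set.range (π ⁻¹ᵁ U).ι := by
    rintro _ ⟨z, rfl⟩
    have h1 := range_point_subset Q hw hI ⟨z, rfl⟩
    rw [← hf.coe_eq, ← ha, Scheme.Hom.comp_apply] at h1
    rw [Scheme.Opens.range_ι]
    exact h1
  let a' : (specOver F A).left ⟶ (π ⁻¹ᵁ U).toScheme := IsOpenImmersion.lift (π ⁻¹ᵁ U).ι a.left hr
  have ha' : a' ≫ (π ⁻¹ᵁ U).ι = a.left := IsOpenImmersion.lift_fac _ _ _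
  have hp : (a' ≫ (π ∣_ U)) ≫ U.ι = (point w hw).left := by
    rw [Category.assoc, morphismRestrict_ι, reassoc_of% ha', ha]
  let p : specOver F A ⟶ Over.mk (U.ι ≫ (projSpace F N).hom) := Over.homMk (a' ≫ (π ∣_ U)) (by
    change (a' ≫ (π ∣_ U)) ≫ U.ι ≫ _ = _
    rw [← Category.assoc, hp, Over.w])
  obtain ⟨hw', h⟩ := hf.comp_eq (p := p) hp
  refine ⟨hw', ?_⟩
  rw [← h]
  ext1
  change a.left ≫ g.left = (a' ≫ (π ∣_ U)) ≫ f.left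
  rw [Category.assoc, ← (show _ = _ from hE), reassoc_of% ha']

/-- A family of `L`-lines that contain the lines of a family extends the span map. -/
theorem IsSpanPair.extends (Q : Quadratic F L) (hf : IsLineSpanMap e U f)
    (h : IsSpanPair e (Over.homMk π : Over.mk (π ≫ (projSpace F N).hom) ⟶ projSpace F N) g) :
    Extends f π g := by
  refine Scheme.hom_ext_of_local fun z => ?_
  let T : Over (Spec (.of F)) := Over.mk ((π ⁻¹ᵁ U).ι ≫ π ≫ (projSpace F N).hom)
  let j : T ⟶ Over.mk (π ≫ (projSpace F N).hom) := Over.homMk (π ⁻¹ᵁ U).ι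
  obtain ⟨A, _, _, a, ha, hz, hr⟩ := h (j.left z)
  obtain ⟨B, _, _, b, c, hb, hzb, he⟩ := exists_affine_nhd_lift (T' := T) j a hz
  obtain ⟨χ, rfl⟩ := exists_specMap_eq c
  obtain ⟨w, hw, v, hv, l, h1, h2, h3⟩ := hr.comp e χ
  refine ⟨_, b.left, hb, hzb, ?_⟩
  have hbw : (b.left ≫ (π ∣_ U)) ≫ U.ι = (point w hw).left := by
    rw [← h2, Category.assoc, morphismRestrict_ι, ← Category.assoc, ← Category.assoc (specMap χ),
      ← he]
    rfl
  have hI : normIdeal Q w = ⊤ := by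
    refine normIdeal_eq_top_of_range Q (hw := hw) ?_
    rw [← hbw, ← hf.coe_eq]
    rintro _ ⟨y, rfl⟩
    rw [Scheme.Hom.comp_apply]
    exact ((b.left ≫ (π ∣_ U)) y).2
  let p : specOver F B ⟶ Over.mk (U.ι ≫ (projSpace F N).hom) := Over.homMk (b.left ≫ (π ∣_ U)) (by
    change (b.left ≫ (π ∣_ U)) ≫ U.ι ≫ _ = _
    rw [← Category.assoc, hbw, Over.w])
  obtain ⟨hw', hpf⟩ := hf.comp_eq (p := p) hbw
  -- Over U the norm ideal of w is the unit ideal and is contained in the ideal of the norm of l. So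
  -- l is a unit, and w and v generate the same L-line.
  have hl : IsUnit l := by
    rw [Q.isUnit_iff, ← Ideal.span_singleton_eq_top, ← top_le_iff, ← hI,
      normIdeal_of_toExt_eq_smul Q h1]
    exact Ideal.mul_le_left (I := Ideal.span {Q.nm l}) (J := normIdeal Q v)
  obtain ⟨m, rfl⟩ := hl
  have h4 : rpt e w hw' = rpt e v hv := (rpt_eq_iff e w v hw' hv).2 ⟨m, h1⟩
  rw [← Category.assoc] at h3
  rw [← he, ← h4, ← hpf] at h3
  have h5 := congrArg (fun k => k.left) h3
  refine Eq.trans ?_ (h5.trans ?_)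
  · exact (Category.assoc _ _ _).symm
  · exact Category.assoc _ _ _

theorem mapA_injective (Q : Quadratic F L) {χ : A →ₐ[F] B} (hχ : Function.Injective χ) :
    Function.Injective (mapA χ : L ⊗[F] A →ₐ[L] L ⊗[F] B) := by
  intro x y h
  rw [Q.ext_iff, reA_mapA, imA_mapA, reA_mapA, imA_mapA] at h
  exact Q.ext_iff.2 ⟨hχ h.1, hχ h.2⟩

/-- Extensions across a Cartier divisor are unique. -/
theorem Extends.unique [Module.Finite F L] [_root_.IsReduced L] (Q : Quadratic F L)
    (hf : IsLineSpanMap e U f) (H : IsInvertibleIdeal ((annIdeal F L N).comap π))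
    {g' : Over.mk (π ≫ (projSpace F N).hom) ⟶ R}
    (hE : Extends f π g) (hE' : Extends f π g') : g' = g := by
  refine over_hom_ext fun t => ?_
  let x : Over.mk (π ≫ (projSpace F N).hom) ⟶ projSpace F N := Over.homMk π
  have hcov : ∀ y : R.left, ∃ φ : Module.Dual L N, y ∈ spanOpens e φ := fun y =>
    TopologicalSpace.Opens.mem_iSup.1 (by rw [iSup_spanOpens e Q]; trivial)
  obtain ⟨φ₁, h₁⟩ := hcov (g.left t)
  obtain ⟨φ₂, h₂⟩ := hcov (g'.left t)
  obtain ⟨C, _, _, c, ψ, w, hw, s, hcO, htc, hcr, -, h3, hs, hI⟩ :=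
    IsInvertibleIdeal.exists_local_point Q (h := x) H (x := t)
      (U := g.left ⁻¹ᵁ spanOpens e φ₁ ⊓ g'.left ⁻¹ᵁ spanOpens e φ₂) ⟨h₁, h₂⟩
  obtain ⟨v₁, hv₁, -, e₁⟩ := exists_rpt_of_range_subset e (φ := φ₁) (c ≫ g) (by
    rw [Over.comp_left]
    rintro _ ⟨z, rfl⟩
    rw [Scheme.Hom.comp_apply]
    exact (hcr ⟨z, rfl⟩).1)
  obtain ⟨v₂, hv₂, -, e₂⟩ := exists_rpt_of_range_subset e (φ := φ₂) (c ≫ g') (by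
    rw [Over.comp_left]
    rintro _ ⟨z, rfl⟩
    rw [Scheme.Hom.comp_apply]
    exact (hcr ⟨z, rfl⟩).2)
  refine ⟨C, _, _, c, hcO, htc, ?_⟩
  -- Inverting the equation s of the divisor is injective and leads into U, where g and g' agree.
  -- The minors of v₂ and v₁ vanish there, hence already over C.
  let χ : C →ₐ[F] Localization.Away s := IsScalarTower.toAlgHom F C (Localization.Away s)
  have hχ : Function.Injective χ := IsLocalization.injective (M := Submonoid.powers s)
    (Localization.Away s) (Submonoid.powers_le.2 hs)
  have hI' : normIdeal Q (mapVec χ w) = ⊤ := by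
    rw [normIdeal_mapVec, hI, Ideal.map_span, Set.image_singleton, Ideal.span_singleton_eq_top]
    exact IsLocalization.Away.algebraMap_isUnit (S := Localization.Away s) s
  have hpt : (specMap χ ≫ c).left ≫ π = (point (mapVec χ w) (hw.map χ)).left := by
    rw [← specMap_comp_point χ w hw, ← h3, Over.comp_left, Category.assoc]
    rfl
  obtain ⟨_, k₁⟩ := hE.exists_comp_eq_rpt Q hf (specMap χ ≫ c) hpt hI'
  obtain ⟨_, k₂⟩ := hE'.exists_comp_eq_rpt Q hf (specMap χ ≫ c) hpt hI'
  rw [Category.assoc, e₁, specMap_comp_rpt] at k₁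
  rw [Category.assoc, e₂, specMap_comp_rpt] at k₂
  obtain ⟨m, hm⟩ := (rpt_eq_iff e _ _ _ _).1 (k₂.trans k₁.symm)
  rw [e₁, e₂]
  refine (rpt_eq_iff e _ _ _ _).2 (exists_unit_smul_of_minors hv₂ hv₁
    fun φ ψ => mapA_injective Q hχ ?_)
  have h4 := fun φ : Module.Dual L N => congrArg (fun z => evalDual z φ) hm
  simp only [toExt_mapVec χ, evalDual_smul] at h4
  rw [map_mul, map_mul]
  have h5 := fun (z) (φ : Module.Dual L N) => evalDual_mapVec (mapA χ : L ⊗[F] C →ₐ[L] _) z φ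
  rw [← h5, ← h5, ← h5, ← h5, h4, h4]
  ring

end

/-! ### Coordinates on the lines inside an L-line -/

section

open Opposite Quadratic

section Vec

variable {F : Type u} [Field F] {A B : Type u} [CommRing A] [Algebra F A] [CommRing B]
  [Algebra F B] {r : ℕ}

theorem evalDual_vec (u : Fin (r + 1) → A) (ψ : Module.Dual F (Fin (r + 1) → F)) :
    evalDual (vec F u) ψ = ∑ i, ψ (Pi.single i 1) • u i := by
  have : vec F u = ∑ i, u i ⊗ₜ[F] (Pi.single i 1 : Fin (r + 1) → F) := by
    rw [vec, LinearEquiv.symm_apply_eq, map_sum]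
    ext j
    simp [Finset.sum_apply, Pi.single_apply]
  have hsum : ∀ (s : Finset (Fin (r + 1))) (g : Fin (r + 1) → A ⊗[F] (Fin (r + 1) → F)),
      evalDual (∑ i ∈ s, g i) ψ = ∑ i ∈ s, evalDual (g i) ψ := by
    intro s g
    classical
    induction s using Finset.induction_on with
    | empty => simp
    | insert a s ha ih => rw [Finset.sum_insert ha, Finset.sum_insert ha, evalDual_add, ih]
  rw [this, hsum]
  simp

theorem evalDual_vec_proj (u : Fin (r + 1) → A) (i : Fin (r + 1)) :
    evalDual (vec F u) (LinearMap.proj i) = u i := by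
  rw [evalDual_vec, Finset.sum_eq_single i]
  · simp
  · intro j _ hj
    simp [hj.symm]
  · simp

theorem unimodular_vec_iff (u : Fin (r + 1) → A) :
    Unimodular (vec F u) ↔ Ideal.span (Set.range u) = ⊤ := by
  have : Ideal.span (Set.range (evalDual (vec F u))) = Ideal.span (Set.range u) := by
    refine le_antisymm (Ideal.span_le.2 ?_) (Ideal.span_mono ?_)
    · rintro _ ⟨ψ, rfl⟩
      rw [evalDual_vec]
      refine Ideal.sum_mem _ fun i _ => ?_
      rw [Algebra.smul_def]
      exact Ideal.mul_mem_left _ _ (Ideal.subset_span ⟨i, rfl⟩)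
    · rintro _ ⟨i, rfl⟩
      exact ⟨_, evalDual_vec_proj u i⟩
  rw [Unimodular, this]

theorem vec_injective : Function.Injective (vec F : (Fin (r + 1) → A) → _) :=
  (TensorProduct.piScalarRight F F A (Fin (r + 1))).symm.injective

theorem vec_surjective : Function.Surjective (vec F : (Fin (r + 1) → A) → _) :=
  (TensorProduct.piScalarRight F F A (Fin (r + 1))).symm.surjective

theorem mapVec_vec (f : A →ₐ[F] B) (u : Fin (r + 1) → A) :
    mapVec f (vec F u) = vec F (fun i => f (u i)) :=
  vec_ext fun ψ => by
    rw [evalDual_mapVec, evalDual_vec, evalDual_vec, map_sum]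
    simp

theorem smul_vec (a : A) (u : Fin (r + 1) → A) : a • vec F u = vec F (fun i => a * u i) :=
  vec_ext fun ψ => by
    rw [evalDual_smul, evalDual_vec, evalDual_vec, Finset.mul_sum]
    simp

end Vec

variable {F L N : Type u} [Field F] [CommRing L] [Algebra F L] [AddCommGroup N] [Module F N]
  [Module L N] [IsScalarTower F L N]
variable {A B : Type u} [CommRing A] [Algebra F A] [CommRing B] [Algebra F B]

namespace Quadratic

variable (Q : Quadratic F L)

/-- The element of `L ⊗ A` with given coordinates. -/
noncomputable def lam (u : Fin (1 + 1) → A) : L ⊗[F] A := scal (u 0) + scal (u 1) * Q.gen A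

theorem reA_lam (u : Fin (1 + 1) → A) : Q.reA (Q.lam u) = u 0 := Q.reA_add_mul_gen _ _

theorem imA_lam (u : Fin (1 + 1) → A) : Q.imA (Q.lam u) = u 1 := Q.imA_add_mul_gen _ _

theorem lam_re_im (x : L ⊗[F] A) : Q.lam ![Q.reA x, Q.imA x] = x := (Q.scal_add x).symm

theorem lam_surjective : Function.Surjective (Q.lam : (Fin (1 + 1) → A) → _) :=
  fun x => ⟨_, Q.lam_re_im x⟩

theorem lam_injective : Function.Injective (Q.lam : (Fin (1 + 1) → A) → _) := by
  intro u u' h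
  have h0 := congrArg Q.reA h
  have h1 := congrArg Q.imA h
  rw [reA_lam, reA_lam] at h0
  rw [imA_lam, imA_lam] at h1
  funext i
  fin_cases i
  · exact h0
  · exact h1

theorem lam_smul (a : A) (u : Fin (1 + 1) → A) : Q.lam (fun i => a * u i) = scal a * Q.lam u := by
  simp only [lam, map_mul]
  ring

theorem mapA_lam (f : A →ₐ[F] B) (u : Fin (1 + 1) → A) :
    mapA f (Q.lam u) = Q.lam (fun i => f (u i)) := by
  rw [Q.ext_iff, reA_mapA, imA_mapA, reA_lam, reA_lam, imA_lam, imA_lam]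
  exact ⟨rfl, rfl⟩

theorem span_range_lam (u : Fin (1 + 1) → A) (I : Ideal A) :
    Q.lam u ∈ I.map (scal : A →ₐ[F] L ⊗[F] A) ↔ Ideal.span (Set.range u) ≤ I := by
  rw [Q.mem_map_iff, reA_lam, imA_lam, Ideal.span_le]
  constructor
  · rintro ⟨h0, h1⟩ _ ⟨i, rfl⟩
    fin_cases i
    · exact h0
    · exact h1
  · intro h
    exact ⟨h ⟨0, rfl⟩, h ⟨1, rfl⟩⟩

end Quadratic

/-- As co v φ = 1, the element `Q.lam u` is the coordinate co w φ. Its traces against L are F-linear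
coordinates of w, so by nondegeneracy the entries of u lie in the coordinate ideal of w. -/
theorem unimodular_of_toExt_eq_lam_smul (Q : Quadratic F L) {v w : A ⊗[F] N} {φ : Module.Dual L N}
    {u : Fin (1 + 1) → A} (hu : Unimodular (vec F u)) (hv : co v φ = 1)
    (h : toExt L w = Q.lam u • toExt L v) : Unimodular w := by
  rw [Unimodular, ← top_le_iff, ← (unimodular_vec_iff u).1 hu, ← Q.span_range_lam]
  have h1 : co w φ = Q.lam u := by
    rw [co, h, evalDual_smul]
    change Q.lam u * co v φ = _
    rw [hv, mul_one]
  rw [← h1]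
  refine Q.mem_map_of_tr_mem fun l => ?_
  have h2 : (l ⊗ₜ[F] (1 : A)) * co w φ = co w (l • φ) := by
    rw [map_smul, Algebra.smul_def]
    rfl
  rw [h2, ← evalDual_trDual]
  exact Ideal.subset_span ⟨_, rfl⟩

theorem unimodular_vec_of_toExt_eq_smul (Q : Quadratic F L) {v w : A ⊗[F] N}
    {u : Fin (1 + 1) → A} (hw : Unimodular w)
    (h : toExt L w = Q.lam u • toExt L v) : Unimodular (vec F u) := by
  rw [unimodular_vec_iff, ← top_le_iff, ← (hw : Ideal.span _ = ⊤), Ideal.span_le]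
  rintro _ ⟨ψ, rfl⟩
  rw [SetLike.mem_coe, evalDual_eq_tr Q, ← Q.scal_mem_map_iff, scal_tr]
  have h1 : co w (dualOfDual Q ψ) ∈
      (Ideal.span (Set.range u)).map (scal : A →ₐ[F] L ⊗[F] A) := by
    rw [co, h, evalDual_smul]
    exact Ideal.mul_mem_right _ _ ((Q.span_range_lam u _).2 le_rfl)
  refine add_mem h1 ?_
  rw [Q.mem_map_iff] at h1 ⊢
  have h2 : Q.conjA (co w (dualOfDual Q ψ)) = scal (Q.reA (co w (dualOfDual Q ψ)) +
      Q.imA (co w (dualOfDual Q ψ)) * algebraMap F A Q.p) +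
        scal (- Q.imA (co w (dualOfDual Q ψ))) * Q.gen A := by
    conv_lhs => rw [Q.scal_add (co w (dualOfDual Q ψ))]
    simp only [map_add, map_mul, conjA_scal, conjA_gen, map_neg]
    ring
  rw [h2, reA_add_mul_gen, imA_add_mul_gen]
  exact ⟨add_mem h1.1 (Ideal.mul_mem_right _ _ h1.2), neg_mem h1.2⟩

end

/-! ### Product charts of the functor of pairs -/

section

open Opposite Quadratic

variable {F L N : Type u} [Field F] [CommRing L] [Algebra F L] [AddCommGroup N] [Module F N]
  [Module L N] [IsScalarTower F L N]
variable {A B : Type u} [CommRing A] [Algebra F A] [CommRing B] [Algebra F B]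
variable [Module.Finite F L]
variable {R : Over (Spec (.of F))} (e : (weilFunctor F L (projSpace L N)).RepresentableBy R)
variable (φ : Module.Dual L N)

/-- The product of a chart of the Weil restriction with a projective line. -/
noncomputable def bundleChart : Over (Spec (.of F)) :=
  Over.mk (pullback.fst ((spanOpens e φ).ι ≫ R.hom) (projSpace F (Fin (1 + 1) → F)).hom ≫
    (spanOpens e φ).ι ≫ R.hom)

/-- The projection of a product chart to the Weil restriction. -/
noncomputable def bundleChartFst : bundleChart e φ ⟶ R :=
  Over.homMk (pullback.fst _ _ ≫ (spanOpens e φ).ι) (Category.assoc _ _ _)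

/-- The projection of a product chart to the projective line. -/
noncomputable def bundleChartSnd : bundleChart e φ ⟶ projSpace F (Fin (1 + 1) → F) :=
  Over.homMk (pullback.snd _ _) pullback.condition.symm

variable {T : Over (Spec (.of F))}

variable {e φ} in
theorem bundleChart_hom_ext {c c' : T ⟶ bundleChart e φ}
    (h : c ≫ bundleChartFst e φ = c' ≫ bundleChartFst e φ)
    (h' : c ≫ bundleChartSnd e φ = c' ≫ bundleChartSnd e φ) : c = c' := by
  ext1
  refine pullback.hom_ext ((cancel_mono (spanOpens e φ).ι).1 ?_) ?_
  · refine (Category.assoc _ _ _).trans (Eq.trans ?_ (Category.assoc _ _ _).symm)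
    exact congrArg (fun k => k.left) h
  · exact congrArg (fun k => k.left) h'

theorem range_comp_bundleChartFst (c : T ⟶ bundleChart e φ) :
    Set.range (c ≫ bundleChartFst e φ).left ⊆ spanOpens e φ := by
  rintro _ ⟨z, rfl⟩
  exact (pullback.fst ((spanOpens e φ).ι ≫ R.hom) (projSpace F (Fin (1 + 1) → F)).hom
    (c.left z)).2

variable {e φ} in
theorem exists_bundleChart_lift {y : T ⟶ R} (hy : Set.range y.left ⊆ spanOpens e φ)
    (k : T ⟶ projSpace F (Fin (1 + 1) → F)) :
    ∃ c : T ⟶ bundleChart e φ, c ≫ bundleChartFst e φ = y ∧ c ≫ bundleChartSnd e φ = k := by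
  have hy' : Set.range y.left ⊆ Set.range (spanOpens e φ).ι := by
    rwa [Scheme.Opens.range_ι]
  have h1 : IsOpenImmersion.lift (spanOpens e φ).ι y.left hy' ≫ (spanOpens e φ).ι = y.left :=
    IsOpenImmersion.lift_fac _ _ _
  have h2 : IsOpenImmersion.lift (spanOpens e φ).ι y.left hy' ≫ (spanOpens e φ).ι ≫ R.hom =
      k.left ≫ (projSpace F (Fin (1 + 1) → F)).hom := by
    rw [reassoc_of% h1, Over.w, Over.w]
  have h3 := pullback.lift_fst _ _ h2
  have h4 := pullback.lift_snd _ _ h2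
  refine ⟨Over.homMk (pullback.lift _ _ h2) ?_, ?_, ?_⟩
  · change pullback.lift _ _ h2 ≫ pullback.fst _ _ ≫ (spanOpens e φ).ι ≫ R.hom = T.hom
    rw [reassoc_of% h3, reassoc_of% h1, Over.w]
  · apply Over.OverMorphism.ext
    change pullback.lift _ _ h2 ≫ pullback.fst _ _ ≫ (spanOpens e φ).ι = y.left
    rw [reassoc_of% h3, h1]
  · exact Over.OverMorphism.ext h4

variable [Module.Free L N] [Module.Finite L N]

/-- Points of a product chart are locally given by vectors. -/
theorem exists_local_bundleChart (c : T ⟶ bundleChart e φ) {U : T.left.Opens} {t : T.left}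
    (ht : t ∈ U) : ∃ (A : Type u) (_ : CommRing A) (_ : Algebra F A) (a : specOver F A ⟶ T)
      (v : A ⊗[F] N) (hv : Unimodular (toExt L v)) (u : Fin (1 + 1) → A)
      (hu : Unimodular (vec F u)), IsOpenImmersion a.left ∧ t ∈ Set.range a.left ∧
      Set.range a.left ⊆ U ∧ co v φ = 1 ∧ a ≫ c ≫ bundleChartFst e φ = rpt e v hv ∧
      a ≫ c ≫ bundleChartSnd e φ = point (vec F u) hu := by
  obtain ⟨A, _, _, a, χ, u, hu, ha, hta, hU, -, h1⟩ :=
    exists_local_point (c ≫ bundleChartSnd e φ) ht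
  obtain ⟨u, rfl⟩ := vec_surjective u
  obtain ⟨v, hv, h2, h3⟩ := exists_rpt_of_range_subset e (φ := φ) (a ≫ c ≫ bundleChartFst e φ) (by
    rw [← Category.assoc]
    exact range_comp_bundleChartFst e φ _)
  exact ⟨A, _, _, a, v, hv, u, hu, ha, hta, hU, h2, h3, h1⟩

variable [Module.Free F N] [Module.Finite F N]

/-- A pair of an L-line and [u] is sent to the line of `Q.lam u` • v, with v the generator
normalized at φ. The normalization fixes v, and scaling u only scales the vector. -/
theorem exists_bundleChartLine (Q : Quadratic F L) : ∃ ξ : bundleChart e φ ⟶ projSpace F N,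
    ∀ (A : Type u) [CommRing A] [Algebra F A] (c : specOver F A ⟶ bundleChart e φ)
      (v : A ⊗[F] N) (hv : Unimodular (toExt L v)) (u : Fin (1 + 1) → A)
      (hu : Unimodular (vec F u)) (w : A ⊗[F] N) (hw : Unimodular w), co v φ = 1 →
      c ≫ bundleChartFst e φ = rpt e v hv → c ≫ bundleChartSnd e φ = point (vec F u) hu →
      toExt L w = Q.lam u • toExt L v → c ≫ ξ = point w hw := by
  obtain ⟨ξ, hξ⟩ := comp_eq_of_local (T := bundleChart e φ) (Y := projSpace F N)
    (fun A _ _ c y => ∃ (v : A ⊗[F] N) (hv : Unimodular (toExt L v)) (u : Fin (1 + 1) → A)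
      (hu : Unimodular (vec F u)) (w : A ⊗[F] N) (hw : Unimodular w), co v φ = 1 ∧
      c ≫ bundleChartFst e φ = rpt e v hv ∧ c ≫ bundleChartSnd e φ = point (vec F u) hu ∧
      toExt L w = Q.lam u • toExt L v ∧ y = point w hw)
    (by
      rintro A B _ _ _ _ f a y ⟨v, hv, u, hu, w, hw, h1, h2, h3, h4, rfl⟩
      have hu' := hu.map f
      refine ⟨mapVec f v, hv.toExt_map f, fun i => f (u i), mapVec_vec f u ▸ hu', mapVec f w,
        hw.map f, ?_, ?_, ?_, ?_, specMap_comp_point f w hw⟩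
      · rw [co_mapVec, h1, map_one]
      · rw [Category.assoc, h2, specMap_comp_rpt]
      · rw [Category.assoc, h3, specMap_comp_point]
        exact point_congr (mapVec_vec f u) _
      · rw [toExt_smul_mapVec h4, mapA_lam])
    (by
      rintro A _ _ a y y' ⟨v, hv, u, hu, w, hw, h1, h2, h3, h4, rfl⟩
        ⟨v', hv', u', hu', w', hw', h1', h2', h3', h4', rfl⟩
      obtain rfl := eq_of_rpt_eq e Q h1 h1' (h2.symm.trans h2')
      obtain ⟨m, hm⟩ := point_eq_iff.1 (h3.symm.trans h3')
      rw [smul_vec] at hm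
      obtain rfl := vec_injective hm
      refine point_eq_iff.2 ⟨m, toExt_injective Q ?_⟩
      rw [h4, lam_smul, toExt_smul, h4', smul_smul])
    (by
      intro x
      obtain ⟨A, _, _, a, v, hv, u, hu, ha, hx, -, h1, h2, h3⟩ :=
        exists_local_bundleChart e φ (𝟙 _) (U := ⊤) (t := x) trivial
      rw [Category.id_comp] at h2 h3
      obtain ⟨w, hw⟩ := toExt_surjective (Q.lam u • toExt L v)
      exact ⟨A, _, _, a, _, ha, hx, v, hv, u, hu, w, unimodular_of_toExt_eq_lam_smul Q hu h1 hw,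
        h1, h2, h3, hw, rfl⟩)
  exact ⟨ξ, fun A _ _ c v hv u hu w hw h1 h2 h3 h4 =>
    hξ A c _ ⟨v, hv, u, hu, w, hw, h1, h2, h3, h4, rfl⟩⟩

/-- The line in `N` given by a point of the projective line and an `L`-line. -/
noncomputable def bundleChartLine (Q : Quadratic F L) : bundleChart e φ ⟶ projSpace F N :=
  (exists_bundleChartLine e φ Q).choose

theorem comp_bundleChartLine (Q : Quadratic F L) {c : specOver F A ⟶ bundleChart e φ}
    {v : A ⊗[F] N} {hv : Unimodular (toExt L v)} {u : Fin (1 + 1) → A}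
    {hu : Unimodular (vec F u)} {w : A ⊗[F] N} (hw : Unimodular w) (h1 : co v φ = 1)
    (h2 : c ≫ bundleChartFst e φ = rpt e v hv)
    (h3 : c ≫ bundleChartSnd e φ = point (vec F u) hu)
    (h4 : toExt L w = Q.lam u • toExt L v) : c ≫ bundleChartLine e φ Q = point w hw :=
  (exists_bundleChartLine e φ Q).choose_spec A c v hv u hu w hw h1 h2 h3 h4

/-- A local form of the points of a product chart. -/
theorem exists_local_bundleChart_line (Q : Quadratic F L) (c : T ⟶ bundleChart e φ)
    {U : T.left.Opens} {t : T.left} (ht : t ∈ U) :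
    ∃ (A : Type u) (_ : CommRing A) (_ : Algebra F A) (a : specOver F A ⟶ T)
      (v : A ⊗[F] N) (hv : Unimodular (toExt L v)) (u : Fin (1 + 1) → A)
      (hu : Unimodular (vec F u)) (w : A ⊗[F] N) (hw : Unimodular w),
      IsOpenImmersion a.left ∧ t ∈ Set.range a.left ∧
      Set.range a.left ⊆ U ∧ co v φ = 1 ∧ a ≫ c ≫ bundleChartFst e φ = rpt e v hv ∧
      a ≫ c ≫ bundleChartSnd e φ = point (vec F u) hu ∧ toExt L w = Q.lam u • toExt L v ∧
      a ≫ c ≫ bundleChartLine e φ Q = point w hw := by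
  obtain ⟨A, _, _, a, v, hv, u, hu, ha, hx, hU, h1, h2, h3⟩ :=
    exists_local_bundleChart e φ c ht
  obtain ⟨w, hw⟩ := toExt_surjective (Q.lam u • toExt L v)
  have hw' := unimodular_of_toExt_eq_lam_smul Q hu h1 hw
  have h4 := comp_bundleChartLine e φ Q (c := a ≫ c) (u := u) (hu := hu) hw' h1
    ((Category.assoc _ _ _).trans h2) ((Category.assoc _ _ _).trans h3) hw
  rw [Category.assoc] at h4
  exact ⟨A, _, _, a, v, hv, u, hu, w, hw', ha, hx, hU, h1, h2, h3, hw, h4⟩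

theorem isSpanPair_bundleChart (Q : Quadratic F L) :
    IsSpanPair e (bundleChartLine e φ Q) (bundleChartFst e φ) := by
  intro t
  obtain ⟨A, _, _, a, v, hv, u, hu, w, hw, ha, hx, -, h1, h2, h3, h4, h5⟩ :=
    exists_local_bundleChart_line e φ Q (𝟙 _) (U := ⊤) (t := t) trivial
  rw [Category.id_comp] at h2 h5
  exact ⟨A, _, _, a, ha, hx, w, hw, v, hv, Q.lam u, h4, h5, h2⟩

variable {e φ} in
-- The φ-coordinate of the vector of the line is `Q.lam u`, so the line determines u up to a unit of
-- A.
theorem bundleChart_hom_ext_line (Q : Quadratic F L) {c c' : T ⟶ bundleChart e φ}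
    (h : c ≫ bundleChartFst e φ = c' ≫ bundleChartFst e φ)
    (h' : c ≫ bundleChartLine e φ Q = c' ≫ bundleChartLine e φ Q) : c = c' := by
  refine over_hom_ext fun t => ?_
  obtain ⟨ψ, hψ⟩ : ∃ ψ : Module.Dual F (Fin (1 + 1) → F),
      (c ≫ bundleChartSnd e φ).left t ∈ nonvanishing ψ :=
    TopologicalSpace.Opens.mem_iSup.1 (by rw [iSup_nonvanishing]; trivial)
  obtain ⟨A, _, _, a, v, hv, u, hu, w, hw, ha, hx, hU, h1, h2, h3, h4, h5⟩ :=
    exists_local_bundleChart_line e φ Q c'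
      (U := (c ≫ bundleChartSnd e φ).left ⁻¹ᵁ nonvanishing ψ) hψ
  refine ⟨A, _, _, a, ha, hx, bundleChart_hom_ext ?_ ?_⟩
  · rw [Category.assoc, Category.assoc, h]
  rw [← h] at h2
  rw [← h'] at h5
  obtain ⟨u', hu', -, h6⟩ := exists_point_of_range_subset (φ := ψ) (a ≫ c ≫ bundleChartSnd e φ) (by
    rw [Over.comp_left]
    rintro _ ⟨z, rfl⟩
    rw [Scheme.Hom.comp_apply]
    exact hU ⟨z, rfl⟩)
  obtain ⟨u', rfl⟩ := vec_surjective u'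
  obtain ⟨w', hw'⟩ := toExt_surjective (Q.lam u' • toExt L v)
  have hw'u := unimodular_of_toExt_eq_lam_smul Q hu' h1 hw'
  have h7 := comp_bundleChartLine e φ Q (c := a ≫ c) (u := u') (hu := hu') hw'u h1
    ((Category.assoc _ _ _).trans h2) ((Category.assoc _ _ _).trans h6) hw'
  rw [Category.assoc, h5, point_eq_iff] at h7
  obtain ⟨m, hm⟩ := h7
  rw [Category.assoc, Category.assoc, h3, h6]
  refine (point_eq_iff.2 ⟨m, ?_⟩).symm
  rw [smul_vec]
  congr 1
  apply Q.lam_injective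
  have h8 := congrArg (fun z => co z φ) hm
  rw [co_smul, co, co, h4, hw', evalDual_smul, evalDual_smul] at h8
  change Q.lam u * co v φ = scal (m : A) * (Q.lam u' * co v φ) at h8
  rw [h1, mul_one, mul_one] at h8
  rw [lam_smul, h8]

variable {e φ} in
-- After normalizing the generator of the L-line at φ, the line is generated by some l v, and the
-- coordinates of l over 1 and θ are the point of ℙ¹.
theorem IsSpanPair.exists_bundleChart (Q : Quadratic F L) {x : T ⟶ projSpace F N} {y : T ⟶ R}
    (h : IsSpanPair e x y) (hy : Set.range y.left ⊆ spanOpens e φ) :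
    ∃ c : T ⟶ bundleChart e φ, c ≫ bundleChartLine e φ Q = x ∧ c ≫ bundleChartFst e φ = y := by
  have hloc : ∀ t : T.left, ∃ (A : Type u) (_ : CommRing A) (_ : Algebra F A)
      (a : specOver F A ⟶ T) (c : specOver F A ⟶ bundleChart e φ), IsOpenImmersion a.left ∧
      t ∈ Set.range a.left ∧ c ≫ bundleChartLine e φ Q = a ≫ x ∧
      c ≫ bundleChartFst e φ = a ≫ y := by
    intro t
    obtain ⟨A, _, _, a, ha, ht, w, hw, v, hv, l, h1, h2, h3⟩ := h t
    have hay : Set.range (a ≫ y).left ⊆ spanOpens e φ := by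
      rw [Over.comp_left]
      rintro _ ⟨z, rfl⟩
      rw [Scheme.Hom.comp_apply]
      exact hy ⟨_, rfl⟩
    obtain ⟨v', hv', h4, h5⟩ := exists_rpt_of_range_subset e _ hay
    obtain ⟨m, hm⟩ := (rpt_eq_iff e _ _ _ _).1 (h3.symm.trans h5)
    rw [hm, smul_smul] at h1
    obtain ⟨u, hu⟩ := Q.lam_surjective (l * (m : L ⊗[F] A))
    rw [← hu] at h1
    have huu := unimodular_vec_of_toExt_eq_smul Q hw h1
    obtain ⟨c, hc1, hc2⟩ := exists_bundleChart_lift hay (point (vec F u) huu)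
    refine ⟨A, _, _, a, c, ha, ht, ?_, hc1⟩
    rw [h2]
    exact comp_bundleChartLine e φ Q hw h4 (hc1.trans h5) hc2 h1
  obtain ⟨c, hc⟩ := exists_hom_of_local (T := T) (Y := bundleChart e φ)
    (fun A _ _ a c => c ≫ bundleChartLine e φ Q = a ≫ x ∧ c ≫ bundleChartFst e φ = a ≫ y)
    (by
      rintro A B _ _ _ _ f a c - - ⟨h1, h2⟩
      exact ⟨by rw [Category.assoc, h1, Category.assoc], by rw [Category.assoc, h2, Category.assoc]⟩)
    (by
      rintro A _ _ a c c' - ⟨h1, h2⟩ ⟨h1', h2'⟩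
      exact bundleChart_hom_ext_line Q (h2.trans h2'.symm) (h1.trans h1'.symm))
    (by
      intro t
      obtain ⟨A, _, _, a, c, ha, ht, hc⟩ := hloc t
      exact ⟨A, _, _, a, c, ha, ht, hc⟩)
  refine ⟨c, over_hom_ext fun t => ?_, over_hom_ext fun t => ?_⟩
  · obtain ⟨A, _, _, a, d, ha, ht, hd⟩ := hloc t
    exact ⟨A, _, _, a, ha, ht, by rw [← Category.assoc, hc A a d ha hd, hd.1]⟩
  · obtain ⟨A, _, _, a, d, ha, ht, hd⟩ := hloc t
    exact ⟨A, _, _, a, ha, ht, by rw [← Category.assoc, hc A a d ha hd, hd.2]⟩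

end

/-! ### The universal pair of a line and an L-line containing it -/

section

open Opposite Quadratic

theorem exists_over_glue {S : Scheme.{u}} {T X : Over S} (𝒰 : Scheme.OpenCover.{u + 1} T.left)
    (y : ∀ j, Over.mk (𝒰.f j ≫ T.hom) ⟶ X)
    (h : ∀ j k (Z : Over S) (a : Z ⟶ Over.mk (𝒰.f j ≫ T.hom)) (b : Z ⟶ Over.mk (𝒰.f k ≫ T.hom)),
      a.left ≫ 𝒰.f j = b.left ≫ 𝒰.f k → a ≫ y j = b ≫ y k) :
    ∃ z : T ⟶ X, ∀ j, (Over.homMk (𝒰.f j) : Over.mk (𝒰.f j ≫ T.hom) ⟶ T) ≫ z = y j := by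
  have hglue : ∀ j k, pullback.fst (𝒰.f j) (𝒰.f k) ≫ (y j).left =
      pullback.snd (𝒰.f j) (𝒰.f k) ≫ (y k).left := by
    intro j k
    have h1 := h j k (Over.mk (pullback.fst (𝒰.f j) (𝒰.f k) ≫ 𝒰.f j ≫ T.hom))
      (Over.homMk (pullback.fst (𝒰.f j) (𝒰.f k)))
      (Over.homMk (pullback.snd (𝒰.f j) (𝒰.f k)) (by
        change pullback.snd (𝒰.f j) (𝒰.f k) ≫ 𝒰.f k ≫ T.hom = _ ≫ 𝒰.f j ≫ T.hom
        rw [← Category.assoc, ← pullback.condition, Category.assoc])) pullback.condition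
    exact congrArg (fun z => z.left) h1
  refine ⟨Over.homMk (𝒰.glueMorphisms (fun j => (y j).left) hglue) ?_, fun j => ?_⟩
  · refine 𝒰.hom_ext _ _ fun j => ?_
    have h1 := 𝒰.ι_glueMorphisms (fun j => (y j).left) hglue j
    have h2 := Over.w (y j)
    refine (Category.assoc _ _ _).symm.trans ((congrArg (· ≫ X.hom) h1).trans h2)
  · exact Over.OverMorphism.ext (𝒰.ι_glueMorphisms (fun j => (y j).left) hglue j)

theorem over_cover_hom_ext {S : Scheme.{u}} {T X : Over S} (𝒰 : Scheme.OpenCover.{u + 1} T.left)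
    {y z : T ⟶ X} (h : ∀ j, (Over.homMk (𝒰.f j) : Over.mk (𝒰.f j ≫ T.hom) ⟶ T) ≫ y =
      Over.homMk (𝒰.f j) ≫ z) : y = z :=
  Over.OverMorphism.ext (𝒰.hom_ext _ _ fun j => congrArg (fun z => z.left) (h j))

theorem isPullback_of_existsUnique {C : Type*} [Category C] {P X Y Z : C} {f : P ⟶ X} {g : P ⟶ Y}
    {h : X ⟶ Z} {k : Y ⟶ Z} (w : f ≫ h = g ≫ k)
    (ex : ∀ (T : C) (a : T ⟶ X) (b : T ⟶ Y), a ≫ h = b ≫ k → ∃ t : T ⟶ P, t ≫ f = a ∧ t ≫ g = b)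
    (uniq : ∀ (T : C) (t t' : T ⟶ P), t ≫ f = t' ≫ f → t ≫ g = t' ≫ g → t = t') :
    IsPullback f g h k := by
  refine ⟨⟨w⟩, ⟨PullbackCone.IsLimit.mk _ (fun s => (ex _ s.fst s.snd s.condition).choose) ?_ ?_ ?_⟩⟩
  · exact fun s => (ex _ s.fst s.snd s.condition).choose_spec.1
  · exact fun s => (ex _ s.fst s.snd s.condition).choose_spec.2
  · intro s m h1 h2
    obtain ⟨h3, h4⟩ := (ex _ s.fst s.snd s.condition).choose_spec
    exact uniq _ _ _ (h1.trans h3.symm) (h2.trans h4.symm)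

variable {F L N : Type u} [Field F] [CommRing L] [Algebra F L] [AddCommGroup N] [Module F N]
  [Module L N] [IsScalarTower F L N]
variable [Module.Finite F L]
variable {R : Over (Spec (.of F))} (e : (weilFunctor F L (projSpace L N)).RepresentableBy R)

/-- The functor of pairs of a line and an `L`-line that contains it. -/
noncomputable def spanPairFunctor : (Over (Spec (.of F)))ᵒᵖ ⥤ Type u where
  obj T := {p : (T.unop ⟶ projSpace F N) × (T.unop ⟶ R) // IsSpanPair e p.1 p.2}
  map f := ↾ fun p => ⟨(f.unop ≫ p.1.1, f.unop ≫ p.1.2), p.2.comp e f.unop⟩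
  map_id T := by
    refine ConcreteCategory.hom_ext _ _ fun x => Subtype.ext (Prod.ext ?_ ?_)
    · exact Category.id_comp _
    · exact Category.id_comp _
  map_comp f g := by
    refine ConcreteCategory.hom_ext _ _ fun x => Subtype.ext (Prod.ext ?_ ?_)
    · exact Category.assoc _ _ _
    · exact Category.assoc _ _ _

variable {e} in
theorem spanPair_map_eq_iff {T T₁ T₂ : Over (Spec (.of F))} (a : T ⟶ T₁) (b : T ⟶ T₂)
    (p : (spanPairFunctor e).obj (op T₁)) (q : (spanPairFunctor e).obj (op T₂)) :
    (spanPairFunctor e).map a.op p = (spanPairFunctor e).map b.op q ↔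
      a ≫ p.1.1 = b ≫ q.1.1 ∧ a ≫ p.1.2 = b ≫ q.1.2 :=
  Subtype.ext_iff.trans Prod.ext_iff

variable {e} in
theorem spanPair_map_eq_iff' {T T₁ : Over (Spec (.of F))} (a : T ⟶ T₁)
    (p : (spanPairFunctor e).obj (op T₁)) (q : (spanPairFunctor e).obj (op T)) :
    (spanPairFunctor e).map a.op p = q ↔ a ≫ p.1.1 = q.1.1 ∧ a ≫ p.1.2 = q.1.2 :=
  Subtype.ext_iff.trans Prod.ext_iff

theorem isZariskiSheaf_spanPairFunctor : IsZariskiSheaf (spanPairFunctor e) := by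
  intro T 𝒰 x hx
  replace hx := fun j k Z a b h => (spanPair_map_eq_iff (e := e) _ _ _ _).1 (hx j k Z a b h)
  obtain ⟨y, hy⟩ := exists_over_glue 𝒰 (fun j => (x j).1.1) fun j k Z a b h => (hx j k Z a b h).1
  obtain ⟨z, hz⟩ := exists_over_glue 𝒰 (fun j => (x j).1.2) fun j k Z a b h => (hx j k Z a b h).2
  refine ⟨⟨(y, z), IsSpanPair.of_local e fun t => ?_⟩, fun j => ?_, fun p hp => ?_⟩
  · obtain ⟨s, hs⟩ := 𝒰.covers t
    refine ⟨_, (Over.homMk (𝒰.f (𝒰.idx t)) : Over.mk (𝒰.f (𝒰.idx t) ≫ T.hom) ⟶ T), ?_,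
      ⟨s, hs⟩, ?_⟩
    · exact 𝒰.map_prop _
    · rw [hy, hz]
      exact (x _).2
  · exact (spanPair_map_eq_iff' _ _ _).2 ⟨hy j, hz j⟩
  · replace hp := fun j => (spanPair_map_eq_iff' _ _ _).1 (hp j)
    refine Subtype.ext (Prod.ext ?_ ?_)
    · exact over_cover_hom_ext 𝒰 fun j => (hp j).1.trans (hy j).symm
    · exact over_cover_hom_ext 𝒰 fun j => (hp j).2.trans (hz j).symm

variable [Module.Free L N] [Module.Finite L N] [Module.Free F N] [Module.Finite F N]

/-- A pair comes from the product chart of φ exactly where its L-line lies in the chart of φ; this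
condition is open and involves the L-line only. -/
theorem isRepresentable_spanPairFunctor (Q : Quadratic F L) :
    (spanPairFunctor e).IsRepresentable := by
  refine isRepresentable_of_charts _ (isZariskiSheaf_spanPairFunctor e)
    (fun φ : ULift.{u} (Module.Dual L N) => bundleChart e φ.down)
    (fun φ => ⟨(bundleChartLine e φ.down Q, bundleChartFst e φ.down),
      isSpanPair_bundleChart e φ.down Q⟩) ?_ ?_ ?_
  · intro φ T a b h
    obtain ⟨h1, h2⟩ := (spanPair_map_eq_iff _ _ _ _).1 h
    exact bundleChart_hom_ext_line Q h2 h1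
  · intro φ T p
    refine ⟨p.1.2.left ⁻¹ᵁ spanOpens e φ.down, fun T' a => ⟨?_, fun h => ?_⟩⟩
    · rintro ⟨b, hb⟩
      have h1 := range_comp_bundleChartFst e φ.down b
      rw [((spanPair_map_eq_iff _ _ _ _).1 hb).2] at h1
      rintro _ ⟨z, rfl⟩
      exact h1 ⟨z, Scheme.Hom.comp_apply _ _ _⟩
    · obtain ⟨c, hc⟩ := (p.2.comp e a).exists_bundleChart Q (φ := φ.down) (by
        rintro _ ⟨z, rfl⟩
        rw [Over.comp_left, Scheme.Hom.comp_apply]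
        exact h ⟨z, rfl⟩)
      exact ⟨c, (spanPair_map_eq_iff _ _ _ _).2 hc⟩
  · intro T p t
    obtain ⟨φ, hφ⟩ : ∃ φ : Module.Dual L N, p.1.2.left t ∈ spanOpens e φ :=
      TopologicalSpace.Opens.mem_iSup.1 (by rw [iSup_spanOpens e Q]; trivial)
    let U := p.1.2.left ⁻¹ᵁ spanOpens e φ
    let a : Over.mk (U.ι ≫ T.hom) ⟶ T := Over.homMk U.ι
    obtain ⟨c, hc⟩ := (p.2.comp e a).exists_bundleChart Q (φ := φ) (by
      rintro _ ⟨z, rfl⟩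
      rw [Over.comp_left, Scheme.Hom.comp_apply]
      exact z.2)
    refine ⟨⟨φ⟩, _, a, inferInstanceAs (IsOpenImmersion U.ι), ?_, c,
      (spanPair_map_eq_iff _ _ _ _).2 hc⟩
    change t ∈ Set.range U.ι
    rw [Scheme.Opens.range_ι]
    exact hφ

/-- A universal pair of a line and an `L`-line that contains it. -/
structure IsUniversalSpanPair {B : Over (Spec (.of F))} (x : B ⟶ projSpace F N) (y : B ⟶ R) :
    Prop where
  isSpanPair : IsSpanPair e x y
  existsUnique : ∀ {T : Over (Spec (.of F))} (x' : T ⟶ projSpace F N) (y' : T ⟶ R),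
    IsSpanPair e x' y' → ∃! t : T ⟶ B, t ≫ x = x' ∧ t ≫ y = y'

theorem exists_isUniversalSpanPair (Q : Quadratic F L) :
    ∃ (B : Over (Spec (.of F))) (x : B ⟶ projSpace F N) (y : B ⟶ R),
      IsUniversalSpanPair e x y := by
  obtain ⟨B, ⟨r⟩⟩ := isRepresentable_spanPairFunctor e Q
  refine ⟨B, (r.homEquiv (𝟙 B)).1.1, (r.homEquiv (𝟙 B)).1.2, (r.homEquiv (𝟙 B)).2, ?_⟩
  intro T x' y' h
  have hr : ∀ t : T ⟶ B, r.homEquiv t = ⟨(x', y'), h⟩ ↔ t ≫ (r.homEquiv (𝟙 B)).1.1 = x' ∧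
      t ≫ (r.homEquiv (𝟙 B)).1.2 = y' := fun t => by
    rw [r.homEquiv_eq t]
    exact spanPair_map_eq_iff' _ _ _
  obtain ⟨t, ht⟩ := r.homEquiv.surjective (⟨(x', y'), h⟩ : (spanPairFunctor e).obj (op T))
  refine ⟨t, (hr t).1 ht, fun t' ht' => r.homEquiv.injective ?_⟩
  exact ((hr t').2 ht').trans ht.symm

variable {e}
variable {B : Over (Spec (.of F))} {x : B ⟶ projSpace F N} {y : B ⟶ R}

theorem IsUniversalSpanPair.hom_ext (hB : IsUniversalSpanPair e x y) {T : Over (Spec (.of F))}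
    {t t' : T ⟶ B} (hx : t ≫ x = t' ≫ x) (hy : t ≫ y = t' ≫ y) : t = t' :=
  (hB.existsUnique _ _ (hB.isSpanPair.comp e t')).unique ⟨hx, hy⟩ ⟨rfl, rfl⟩

/-- Morphisms to B with L-line in the chart of φ are pairs of this kind, that is, morphisms to the
product chart; so the product chart is the preimage of the chart. -/
theorem IsUniversalSpanPair.exists_chart (hB : IsUniversalSpanPair e x y) (Q : Quadratic F L)
    (φ : Module.Dual L N) : ∃ t : bundleChart e φ ⟶ B,
      t ≫ x = bundleChartLine e φ Q ∧ t ≫ y = bundleChartFst e φ ∧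
      IsPullback t.left (pullback.fst ((spanOpens e φ).ι ≫ R.hom)
        (projSpace F (Fin (1 + 1) → F)).hom) y.left (spanOpens e φ).ι := by
  obtain ⟨t, ⟨h1, h2⟩, -⟩ := hB.existsUnique _ _ (isSpanPair_bundleChart e φ Q)
  have hc : t.left ≫ y.left = pullback.fst ((spanOpens e φ).ι ≫ R.hom)
        (projSpace F (Fin (1 + 1) → F)).hom ≫ (spanOpens e φ).ι := congrArg (fun z => z.left) h2
  refine ⟨t, h1, h2, isPullback_of_existsUnique hc ?_ ?_⟩
  · intro Z a b hab
    have h3 : Set.range (Over.homMk a : Over.mk (a ≫ B.hom) ⟶ B).left ⊆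
        y.left ⁻¹ᵁ spanOpens e φ := by
      rintro _ ⟨z, rfl⟩
      change y.left (a z) ∈ spanOpens e φ
      rw [← Scheme.Hom.comp_apply, hab, Scheme.Hom.comp_apply]
      exact (b z).2
    obtain ⟨c, hcx, hcy⟩ := (hB.isSpanPair.comp e
      (Over.homMk a : Over.mk (a ≫ B.hom) ⟶ B)).exists_bundleChart Q (φ := φ) (by
        rintro _ ⟨z, rfl⟩
        rw [Over.comp_left, Scheme.Hom.comp_apply]
        exact h3 ⟨z, rfl⟩)
    have h4 : c ≫ t = (Over.homMk a : Over.mk (a ≫ B.hom) ⟶ B) :=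
      hB.hom_ext (by rw [Category.assoc, h1, hcx]) (by rw [Category.assoc, h2, hcy])
    refine ⟨c.left, congrArg (fun z => z.left) h4, ?_⟩
    refine (cancel_mono (spanOpens e φ).ι).1 (Eq.trans (Category.assoc _ _ _) (Eq.trans ?_ hab))
    exact congrArg (fun z => z.left) hcy
  · intro Z c c' ha hb
    have ha' : c' ≫ (bundleChart e φ).hom = c ≫ (bundleChart e φ).hom := by
      rw [← Over.w t, reassoc_of% ha]
    have h3 := bundleChart_hom_ext_line Q (c := (Over.homMk c : Over.mk (c ≫ _) ⟶ bundleChart e φ))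
      (c' := Over.homMk c' ha')
      (Over.OverMorphism.ext ((Category.assoc _ _ _).symm.trans
        ((congrArg (· ≫ (spanOpens e φ).ι) hb).trans (Category.assoc _ _ _))))
      (Over.OverMorphism.ext (by
        rw [← h1]
        change c ≫ t.left ≫ x.left = c' ≫ t.left ≫ x.left
        rw [reassoc_of% ha]))
    exact congrArg (fun z => z.left) h3

end

/-! ### The universal pair is the blow-up -/

section

open Opposite Quadratic

variable {F L N : Type u} [Field F] [CommRing L] [Algebra F L]

/-- A nonempty chart of the projective line is integral, and the norm form does not vanish
identically, having value 1 at (1, 0). For ψ = 0 the chart ring is zero. -/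
theorem nm_lam_mem_nonZeroDivisors_awayRing (Q : Quadratic F L) {ψ : Module.Dual F (Fin (1 + 1) → F)}
    {u : Fin (1 + 1) → AwayRing ψ} (hu : univVec ψ = vec F u) :
    Q.nm (Q.lam u) ∈ nonZeroDivisors (AwayRing ψ) := by
  by_cases hψ : ψ = 0
  · subst hψ
    have := subsingleton_awayRing_zero (F := F) (M := Fin (1 + 1) → F)
    rw [Subsingleton.elim (Q.nm (Q.lam u)) 1]
    exact one_mem _
  obtain ⟨K, _, _, v, v', χ, c, hinj, hv', hvι, hχ, hc, h⟩ := exists_generic_chart hψ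
  have := hχ.isDomain χ.toRingHom
  refine mem_nonZeroDivisors_of_ne_zero fun h0 => ?_
  obtain ⟨u', rfl⟩ := vec_surjective v'
  rw [hu, ← hv', mapVec_vec, mapVec_vec, smul_vec] at h
  have h1 : Q.nm (Q.lam fun i => χ (u i)) = 0 := by
    rw [← mapA_lam, nm_mapA, h0, map_zero]
  rw [vec_injective h, lam_smul, nm_mul, nm_scal, ← mapA_lam, nm_mapA, mul_eq_zero,
    map_eq_zero_iff _ hinj] at h1
  have h2 := mapVec_evalSym_of_evalDual_eq_ι hvι (vec F ![(1 : F), 0])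
  rw [mapVec_vec] at h2
  have h3 : Q.nm (Q.lam ![(1 : F), 0]) = 0 := by
    rw [← vec_injective h2, ← mapA_lam, nm_mapA, h1.resolve_left (mul_ne_zero hc hc), map_zero]
  have h4 : Q.lam ![(1 : F), 0] = 1 := by
    simp [lam, Algebra.TensorProduct.one_def]
  rw [h4, nm_one] at h3
  exact one_ne_zero h3

variable [AddCommGroup N] [Module F N] [Module L N] [IsScalarTower F L N]
variable {A B : Type u} [CommRing A] [Algebra F A] [CommRing B] [Algebra F B]
variable [Module.Free L N] [Module.Finite L N] [Module.Free F N] [Module.Finite F N]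
variable [_root_.IsReduced L]

theorem isInvertibleIdeal_comap_annIdeal_of_local (Q : Quadratic F L) {T : Over (Spec (.of F))}
    (h : T ⟶ projSpace F N)
    (H : ∀ x : T.left, ∃ (A : Type u) (_ : CommRing A) (_ : Algebra F A) (a : specOver F A ⟶ T)
      (w : A ⊗[F] N) (hw : Unimodular w) (s : A), IsOpenImmersion a.left ∧
      x ∈ Set.range a.left ∧ a ≫ h = point w hw ∧ s ∈ nonZeroDivisors A ∧
      normIdeal Q w = Ideal.span {s}) : IsInvertibleIdeal ((annIdeal F L N).comap h.left) := by
  refine isInvertibleIdeal_comap_annIdeal Q h fun x => ?_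
  obtain ⟨A, _, _, a, w, hw, s, ha, ⟨x, rfl⟩, h1, hs, h2⟩ := H x
  obtain ⟨B, _, _, b, ψ, v, hv, hb, ⟨z, rfl⟩, -, h3, h4⟩ :=
    exists_local_point (a ≫ h) (U := ⊤) (x := x) trivial
  obtain ⟨f, rfl⟩ := exists_specMap_eq b
  rw [h1, specMap_comp_point f, point_eq_iff] at h4
  obtain ⟨m, hm⟩ := h4
  refine ⟨B, _, _, specMap f ≫ a, ψ, v, hv, f s, ?_, ⟨z, ?_⟩, h3, ?_, ?_, ?_⟩
  · rw [Over.comp_left]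
    infer_instance
  · rw [Over.comp_left, Scheme.Hom.comp_apply]
  · rw [Category.assoc, h1, specMap_comp_point f, point_eq_iff]
    exact ⟨m, hm⟩
  · have : IsOpenImmersion (Spec.map (CommRingCat.ofHom f.toRingHom)) := hb
    exact mem_nonZeroDivisors_of_isOpenImmersion (f := f.toRingHom) hs
  · rw [← normIdeal_smul_unit Q m v, ← hm, normIdeal_mapVec, h2, Ideal.map_span,
      Set.image_singleton]
    rfl

variable [Module.Finite F L]
variable {R : Over (Spec (.of F))} {e : (weilFunctor F L (projSpace L N)).RepresentableBy R}
variable {φ : Module.Dual L N}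

instance : Flat (bundleChartSnd e φ).left :=
  inferInstanceAs (Flat (pullback.snd _ _))

theorem nm_lam_mem_nonZeroDivisors (Q : Quadratic F L) (b : specOver F A ⟶ bundleChart e φ)
    [IsOpenImmersion b.left] {u : Fin (1 + 1) → A} {hu : Unimodular (vec F u)}
    {ψ : Module.Dual F (Fin (1 + 1) → F)} (h : evalDual (vec F u) ψ = 1)
    (hb : b ≫ bundleChartSnd e φ = point (vec F u) hu) : Q.nm (Q.lam u) ∈ nonZeroDivisors A := by
  obtain ⟨χ, hχ⟩ := exists_mapVec_univVec (vec F u) h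
  obtain ⟨u₀, hu₀⟩ := vec_surjective (univVec ψ)
  have h1 : (b ≫ bundleChartSnd e φ).left = (specMap χ).left ≫ (chart ψ).left := by
    rw [hb, chart_eq_point, ← Over.comp_left, specMap_comp_point]
    exact congrArg (fun z => z.left) (point_congr hχ.symm hu)
  have h2 : Flat ((specMap χ).left ≫ (chart ψ).left) := by
    rw [← h1, Over.comp_left]
    infer_instance
  -- The product chart is flat over the projective line, as a base change of a scheme over a field.
  -- The chart of the line is a monomorphism, so the factorization through it is flat and preserves
  -- nonzerodivisors.
  have h3 : Flat (Spec.map (CommRingCat.ofHom χ.toRingHom)) :=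
    MorphismProperty.IsStableUnderBaseChange.hasOfPostcompProperty_monomorphisms
      (P := @Flat) |>.of_postcomp _ (chart ψ).left (inferInstanceAs (Mono (chart ψ).left)) h2
  have h4 := mem_nonZeroDivisors_of_flat (Flat.SpecMap_iff.1 h3) (nm_lam_mem_nonZeroDivisors_awayRing Q hu₀.symm)
  rw [← hu₀, mapVec_vec] at hχ
  obtain rfl := vec_injective hχ
  rw [← mapA_lam, nm_mapA]
  exact h4

/-- The vector `Q.lam u` • v has the norm of `Q.lam u` as generator of its norm ideal, since v
generates an L-line. -/
theorem isInvertibleIdeal_bundleChartLine (Q : Quadratic F L) :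
    IsInvertibleIdeal ((annIdeal F L N).comap (bundleChartLine e φ Q).left) := by
  refine isInvertibleIdeal_comap_annIdeal_of_local Q _ fun t => ?_
  obtain ⟨A, _, _, a, ψ, u, hu, ha, hta, -, h0, h1⟩ :=
    exists_local_point (bundleChartSnd e φ) (U := ⊤) (x := t) trivial
  obtain ⟨u, rfl⟩ := vec_surjective u
  obtain ⟨v, hv, h2, h3⟩ := exists_rpt_of_range_subset e (φ := φ) (a ≫ bundleChartFst e φ)
    (range_comp_bundleChartFst e φ _)
  obtain ⟨w, hw⟩ := toExt_surjective (Q.lam u • toExt L v)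
  have hw' := unimodular_of_toExt_eq_lam_smul Q hu h2 hw
  refine ⟨A, _, _, a, w, hw', Q.nm (Q.lam u), ha, hta,
    comp_bundleChartLine e φ Q hw' h2 h3 h1 hw, nm_lam_mem_nonZeroDivisors Q a h0 h1, ?_⟩
  rw [normIdeal_of_toExt_eq_smul Q hw, normIdeal_eq_top_of_unimodular Q hv, Ideal.mul_top]

theorem isInvertibleIdeal_of_forall_comap {X : Scheme.{u}} {I : X.IdealSheafData}
    (h : ∀ x : X, ∃ (V : Scheme.{u}) (a : V ⟶ X), IsOpenImmersion a ∧ x ∈ Set.range a ∧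
      IsInvertibleIdeal (I.comap a)) : IsInvertibleIdeal I := by
  refine isInvertibleIdeal_of_local fun x => ?_
  obtain ⟨V, a, ha, ⟨z, rfl⟩, hI⟩ := h x
  obtain ⟨A, _, b, s, hb, ⟨p, rfl⟩, hs, h1⟩ := hI.exists_local z
  refine ⟨A, _, b ≫ a, s, inferInstance, ⟨p, Scheme.Hom.comp_apply _ _ _⟩, hs, ?_⟩
  rw [Scheme.IdealSheafData.comap_comp]
  exact h1

variable {B : Over (Spec (.of F))} {x : B ⟶ projSpace F N} {y : B ⟶ R}

theorem IsUniversalSpanPair.isInvertibleIdeal (hB : IsUniversalSpanPair e x y)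
    (Q : Quadratic F L) : IsInvertibleIdeal ((annIdeal F L N).comap x.left) := by
  refine isInvertibleIdeal_of_forall_comap fun b => ?_
  obtain ⟨φ, hφ⟩ : ∃ φ : Module.Dual L N, y.left b ∈ spanOpens e φ :=
    TopologicalSpace.Opens.mem_iSup.1 (by rw [iSup_spanOpens e Q]; trivial)
  obtain ⟨t, h1, h2, h3⟩ := hB.exists_chart Q φ
  refine ⟨_, t.left, MorphismProperty.of_isPullback (P := @IsOpenImmersion) h3.flip
    inferInstance, ?_, ?_⟩
  · obtain ⟨z, hz, -⟩ := Scheme.exists_preimage_of_isPullback h3 b ⟨_, hφ⟩ rfl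
    exact ⟨z, hz⟩
  · rw [← Scheme.IdealSheafData.comap_comp, ← Over.comp_left, h1]
    exact isInvertibleIdeal_bundleChartLine Q

/-- The universal pair of a line and an `L`-line that contains it is the blow-up of the
degeneracy locus. -/
theorem IsUniversalSpanPair.isBlowup (hB : IsUniversalSpanPair e x y)
    (Q : Quadratic F L) : IsBlowup (annIdeal F L N) x.left := by
  refine ⟨hB.isInvertibleIdeal Q, fun T h hT => ?_⟩
  let x' : Over.mk (h ≫ (projSpace F N).hom) ⟶ projSpace F N := Over.homMk h
  -- Once S(N) is Cartier on T, the L-line is determined by the line. So morphisms to B over the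
  -- projective space are the same as pairs, of which there is exactly one.
  obtain ⟨y', hy', huniq⟩ := existsUnique_isSpanPair e Q (x := x') hT
  obtain ⟨t, ⟨h1, h2⟩, -⟩ := hB.existsUnique x' y' hy'
  refine ⟨t.left, congrArg (fun z => z.left) h1, fun t' ht' => ?_⟩
  let s : Over.mk (h ≫ (projSpace F N).hom) ⟶ B := Over.homMk t' (by
    rw [← Over.w x, reassoc_of% ht']
    rfl)
  have h3 : s ≫ x = x' := Over.OverMorphism.ext ht'
  have h4 : s ≫ y = y' := huniq _ (by
    have := hB.isSpanPair.comp e s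
    rwa [h3] at this)
  exact congrArg (fun z => z.left) (hB.hom_ext (t := s) (t' := t) (h3.trans h1.symm)
    (h4.trans h2.symm))

end

/-! ### Transition matrices of the bundle -/

section

open Opposite Quadratic

section Functions

variable {Y : Scheme.{u}} {A B : Type u} [CommRing A] [CommRing B]

theorem pullFun_homOfLE {V W : Y.Opens} (h : V ≤ W) (s : Spec (.of A) ⟶ V.toScheme) (x : Γ(Y, W)) :
    pullFun s (Y.presheaf.map (homOfLE h).op x) = pullFun (s ≫ Y.homOfLE h) x := by
  have h1 : Y.presheaf.map (homOfLE h).op ≫ V.topIso.inv =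
      W.topIso.inv ≫ (Y.homOfLE h).appTop := by
    rw [Scheme.homOfLE_appTop]
    change Y.presheaf.map _ ≫ Y.presheaf.map _ = Y.presheaf.map _ ≫ Y.presheaf.map _
    exact (Y.presheaf.map_comp _ _).symm.trans (Eq.trans
      (congrArg Y.presheaf.map (Subsingleton.elim _ _)) (Y.presheaf.map_comp _ _))
  have h2 : Y.presheaf.map (homOfLE h).op ≫ V.topIso.inv ≫ s.appTop ≫
      (Scheme.ΓSpecIso (.of A)).hom =
        W.topIso.inv ≫ (s ≫ Y.homOfLE h).appTop ≫ (Scheme.ΓSpecIso (.of A)).hom := by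
    rw [Scheme.Hom.comp_appTop, reassoc_of% h1, Category.assoc]
  exact congrArg (fun z => z.hom x) h2

theorem pullFun_ext {V : Y.Opens} {x x' : Γ(Y, V)} (h : ∀ (A : Type u) [CommRing A]
    (s : Spec (.of A) ⟶ V.toScheme), pullFun s x = pullFun s x') : x = x' := by
  have h1 : V.topIso.inv.hom x = V.topIso.inv.hom x' := by
    refine V.toScheme.affineOpenCover.openCover.ext_elem _ _ fun i => ?_
    have h2 := h (V.toScheme.affineOpenCover.X i) (V.toScheme.affineOpenCover.f i)
    exact (ConcreteCategory.bijective_of_isIso (Scheme.ΓSpecIso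
      (.of (V.toScheme.affineOpenCover.X i))).hom).1 h2
  exact (ConcreteCategory.bijective_of_isIso V.topIso.inv).1 h1

/-- The function on `V` induced by a morphism to an affine scheme. -/
noncomputable def funOfHom {V : Y.Opens} (k : V.toScheme ⟶ Spec (.of B)) : B →+* Γ(Y, V) :=
  ((Scheme.ΓSpecIso (.of B)).inv ≫ k.appTop ≫ V.topIso.hom).hom

theorem pullFun_funOfHom {V : Y.Opens} (k : V.toScheme ⟶ Spec (.of B)) (s : Spec (.of A) ⟶ V.toScheme)
    (f : B →+* A) (h : s ≫ k = Spec.map (CommRingCat.ofHom f)) (b : B) :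
    pullFun s (funOfHom k b) = f b := by
  have h1 : ((Scheme.ΓSpecIso (.of B)).inv ≫ k.appTop ≫ V.topIso.hom) ≫ V.topIso.inv ≫ s.appTop ≫
      (Scheme.ΓSpecIso (.of A)).hom = CommRingCat.ofHom f := by
    rw [Category.assoc, Category.assoc, Iso.hom_inv_id_assoc, ← Scheme.Hom.comp_appTop_assoc, h,
      Iso.inv_comp_eq]
    exact Scheme.ΓSpecIso_naturality (CommRingCat.ofHom f)
  exact congrArg (fun z => z.hom b) h1

end Functions

variable {F L N : Type u} [Field F] [CommRing L] [Algebra F L]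
variable {A B : Type u} [CommRing A] [Algebra F A] [CommRing B] [Algebra F B]

namespace Quadratic

/-- The matrix of the multiplication by an element of `L ⊗ A`. -/
noncomputable def mulMatrix (Q : Quadratic F L) (c : L ⊗[F] A) :
    Matrix (Fin (1 + 1)) (Fin (1 + 1)) A :=
  Matrix.of fun i j => ![![Q.reA c, Q.reA (c * Q.gen A)], ![Q.imA c, Q.imA (c * Q.gen A)]] i j

variable (Q : Quadratic F L)

theorem lam_mulMatrix_mulVec (c : L ⊗[F] A) (u : Fin (1 + 1) → A) :
    Q.lam ((Q.mulMatrix c).mulVec u) = c * Q.lam u := by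
  have h : c * Q.lam u = scal (u 0) * c + scal (u 1) * (c * Q.gen A) := by
    rw [lam]; ring
  rw [h, Q.ext_iff, reA_lam, imA_lam, map_add, map_add, reA_scal_mul, reA_scal_mul, imA_scal_mul,
    imA_scal_mul, Matrix.mulVec, Matrix.mulVec, dotProduct, dotProduct]
  change ∑ i : Fin 2, _ = _ ∧ ∑ i : Fin 2, _ = _
  rw [Fin.sum_univ_two, Fin.sum_univ_two]
  exact ⟨by rw [mul_comm (u 0), mul_comm (u 1)]; rfl, by rw [mul_comm (u 0), mul_comm (u 1)]; rfl⟩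

theorem mulMatrix_map (f : A →ₐ[F] B) (c : L ⊗[F] A) :
    (Q.mulMatrix c).map f = Q.mulMatrix (mapA f c) := by
  have h : mapA f c * Q.gen B = mapA f (c * Q.gen A) := by
    rw [map_mul]
    congr 1
    simp [gen, mapA]
  ext i j
  fin_cases i <;> fin_cases j <;> simp [mulMatrix, h, ← reA_mapA, ← imA_mapA, -map_mul]

theorem mulMatrix_mul (c d : L ⊗[F] A) :
    Q.mulMatrix (c * d) = Q.mulMatrix c * Q.mulMatrix d := by
  refine Matrix.ext_of_mulVec_single fun i => Q.lam_injective ?_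
  rw [← Matrix.mulVec_mulVec, lam_mulMatrix_mulVec, lam_mulMatrix_mulVec, lam_mulMatrix_mulVec,
    mul_assoc]

theorem mulMatrix_one : Q.mulMatrix (1 : L ⊗[F] A) = 1 := by
  refine Matrix.ext_of_mulVec_single fun i => Q.lam_injective ?_
  rw [lam_mulMatrix_mulVec, one_mul, Matrix.one_mulVec]

end Quadratic

variable [AddCommGroup N] [Module F N] [Module L N] [IsScalarTower F L N]
variable [Module.Free L N] [Module.Finite L N] [Module.Free F N] [Module.Finite F N]
variable [Module.Finite F L]
variable {R : Over (Spec (.of F))} (e : (weilFunctor F L (projSpace L N)).RepresentableBy R)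

/-- The generator normalized at φ' is pulled back from a universal one over an affine scheme. So
multiplication by its φ-coordinate is a matrix of functions on V, with the expected value at every
point. -/
theorem exists_transition (Q : Quadratic F L) (φ φ' : Module.Dual L N) {V : R.left.Opens}
    (hV : V ≤ spanOpens e φ') : ∃ g : Matrix (Fin (1 + 1)) (Fin (1 + 1)) Γ(R.left, V),
      ∀ (A : Type u) [CommRing A] [Algebra F A] (s : Spec (.of A) ⟶ V.toScheme) (v : A ⊗[F] N)
        (hv : Unimodular (toExt L v)), co v φ' = 1 → s ≫ V.ι = (rpt e v hv).left →
        g.map (pullFun s) = Q.mulMatrix (co v φ) := by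
  obtain ⟨B, _, _, v₀, hv₀, huniv, hinj⟩ := exists_universal_normalized_co Q φ'
  obtain ⟨k, hk⟩ := comp_eq_of_local (T := Over.mk (V.ι ≫ R.hom)) (Y := specOver F B)
    (fun A _ _ a y => ∃ (v : A ⊗[F] N) (hv : Unimodular (toExt L v)) (χ : B →ₐ[F] A),
      co v φ' = 1 ∧ a ≫ (Over.homMk V.ι : Over.mk (V.ι ≫ R.hom) ⟶ R) = rpt e v hv ∧
      mapVec χ v₀ = v ∧ y = specMap χ)
    (by
      rintro A A' _ _ _ _ f a y ⟨v, hv, χ, h1, h2, h3, rfl⟩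
      refine ⟨mapVec f v, hv.toExt_map f, f.comp χ, ?_, ?_, ?_, ?_⟩
      · rw [co_mapVec, h1, map_one]
      · rw [Category.assoc, h2, specMap_comp_rpt]
      · rw [← h3]
        exact vec_ext fun ψ => by simp only [evalDual_mapVec, AlgHom.comp_apply]
      · exact Over.OverMorphism.ext (Spec.map_comp (CommRingCat.ofHom χ.toRingHom)
          (CommRingCat.ofHom f.toRingHom)).symm)
    (by
      rintro A _ _ a y y' ⟨v, hv, χ, h1, h2, h3, rfl⟩ ⟨v', hv', χ', h1', h2', h3', rfl⟩
      obtain rfl := eq_of_rpt_eq e Q h1 h1' (h2.symm.trans h2')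
      rw [hinj _ χ χ' (h3.trans h3'.symm)])
    (by
      intro t
      obtain ⟨A, _, _, a, ha, ht, -⟩ := exists_affine_nhd (Over.mk (V.ι ≫ R.hom)) (U := ⊤) (x := t)
        trivial
      obtain ⟨v, hv, h1, h2⟩ := exists_rpt_of_range_subset e (φ := φ')
        (a ≫ (Over.homMk V.ι : Over.mk (V.ι ≫ R.hom) ⟶ R)) (by
          rintro _ ⟨z, rfl⟩
          exact hV (a.left z).2)
      obtain ⟨χ, hχ⟩ := huniv A v h1
      exact ⟨A, _, _, a, _, ha, ht, v, hv, χ, h1, h2, hχ, rfl⟩)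
  refine ⟨(Q.mulMatrix (co v₀ φ)).map (funOfHom k.left), fun A _ _ s v hv h1 h2 => ?_⟩
  obtain ⟨χ, rfl⟩ := huniv A v h1
  let a : specOver F A ⟶ Over.mk (V.ι ≫ R.hom) := Over.homMk s (by
    change s ≫ V.ι ≫ R.hom = _
    rw [reassoc_of% h2]
    exact Over.w (rpt e _ hv))
  have h3 := congrArg (fun z => z.left) (hk A a (specMap χ) ⟨_, hv, χ, h1, Over.OverMorphism.ext h2, rfl, rfl⟩)
  rw [co_mapVec, ← mulMatrix_map, Matrix.map_map]
  congr 1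
  funext b
  exact pullFun_funOfHom k.left s χ.toRingHom h3 b


theorem exists_algebra_of_hom {Y : Over (Spec (.of F))} {A : Type u} [CommRing A]
    (s : Spec (.of A) ⟶ Y.left) : ∃ _ : Algebra F A, ∃ a : specOver F A ⟶ Y, a.left = s := by
  obtain ⟨f, hf⟩ := Spec.map_surjective (s ≫ Y.hom)
  exact ⟨f.hom.toAlgebra, Over.homMk s hf.symm, rfl⟩

theorem exists_rpt_of_opens {V : R.left.Opens} {φ : Module.Dual L N} (hV : V ≤ spanOpens e φ)
    (s : Spec (.of A) ⟶ V.toScheme) (a : specOver F A ⟶ R) (ha : a.left = s ≫ V.ι) :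
    ∃ (v : A ⊗[F] N) (hv : Unimodular (toExt L v)), co v φ = 1 ∧ a = rpt e v hv := by
  refine exists_rpt_of_range_subset e a ?_
  rw [ha]
  rintro _ ⟨z, rfl⟩
  exact hV (s z).2

/-- Generators of the same L-line differ by a unit, and the normalization of v at φ identifies that
unit as the inverse of co w φ. This yields the cocycle condition and the invertibility of the
transition matrices. -/
theorem co_mul_co_of_rpt_eq {v w : A ⊗[F] N} {hv : Unimodular (toExt L v)}
    {hw : Unimodular (toExt L w)} {φ : Module.Dual L N} (hφ : co v φ = 1)
    (h : rpt e v hv = rpt e w hw) (φ' : Module.Dual L N) : co v φ' * co w φ = co w φ' := by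
  obtain ⟨m, hm⟩ := (rpt_eq_iff e _ _ _ _).1 h
  have h1 : ∀ χ, co v χ = (m : L ⊗[F] A) * co w χ := fun χ => by
    rw [co, hm, evalDual_smul]
    rfl
  have h2 := h1 φ
  rw [hφ] at h2
  rw [h1 φ', mul_right_comm, ← h2, one_mul]

theorem toExt_eq_co_smul_of_rpt_eq {v w : A ⊗[F] N} {hv : Unimodular (toExt L v)}
    {hw : Unimodular (toExt L w)} {φ : Module.Dual L N} (hφ : co v φ = 1)
    (h : rpt e w hw = rpt e v hv) : toExt L w = co w φ • toExt L v := by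
  obtain ⟨m, hm⟩ := (rpt_eq_iff e _ _ _ _).1 h
  have h1 : co w φ = (m : L ⊗[F] A) * co v φ := by
    rw [co, hm, evalDual_smul]
    rfl
  rw [h1, hφ, mul_one, hm]

theorem matrix_map_pullFun {n : Type*} {Y : Scheme.{u}} {V W : Y.Opens} (h : V ≤ W)
    (s : Spec (.of A) ⟶ V.toScheme) (g : Matrix n n Γ(Y, W)) :
    (g.map (Y.presheaf.map (homOfLE h).op)).map (pullFun s) =
      g.map (pullFun (s ≫ Y.homOfLE h)) := by
  ext i j
  exact pullFun_homOfLE h s _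

theorem matrix_ext_of_pullFun {n : Type*} {Y : Scheme.{u}} {V : Y.Opens}
    {g g' : Matrix n n Γ(Y, V)} (h : ∀ (A : Type u) [CommRing A]
    (s : Spec (.of A) ⟶ V.toScheme), g.map (pullFun s) = g'.map (pullFun s)) : g = g' := by
  ext i j
  exact pullFun_ext fun A _ s => congrFun (congrFun (h A s) i) j

variable {B : Over (Spec (.of F))} {x : B ⟶ projSpace F N} {y : B ⟶ R}

variable {e} in
/-- The lines contained in an `L`-line form a projective bundle over the Weil restriction. -/
theorem IsUniversalSpanPair.isProjectiveBundle (hB : IsUniversalSpanPair e x y)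
    (Q : Quadratic F L) : IsProjectiveBundle F 1 y := by
  choose g hg using fun (φ φ' : Module.Dual L N) (V : R.left.Opens) (hV : V ≤ spanOpens e φ') =>
    exists_transition e Q φ φ' hV
  choose t ht1 ht2 ht3 using fun φ => hB.exists_chart Q φ
  refine ⟨ULift.{u} (Module.Dual L N), fun i => spanOpens e i.down,
    fun i j => g i.down j.down _ inf_le_right, fun i => (t i.down).left, ?_, ?_, ?_,
    fun i => ht3 i.down, ?_⟩
  · rw [eq_top_iff, ← iSup_spanOpens e Q]
    exact iSup_le fun φ => le_iSup (fun i : ULift.{u} (Module.Dual L N) => spanOpens e i.down) ⟨φ⟩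
  · rintro ⟨φ⟩ ⟨φ'⟩
    -- The inverse is the transition matrix in the other direction: with v and v' normalized at φ
    -- and φ', the product of co v φ' and co v' φ is co v' φ' = 1.
    refine (Matrix.isUnit_iff_isUnit_det _).2 (Matrix.isUnit_det_of_right_inverse
      (B := g φ' φ _ inf_le_left) (matrix_ext_of_pullFun fun A _ s => ?_))
    obtain ⟨_, a, ha⟩ := exists_algebra_of_hom (Y := R) (s ≫ (spanOpens e φ ⊓ spanOpens e φ').ι)
    obtain ⟨v, hv, h1, rfl⟩ := exists_rpt_of_opens e inf_le_left s a ha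
    obtain ⟨v', hv', h1', h2⟩ := exists_rpt_of_opens e inf_le_right s _ ha
    rw [Matrix.map_mul, hg φ φ' _ _ A s v' hv' h1' (ha.symm.trans (by rw [h2])),
      hg φ' φ _ _ A s v hv h1 ha.symm, ← mulMatrix_mul, mul_comm, co_mul_co_of_rpt_eq e h1 h2, h1',
      mulMatrix_one, Matrix.map_one _ (map_zero _) (map_one _)]
  · rintro ⟨φ⟩ ⟨φ'⟩ ⟨φ''⟩
    refine matrix_ext_of_pullFun fun A _ s => ?_
    obtain ⟨_, a, ha⟩ := exists_algebra_of_hom (Y := R)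
      (s ≫ (spanOpens e φ ⊓ spanOpens e φ' ⊓ spanOpens e φ'').ι)
    obtain ⟨v', hv', h1, rfl⟩ := exists_rpt_of_opens e (inf_le_left.trans inf_le_right) s a ha
    obtain ⟨v, hv, h1', h2⟩ := exists_rpt_of_opens e inf_le_right s _ ha
    rw [Matrix.map_mul, matrix_map_pullFun, matrix_map_pullFun, matrix_map_pullFun,
      hg φ φ' _ _ A _ v' hv' h1 (by rw [Category.assoc, Scheme.homOfLE_ι, ← ha]),
      hg φ' φ'' _ _ A _ v hv h1' (by rw [Category.assoc, Scheme.homOfLE_ι, ← ha, h2]),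
      hg φ φ'' _ _ A _ v hv h1' (by rw [Category.assoc, Scheme.homOfLE_ι, ← ha, h2]),
      ← mulMatrix_mul, co_mul_co_of_rpt_eq e h1 h2]
  · rintro ⟨φ⟩ ⟨φ'⟩ A _ _ s u hu hgu a b ha1 ha2 hb1 hb2
    let a' : specOver F A ⟶ bundleChart e φ := Over.homMk a (by
      refine Eq.trans (congrArg (a ≫ ·) (pullback.condition)) ?_
      refine (Category.assoc _ _ _).symm.trans ((congrArg (· ≫ _) ha2).trans (Over.w _)))
    let b' : specOver F A ⟶ bundleChart e φ' := Over.homMk b (by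
      refine Eq.trans (congrArg (b ≫ ·) (pullback.condition)) ?_
      refine (Category.assoc _ _ _).symm.trans ((congrArg (· ≫ _) hb2).trans (Over.w _)))
    have ha : (a' ≫ bundleChartFst e φ).left = s ≫ (spanOpens e φ ⊓ spanOpens e φ').ι := by
      refine (Category.assoc _ _ _).symm.trans ((congrArg (· ≫ (spanOpens e φ).ι) ha1).trans ?_)
      rw [Category.assoc, Scheme.homOfLE_ι]
    have hb : (b' ≫ bundleChartFst e φ').left = s ≫ (spanOpens e φ ⊓ spanOpens e φ').ι := by
      refine (Category.assoc _ _ _).symm.trans ((congrArg (· ≫ (spanOpens e φ').ι) hb1).trans ?_)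
      rw [Category.assoc, Scheme.homOfLE_ι]
    have hab : a' ≫ bundleChartFst e φ = b' ≫ bundleChartFst e φ' :=
      Over.OverMorphism.ext (ha.trans hb.symm)
    obtain ⟨v, hv, h1, h2⟩ := exists_rpt_of_opens e inf_le_left s _ ha
    obtain ⟨v', hv', h1', h2'⟩ := exists_rpt_of_opens e inf_le_right s _ hb
    have h3 : rpt e v' hv' = rpt e v hv := h2'.symm.trans (hab.symm.trans h2)
    obtain ⟨w, hw⟩ := toExt_surjective (Q.lam u • toExt L v')
    have hw' := unimodular_of_toExt_eq_lam_smul Q hu h1' hw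
    have h4 : b' ≫ bundleChartLine e φ' Q = point w hw' :=
      comp_bundleChartLine e φ' Q hw' h1' h2' (Over.OverMorphism.ext hb2) hw
    have h5 : a' ≫ bundleChartLine e φ Q = point w hw' := by
      refine comp_bundleChartLine e φ Q hw' h1 h2 (Over.OverMorphism.ext ha2) ?_
      -- Since v' = co v' φ • v, the vector w equals `Q.lam u` · co v' φ times v, and the transition
      -- matrix applied to u gives the coordinates of this factor.
      rw [hg φ φ' _ _ A s v' hv' h1' (by rw [← hb, h2']), lam_mulMatrix_mulVec, hw,
        toExt_eq_co_smul_of_rpt_eq e h1 h3, smul_smul, mul_comm]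
    have h6 : a' ≫ t φ = b' ≫ t φ' := hB.hom_ext
      (by rw [Category.assoc, Category.assoc, ht1, ht1, h4, h5])
      (by rw [Category.assoc, Category.assoc, ht2, ht2, hab])
    exact congrArg (fun z => z.left) h6

end

/-! ### Comparison with an arbitrary blow-up -/

section

open Opposite Quadratic

variable {F L N : Type u} [Field F] [CommRing L] [Algebra F L]
variable [AddCommGroup N] [Module F N] [Module L N] [IsScalarTower F L N]
variable [Module.Free L N] [Module.Finite L N] [Module.Free F N] [Module.Finite F N]
variable [Module.Finite F L] [_root_.IsReduced L]
variable {R : Over (Spec (.of F))} {e : (weilFunctor F L (projSpace L N)).RepresentableBy R}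

/-- Every blow-up of the degeneracy locus is a universal pair. -/
theorem IsBlowup.isUniversalSpanPair (Q : Quadratic F L) {B : Scheme.{u}}
    {π : B ⟶ (projSpace F N).left} (hπ : IsBlowup (annIdeal F L N) π)
    {g : Over.mk (π ≫ (projSpace F N).hom) ⟶ R} (hg : IsSpanPair e (Over.homMk π) g) :
    IsUniversalSpanPair e (Over.homMk π) g := by
  obtain ⟨B', x, y, hB⟩ := exists_isUniversalSpanPair e Q
  let p : Over.mk (π ≫ (projSpace F N).hom) ⟶ projSpace F N := Over.homMk π
  obtain ⟨i, ⟨hi1, hi2⟩, -⟩ := hB.existsUnique p g hg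
  obtain ⟨j, hj, -⟩ := hπ.existsUnique_lift B'.left x.left (hB.isInvertibleIdeal Q)
  let j' : B' ⟶ Over.mk (π ≫ (projSpace F N).hom) := Over.homMk j (by
    change j ≫ π ≫ _ = _
    rw [reassoc_of% hj, Over.w])
  have hj1 : j' ≫ p = x := Over.OverMorphism.ext hj
  have hj2 : j' ≫ g = y := by
    refine (existsUnique_isSpanPair e Q (hB.isInvertibleIdeal Q)).unique ?_ hB.isSpanPair
    rw [← hj1]
    exact hg.comp e j'
  -- An endomorphism of the blow-up over the projective space is the identity, by the universal
  -- property applied to π itself. The other composite is not needed, since uniqueness is inherited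
  -- from B'.
  have hij : i ≫ j' = 𝟙 _ := Over.OverMorphism.ext
    ((hπ.existsUnique_lift B π hπ.isInvertible).unique
      (congrArg (fun z => z.left) (show (i ≫ j') ≫ p = p by rw [Category.assoc, hj1, hi1]))
      (Category.id_comp _))
  refine ⟨hg, fun x' y' h => ?_⟩
  obtain ⟨t, ⟨ht1, ht2⟩, -⟩ := hB.existsUnique x' y' h
  refine ⟨t ≫ j', ⟨(Category.assoc _ _ _).trans ((congrArg (t ≫ ·) hj1).trans ht1),
    (Category.assoc _ _ _).trans ((congrArg (t ≫ ·) hj2).trans ht2)⟩, ?_⟩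
  rintro t' ⟨ht1', ht2'⟩
  have h1 : t' ≫ i = t := hB.hom_ext (by rw [Category.assoc, hi1, ht1]; exact ht1')
    (by rw [Category.assoc, hi2, ht2, ht2'])
  rw [← h1, Category.assoc, hij, Category.comp_id]

end

end LineSpan

/-! ### The main theorem -/

theorem mainTheorem4 (F L N : Type u) [Field F] [CommRing L] [Algebra F L] [Algebra.Etale F L]
    (hL : Module.finrank F L = 2) [AddCommGroup N] [Module F N] [Module L N]
    [IsScalarTower F L N] [Module.Free L N] [Module.Finite L N] :
    -- the Weil restriction `ℙ(N, L)` of `ℙ_L(N)` and the blow-up of `ℙ_F(N)` along `S(N)` exist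
    (LineSpan.weilFunctor F L (LineSpan.projSpace L N)).IsRepresentable ∧
    (∃ (B : Scheme.{u}) (π : B ⟶ (LineSpan.projSpace F N).left),
      LineSpan.IsBlowup (LineSpan.annIdeal F L N) π) ∧
    ∀ (R : Over (Spec (.of F)))
      (e : (LineSpan.weilFunctor F L (LineSpan.projSpace L N)).RepresentableBy R),
      ∃ (U : (LineSpan.projSpace F N).left.Opens)
        (f : Over.mk (U.ι ≫ (LineSpan.projSpace F N).hom) ⟶ R),
        LineSpan.IsLineSpanMap e U f ∧
        ∀ (B : Scheme.{u}) (π : B ⟶ (LineSpan.projSpace F N).left),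
          LineSpan.IsBlowup (LineSpan.annIdeal F L N) π →
          ∃ g : Over.mk (π ≫ (LineSpan.projSpace F N).hom) ⟶ R,
            LineSpan.Extends f π g ∧
            (∀ g' : Over.mk (π ≫ (LineSpan.projSpace F N).hom) ⟶ R,
              LineSpan.Extends f π g' → g' = g) ∧
            LineSpan.IsProjectiveBundle F 1 g := by
  obtain ⟨Q⟩ := LineSpan.exists_quadratic F L hL
  have : Module.Finite F L := Module.finite_of_finrank_pos (by rw [hL]; norm_num)
  have : Module.Finite F N := Module.Finite.trans L N
  have : IsReduced L := Algebra.FormallyUnramified.isReduced_of_field F L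
  have hrep := LineSpan.isRepresentable_weilFunctor (N := N) Q
  refine ⟨hrep, ?_, fun R e => ?_⟩
  · obtain ⟨R, ⟨e⟩⟩ := hrep
    obtain ⟨B, x, y, hB⟩ := LineSpan.exists_isUniversalSpanPair e Q
    exact ⟨B.left, x.left, hB.isBlowup Q⟩
  · obtain ⟨U, f, hf⟩ := LineSpan.exists_isLineSpanMap e Q
    refine ⟨U, f, hf, fun B π hπ => ?_⟩
    -- S(N) is Cartier on the blow-up, so the tautological lines lie in a unique family of L-lines;
    -- this family is g.
    obtain ⟨g, hg, -⟩ := LineSpan.existsUnique_isSpanPair e Q (x := (Over.homMk π :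
      Over.mk (π ≫ (LineSpan.projSpace F N).hom) ⟶ LineSpan.projSpace F N)) hπ.isInvertible
    have hE := LineSpan.IsSpanPair.extends Q hf hg
    exact ⟨g, hE, fun g' hg' => LineSpan.Extends.unique Q hf hπ.isInvertible hE hg',
      (hπ.isUniversalSpanPair Q hg).isProjectiveBundle Q⟩
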